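/- Let $k$ be a field of characteristic $0$. **Topological vertex algebras.** A $\mathbb{Z}_{\ge 0}$-graded vertex superalgebra over $k$ is a superspace $V=\bigoplus_{s\ge 0}V^s$ with a vacuum $\mathbf 1\in V^0_{ev}$ and bilinear products ${}_{(n)}$, $n\in\mathbb Z$, such that $V^i{}_{(n)}V^j\subset V^{i+j-n-1}$, $p(a_{(n)}b)=p(a)+p(b)$, $\mathbf 1_{(n)}a=\delta_{n,-1}a$, $a_{(-1)}\mathbf 1=a$, $a_{(n)}\mathbf 1=0$ for $n\ge 0$, and the Borcherds identity holds. It is a topological vertex algebra if it is equipped with elements $L\in V^2_{ev}$, $G\in V^2_{odd}$, $Q\in V^1_{odd}$, $J\in V^1_{ev}$ such that $Q_{(0)}^2=0=G_{(1)}^2$ and $[Q_{(0)},G_{(i)}]=L_{(i)}$ for all $i$; $L_{(1)}$ and $J_{(0)}$ are commuting diagonalizable operators, $L_{(1)}$ acting on $V^s$ as $s$, and $J_{(0)}$ having integral eigenvalues, the eigenvalue $n$ being the fermionic degree $|v|=n$, which modulo $2$ is the parity; and $L,G,Q,J$ have fermionic degrees $0,-1,1,0$. Put $$x\bullet y=x_{(-1)}y,\qquad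 \{x,y\}=(-1)^{|x|}(G_{(0)}x)_{(0)}y,$$ $$x\cdot y=\tfrac12\bigl(x_{(-1)}y+(-1)^{|x||y|}y_{(-1)}x\bigr),\qquad (-1)^{|x|}[x,y]=\tfrac12\bigl((G_{(0)}x)_{(0)}y+(-1)^{|x||y|}(G_{(0)}y)_{(0)}x\bigr).$$ **$G_\infty$ structures.** A Gerstenhaber algebra is a graded vector space with a graded commutative associative product of degree $0$ and a bracket of degree $-1$ that is a graded Lie bracket on $W[1]$, where $W[1]_n=W_{n+1}$, and for which every $[a,-]$ is a derivation of the product. A $G_\infty$ structure on a graded vector space $V$ is a square-zero linear map $D$ of degree $1$ of the cofree conilpotent Gerstenhaber coalgebra $C(V)$ cogenerated by $V[2]$ which is a coderivation for both the coproduct (degree $0$) and the cobracket (degree $-1$); for finite-dimensional $V$ this is dual to a derivation of the free Gerstenhaber algebra $\bigwedge^\bullet\bigl((\mathrm{Lie}\,V[1]^*)[-1]\bigr)$. It is determined by its corestriction $C(V)\to V$; write $m_{(l)}$ for the restriction of the corestriction to the part of length $l$ (that is, $l$ cogenerators). Thus $m_{(1)}$ is a map $m_1\colon V\to V$, $m_{(2)}$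 consists of a product $m_2$ and a bracket $m_{1,1}$, and the $m_{(l)}$ with $l\ge 3$ are the higher operations. **Theorem.** Let $V$ be a $\mathbb{Z}_{\ge 0}$-graded topological vertex algebra over $k$ such that for every $s$ only finitely many fermionic degrees occur in $V^s$. Then $V$, graded by the fermionic degree, carries a $G_\infty$ structure $D$ that preserves the conformal weight, such that: 1. $m_1=Q_{(0)}$, $m_2(x,y)=x\cdot y$ and $m_{1,1}(x,y)=[x,y]$; 2. $(V^0,\cdot,[\,,])$ is a Gerstenhaber algebra, and all higher operations vanish on inputs from $V^0$, so that $D$ extends this Gerstenhaber structure (with differential $Q_{(0)}$) on $V^0$; 3. explicitly, on inputs of total conformal weight $s>0$ and for $l\ge 3$ the higher operations are given by the recursion $$m_{(l)}=\tfrac1s\,G_{(1)}\circ\Gamma_l,\qquad \Gamma_l=-\sum_{j=2}^{l-1}m_{(j)}\circ D_l^{\,j},$$ where $D_l^{\,j}$ is the component of $D$ from length $l$ to length $j$ (for $j\ge 2$ it depends only on the $m_{(i)}$ with $i<l$); 4. $\bullet$, $\{\,,\}$, $\cdot$ and $[\,,]$ all pass to the BRST cohomology $H^*(V,Q_{(0)})$,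 where $\cdot$ induces the same product as $\bullet$ and $[\,,]$ the same bracket as $\{\,,\}$, and these make $H^*(V,Q_{(0)})$ a Gerstenhaber algebra (the Lian–Zuckerman structure). In particular the Lian–Zuckerman conjecture holds for this class of vertex algebras. -/

import Mathlib

open scoped TensorProduct DirectSum

universe u v

noncomputable section

/-! ## Graded vector spaces and the Koszul sign rule -/

/-- A `ℤ`-grading on a vector space. -/
structure ZGrading (k : Type u) (V : Type v) [Field k] [AddCommGroup V] [Module k V] where
  deg : ℤ → Submodule k V
  internal : DirectSum.IsInternal deg

namespace ZGrading

variable {k : Type u} {V : Type v} [Field k] [AddCommGroup V] [Module k V]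

/-- The parity operator `v ↦ (-1) ^ |v| v`. -/
def sign (g : ZGrading k V) : V →ₗ[k] V :=
  (DirectSum.toModule k ℤ V fun n => ((n.negOnePow : ℤ) : k) • (g.deg n).subtype) ∘ₗ
    (LinearEquiv.ofBijective (DirectSum.coeLinearMap g.deg) g.internal).symm.toLinearMap

theorem sign_apply (g : ZGrading k V) {n : ℤ} {x : V} (hx : x ∈ g.deg n) :
    g.sign x = ((n.negOnePow : ℤ) : k) • x := by
  have h : (LinearEquiv.ofBijective (DirectSum.coeLinearMap g.deg) g.internal).symm x =
      DirectSum.lof k ℤ (fun n => g.deg n) n ⟨x, hx⟩ :=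
    (LinearEquiv.symm_apply_eq _).2 (DirectSum.coeLinearMap_lof (A := g.deg) n ⟨x, hx⟩).symm
  simp only [sign, LinearMap.comp_apply, LinearEquiv.coe_coe]
  rw [h, DirectSum.toModule_lof]
  simp

end ZGrading

section Koszul

variable {k : Type u} {X : Type v} [Field k] [AddCommGroup X] [Module k X]

/-- The symmetry `x ⊗ y ↦ (-1) ^ (|x| |y|) y ⊗ x` of a graded space with parity operator `ε`. -/
def koszulFlip (ε : X →ₗ[k] X) : X ⊗[k] X →ₗ[k] X ⊗[k] X :=
  (TensorProduct.comm k X X).toLinearMap ∘ₗ ((2 : k)⁻¹ •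
    (LinearMap.id + TensorProduct.map ε LinearMap.id + TensorProduct.map LinearMap.id ε
      - TensorProduct.map ε ε))

theorem koszulFlip_tmul [CharZero k] (ε : X →ₗ[k] X) {a b : ℤ} {x y : X}
    (hx : ε x = ((a.negOnePow : ℤ) : k) • x) (hy : ε y = ((b.negOnePow : ℤ) : k) • y) :
    koszulFlip ε (x ⊗ₜ y) = (((a * b).negOnePow : ℤ) : k) • (y ⊗ₜ[k] x) := by
  have h2 : (2 : k) ≠ 0 := two_ne_zero
  have key : (2 : k)⁻¹ * (1 + ((a.negOnePow : ℤ) : k) + ((b.negOnePow : ℤ) : k)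
      - ((a.negOnePow : ℤ) : k) * ((b.negOnePow : ℤ) : k)) = (((a * b).negOnePow : ℤ) : k) := by
    rcases Int.even_or_odd a with ha | ha <;> rcases Int.even_or_odd b with hb | hb
    · rw [Int.negOnePow_even _ ha, Int.negOnePow_even _ hb, Int.negOnePow_even _ (ha.mul_right b)]
      field_simp; push_cast; norm_num
    · rw [Int.negOnePow_even _ ha, Int.negOnePow_odd _ hb, Int.negOnePow_even _ (ha.mul_right b)]
      field_simp; push_cast; norm_num
    · rw [Int.negOnePow_odd _ ha, Int.negOnePow_even _ hb, Int.negOnePow_even _ (hb.mul_left a)]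
      field_simp; push_cast; norm_num
    · rw [Int.negOnePow_odd _ ha, Int.negOnePow_odd _ hb, Int.negOnePow_odd _ (ha.mul hb)]
      field_simp; push_cast; norm_num
  rw [← key]
  clear key
  simp only [koszulFlip, LinearMap.comp_apply, LinearMap.smul_apply, LinearMap.add_apply,
    LinearMap.sub_apply, LinearMap.id_apply, TensorProduct.map_tmul, hx, hy, map_smul, map_add,
    map_sub, LinearEquiv.coe_coe, TensorProduct.comm_tmul, ← TensorProduct.smul_tmul',
    TensorProduct.tmul_smul]
  module

/-- The Koszul-signed exchange of the first two factors of `X ⊗ (X ⊗ X)`. -/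
def koszulFlip₁₂ (ε : X →ₗ[k] X) : X ⊗[k] (X ⊗[k] X) →ₗ[k] X ⊗[k] (X ⊗[k] X) :=
  (TensorProduct.assoc k X X X).toLinearMap ∘ₗ TensorProduct.map (koszulFlip ε) LinearMap.id ∘ₗ
    (TensorProduct.assoc k X X X).symm.toLinearMap

/-- The Koszul-signed cyclic permutation `x ⊗ y ⊗ z ↦ ± z ⊗ x ⊗ y`. -/
def koszulCycle (ε : X →ₗ[k] X) : X ⊗[k] (X ⊗[k] X) →ₗ[k] X ⊗[k] (X ⊗[k] X) :=
  koszulFlip₁₂ ε ∘ₗ TensorProduct.map LinearMap.id (koszulFlip ε)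

end Koszul

/-- A Gerstenhaber algebra: a graded vector space with a graded commutative associative product of
degree `0` and a bracket of degree `-1` which is a graded Lie bracket on the desuspension
`W[1]` (so that `x ∈ W_a` has degree `a - 1` there) and such that every `[x, -]` is a derivation of
the product. -/
structure IsGerstenhaberAlgebra {k : Type u} {W : Type v} [Field k] [AddCommGroup W] [Module k W]
    (deg : ℤ → Submodule k W) (mul brac : W →ₗ[k] W →ₗ[k] W) : Prop where
  internal : DirectSum.IsInternal deg
  mul_mem : ∀ a b : ℤ, ∀ x ∈ deg a, ∀ y ∈ deg b, mul x y ∈ deg (a + b)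
  mul_comm : ∀ a b : ℤ, ∀ x ∈ deg a, ∀ y ∈ deg b, mul x y = (a * b).negOnePow • mul y x
  mul_assoc : ∀ x y z : W, mul (mul x y) z = mul x (mul y z)
  brac_mem : ∀ a b : ℤ, ∀ x ∈ deg a, ∀ y ∈ deg b, brac x y ∈ deg (a + b - 1)
  brac_skew : ∀ a b : ℤ, ∀ x ∈ deg a, ∀ y ∈ deg b,
    brac x y + ((a - 1) * (b - 1)).negOnePow • brac y x = 0
  jacobi : ∀ a b c : ℤ, ∀ x ∈ deg a, ∀ y ∈ deg b, ∀ z ∈ deg c,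
    brac (brac x y) z
      + ((a - 1) * (b - 1) + (a - 1) * (c - 1)).negOnePow • brac (brac y z) x
      + ((a - 1) * (c - 1) + (b - 1) * (c - 1)).negOnePow • brac (brac z x) y = 0
  leibniz : ∀ a b c : ℤ, ∀ x ∈ deg a, ∀ y ∈ deg b, ∀ z ∈ deg c,
    brac x (mul y z) = mul (brac x y) z + ((a - 1) * b).negOnePow • mul y (brac x z)

/-! ## The cofree Gerstenhaber coalgebra

A Gerstenhaber coalgebra has a coproduct `Δ` of degree `0` and a cobracket `δ` of degree `-1`.  The
cofree conilpotent coalgebra on `V[2]` with two binary cooperations subject to no relation at all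
has as underlying space the sum, over all planar binary trees with nodes of two kinds, of the
tensor powers of `V`; a cooperation cuts a tree at its root.  The cofree conilpotent Gerstenhaber
coalgebra on `V[2]` is its largest subcoalgebra in which the dual Gerstenhaber identities hold.
For finite-dimensional `V` it is the graded dual of the free Gerstenhaber algebra
`G(V[1]^*) = ⋀ (Lie (V[1]^*) [-1])`. -/

/-- The two cooperations. -/
inductive Cooperation : Type
  | coproduct : Cooperation
  | cobracket : Cooperation
  deriving DecidableEq

/-- Planar binary trees, each node being labelled by one of the two cooperations. -/
inductive CoTree : Type
  | leaf : CoTree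
  | node : Cooperation → CoTree → CoTree → CoTree
  deriving DecidableEq

namespace CoTree

/-- Number of leaves. -/
def leaves : CoTree → ℕ
  | leaf => 1
  | node _ l r => l.leaves + r.leaves

/-- Number of nodes labelled by the cobracket. -/
def cobrackets : CoTree → ℕ
  | leaf => 0
  | node .coproduct l r => l.cobrackets + r.cobrackets
  | node .cobracket l r => l.cobrackets + r.cobrackets + 1

end CoTree

/-- Trees with leaves decorated by vectors of `V`. -/
def TreeSpace (k : Type u) (V : Type v) [Field k] [AddCommGroup V] [Module k V] : Type (max u v) :=
  ⨁ t : CoTree, ⨂[k]^t.leaves V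

namespace TreeSpace

variable {k : Type u} {V : Type v} [Field k] [AddCommGroup V] [Module k V]

instance : AddCommGroup (TreeSpace k V) :=
  inferInstanceAs (AddCommGroup (⨁ t : CoTree, ⨂[k]^t.leaves V))

instance : Module k (TreeSpace k V) :=
  inferInstanceAs (Module k (⨁ t : CoTree, ⨂[k]^t.leaves V))

/-- The tree `t` with leaves decorated by a tensor. -/
def tree (t : CoTree) : (⨂[k]^t.leaves V) →ₗ[k] TreeSpace k V :=
  DirectSum.lof k CoTree (fun t => ⨂[k]^t.leaves V) t

/-- The linear map out of the space of trees with the given restriction to each tree. -/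
def treeLift {N : Type*} [AddCommGroup N] [Module k N] (f : ∀ t : CoTree, (⨂[k]^t.leaves V) →ₗ[k] N) :
    TreeSpace k V →ₗ[k] N :=
  DirectSum.toModule k CoTree N f

theorem treeLift_tree {N : Type*} [AddCommGroup N] [Module k N]
    (f : ∀ t : CoTree, (⨂[k]^t.leaves V) →ₗ[k] N) (t : CoTree) (x : ⨂[k]^t.leaves V) :
    treeLift f (tree t x) = f t x :=
  DirectSum.toModule_lof (R := k) (M := fun t : CoTree => ⨂[k]^t.leaves V) (N := N) (φ := f) t x

/-- The tree `t` with leaves decorated by vectors. -/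
def pureTree (t : CoTree) (v : Fin t.leaves → V) : TreeSpace k V :=
  tree t (PiTensorProduct.tprod k v)

/-- The cooperations cut a tree at its root. -/
def split (o : Cooperation) : TreeSpace k V →ₗ[k] TreeSpace k V ⊗[k] TreeSpace k V :=
  treeLift fun t =>
    match t with
    | .leaf => 0
    | .node o' l r =>
      if o' = o then
        TensorProduct.map (tree l) (tree r) ∘ₗ (TensorPower.mulEquiv (R := k) (M := V)).symm.toLinearMap
      else 0

/-- The projection to the cogenerators. -/
def toLeaf : TreeSpace k V →ₗ[k] V :=
  treeLift fun t =>
    match t with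
    | .leaf =>
      (PiTensorProduct.subsingletonEquiv (R := k) (s := fun _ : Fin 1 => V) 0).toLinearMap
    | .node _ _ _ => 0

/-- A vector as a one-leaf tree. -/
def single (v : V) : TreeSpace k V := pureTree .leaf fun _ => v

/-- The tree with one node and leaves decorated by `v` and `w`. -/
def pair (o : Cooperation) (v w : V) : TreeSpace k V := pureTree (.node o .leaf .leaf) ![v, w]

/-- The projection to the trees with `j` leaves. -/
def lengthProj (j : ℕ) : TreeSpace k V →ₗ[k] TreeSpace k V :=
  treeLift fun t => if t.leaves = j then tree t else 0

/-- The subspace of length `j`. -/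
def length (j : ℕ) : Submodule k (TreeSpace k V) :=
  Submodule.span k {x | ∃ (t : CoTree) (v : Fin t.leaves → V), t.leaves = j ∧ x = pureTree t v}

/-- The subspace of degree `n`: the cogenerators are `V[2]`, and `δ` has degree `-1`. -/
def degree (g : ZGrading k V) (n : ℤ) : Submodule k (TreeSpace k V) :=
  Submodule.span k {x | ∃ (t : CoTree) (v : Fin t.leaves → V) (d : Fin t.leaves → ℤ),
    (∀ i, v i ∈ g.deg (d i)) ∧ ∑ i, (d i - 2) + t.cobrackets = n ∧ x = pureTree t v}

/-- For an auxiliary grading `wt` of `V`, the subspace of total weight `s`. -/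
def weight (wt : ℤ → Submodule k V) (s : ℤ) : Submodule k (TreeSpace k V) :=
  Submodule.span k {x | ∃ (t : CoTree) (v : Fin t.leaves → V) (d : Fin t.leaves → ℤ),
    (∀ i, v i ∈ wt (d i)) ∧ ∑ i, d i = s ∧ x = pureTree t v}

/-- The parity operator on decorated trees. -/
def sign (g : ZGrading k V) : TreeSpace k V →ₗ[k] TreeSpace k V :=
  treeLift fun t =>
    tree t ∘ₗ ((-1 : k) ^ t.cobrackets • PiTensorProduct.map fun _ => g.sign)

/-- A subcoalgebra in which the dual Gerstenhaber identities hold.  By the Koszul rule the map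
`1 ⊗ δ` sends `x ⊗ y` to `(-1) ^ |x| x ⊗ δ y`. -/
structure IsGerstenhaberSubcoalgebra (g : ZGrading k V) (S : Submodule k (TreeSpace k V)) :
    Prop where
  closed : ∀ o, ∀ x ∈ S, split o x ∈ LinearMap.range (TensorProduct.mapIncl S S)
  cocommutative : ∀ x ∈ S, koszulFlip (sign g) (split .coproduct x) = split .coproduct x
  coassociative : ∀ x ∈ S,
    TensorProduct.assoc k _ _ _
        (TensorProduct.map (split .coproduct) LinearMap.id (split .coproduct x)) =
      TensorProduct.map LinearMap.id (split .coproduct) (split .coproduct x)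
  cosymmetric : ∀ x ∈ S, koszulFlip (sign g) (split .cobracket x) = split .cobracket x
  coJacobi : ∀ x ∈ S, ∀ y, y = TensorProduct.assoc k _ _ _
        (TensorProduct.map (split .cobracket) LinearMap.id (split .cobracket x)) →
      y + koszulCycle (sign g) y + koszulCycle (sign g) (koszulCycle (sign g) y) = 0
  coLeibniz : ∀ x ∈ S,
    TensorProduct.map LinearMap.id (split .coproduct) (split .cobracket x) =
      TensorProduct.assoc k _ _ _
          (TensorProduct.map (split .cobracket) LinearMap.id (split .coproduct x))
        + koszulFlip₁₂ (sign g)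
          (TensorProduct.map (sign g) (split .cobracket) (split .coproduct x))

end TreeSpace

open TreeSpace

variable {k : Type u} {V : Type v} [Field k] [AddCommGroup V] [Module k V]

/-- The cofree conilpotent Gerstenhaber coalgebra on `V[2]`, as a subspace of `TreeSpace k V`. -/
def gerCofree (g : ZGrading k V) : Submodule k (TreeSpace k V) :=
  sSup {S | IsGerstenhaberSubcoalgebra g S}

theorem split_mem_gerCofree (g : ZGrading k V) (o : Cooperation) {x : TreeSpace k V}
    (hx : x ∈ gerCofree g) :
    split o x ∈ LinearMap.range (TensorProduct.mapIncl (gerCofree g) (gerCofree g)) := by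
  have h : gerCofree g ≤ (LinearMap.range
      (TensorProduct.mapIncl (gerCofree g) (gerCofree g))).comap (split o) := by
    refine sSup_le fun S hS x hx => ?_
    have hle : S ≤ gerCofree g := le_sSup hS
    obtain ⟨y, hy⟩ := hS.closed o x hx
    refine ⟨TensorProduct.map (Submodule.inclusion hle) (Submodule.inclusion hle) y, ?_⟩
    rw [← hy, TensorProduct.mapIncl, TensorProduct.mapIncl, ← LinearMap.comp_apply,
      ← TensorProduct.map_comp]
    rfl
  exact h hx

theorem gerCofree_isGerstenhaberSubcoalgebra (g : ZGrading k V) :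
    IsGerstenhaberSubcoalgebra g (gerCofree g) := by
  have key : ∀ T : Submodule k (TreeSpace k V),
      (∀ S, IsGerstenhaberSubcoalgebra g S → S ≤ T) → gerCofree g ≤ T := fun T h => sSup_le h
  refine ⟨fun o x hx => split_mem_gerCofree g o hx, ?_, ?_, ?_, ?_, ?_⟩
  · exact fun x hx => key (LinearMap.eqLocus (koszulFlip (TreeSpace.sign g) ∘ₗ split .coproduct)
      (split .coproduct)) (fun S hS x hx => hS.cocommutative x hx) hx
  · exact fun x hx => key (LinearMap.eqLocus
      ((TensorProduct.assoc k _ _ _).toLinearMap ∘ₗ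
        TensorProduct.map (split .coproduct) LinearMap.id ∘ₗ split .coproduct)
      (TensorProduct.map LinearMap.id (split .coproduct) ∘ₗ split .coproduct))
      (fun S hS x hx => hS.coassociative x hx) hx
  · exact fun x hx => key (LinearMap.eqLocus (koszulFlip (TreeSpace.sign g) ∘ₗ split .cobracket)
      (split .cobracket)) (fun S hS x hx => hS.cosymmetric x hx) hx
  · rintro x hx y rfl
    exact key (LinearMap.ker
      ((LinearMap.id + koszulCycle (TreeSpace.sign g)
        + koszulCycle (TreeSpace.sign g) ∘ₗ koszulCycle (TreeSpace.sign g)) ∘ₗ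
        (TensorProduct.assoc k _ _ _).toLinearMap ∘ₗ
        TensorProduct.map (split .cobracket) LinearMap.id ∘ₗ split .cobracket))
      (fun S hS x hx => LinearMap.mem_ker.2 (hS.coJacobi x hx _ rfl)) hx
  · exact fun x hx => key (LinearMap.eqLocus
      (TensorProduct.map LinearMap.id (split .coproduct) ∘ₗ split .cobracket)
      ((TensorProduct.assoc k (TreeSpace k V) (TreeSpace k V) (TreeSpace k V)).toLinearMap ∘ₗ
        TensorProduct.map (split .cobracket) LinearMap.id ∘ₗ split .coproduct
        + koszulFlip₁₂ (TreeSpace.sign g) ∘ₗ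
          TensorProduct.map (TreeSpace.sign g) (split .cobracket) ∘ₗ split .coproduct))
      (fun S hS x hx => LinearMap.mem_eqLocus.2 (hS.coLeibniz x hx)) hx

theorem gerCofree_incl_injective (g : ZGrading k V) :
    Function.Injective (TensorProduct.mapIncl (gerCofree g) (gerCofree g)) :=
  TensorProduct.map_injective_of_flat_flat _ _
    (gerCofree g).injective_subtype (gerCofree g).injective_subtype

/-- The coproduct and the cobracket of the cofree Gerstenhaber coalgebra. -/
def cooperation (g : ZGrading k V) (o : Cooperation) :
    gerCofree g →ₗ[k] gerCofree g ⊗[k] gerCofree g :=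
  (LinearEquiv.ofInjective _ (gerCofree_incl_injective g)).symm.toLinearMap ∘ₗ
    LinearMap.codRestrict _ (split o ∘ₗ (gerCofree g).subtype)
      fun x => split_mem_gerCofree g o x.2

theorem mapIncl_cooperation (g : ZGrading k V) (o : Cooperation) (x : gerCofree g) :
    TensorProduct.mapIncl _ _ (cooperation g o x) = split o (x : TreeSpace k V) := by
  have := LinearEquiv.ofInjective_symm_apply (f := TensorProduct.mapIncl (gerCofree g) (gerCofree g))
    (h := gerCofree_incl_injective g) ⟨split o (x : TreeSpace k V), split_mem_gerCofree g o x.2⟩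
  exact this

/-- The extension `D ⊗ 1 + 1 ⊗ D` of an odd linear map `D`, with the Koszul sign
`(1 ⊗ D) (x ⊗ y) = (-1) ^ |x| x ⊗ D y`, followed by the inclusion into the tensor square of
`TreeSpace k V`. -/
def oddLeibniz (g : ZGrading k V) (D : gerCofree g →ₗ[k] gerCofree g) :
    gerCofree g ⊗[k] gerCofree g →ₗ[k] TreeSpace k V ⊗[k] TreeSpace k V :=
  TensorProduct.map ((gerCofree g).subtype ∘ₗ D) (gerCofree g).subtype
    + TensorProduct.map (TreeSpace.sign g ∘ₗ (gerCofree g).subtype) ((gerCofree g).subtype ∘ₗ D)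

/-- A `G_∞` structure on a graded vector space `V`: a square-zero linear map of degree `1` of the
cofree conilpotent Gerstenhaber coalgebra on `V[2]` which is a coderivation for the coproduct and
for the cobracket (the latter has odd degree, hence the sign). -/
structure GInfinityStructure (g : ZGrading k V) where
  D : gerCofree g →ₗ[k] gerCofree g
  degree_one : ∀ (n : ℤ) (x : gerCofree g), (x : TreeSpace k V) ∈ TreeSpace.degree g n →
    (D x : TreeSpace k V) ∈ TreeSpace.degree g (n + 1)
  square_zero : ∀ x, D (D x) = 0
  coderivation_coproduct : ∀ x : gerCofree g,
    split .coproduct (D x : TreeSpace k V) = oddLeibniz g D (cooperation g .coproduct x)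
  coderivation_cobracket : ∀ x : gerCofree g,
    split .cobracket (D x : TreeSpace k V) = - oddLeibniz g D (cooperation g .cobracket x)

namespace GInfinityStructure

variable {g : ZGrading k V} (γ : GInfinityStructure g)

/-- The structure map `gerCofree g → V` with components `m_{p₁,…,p_t}`, which determines `γ.D`. -/
def operation : gerCofree g →ₗ[k] V := toLeaf ∘ₗ (gerCofree g).subtype ∘ₗ γ.D

/-- The operation `m_1` of the structure is `d`. -/
def HasDifferential (d : V →ₗ[k] V) : Prop :=
  ∀ v : V, ∃ h : single v ∈ gerCofree g, γ.operation ⟨single v, h⟩ = d v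

/-- The operation `m_2` of the structure is the graded commutative product `mul`.  The element
below is the one of length two whose cobracket is `v ⊗ w + (-1) ^ (|v| |w|) w ⊗ v` and whose
coproduct vanishes. -/
def HasProduct (mul : V →ₗ[k] V →ₗ[k] V) : Prop :=
  ∀ a b : ℤ, ∀ v ∈ g.deg a, ∀ w ∈ g.deg b,
    ∃ h : pair .cobracket v w + (a * b).negOnePow • pair .cobracket w v ∈ gerCofree g,
      γ.operation ⟨_, h⟩ = mul v w

/-- The operation `m_{1,1}` of the structure is the bracket `brac` of degree `-1`.  The element
below is the one of length two whose coproduct is `v ⊗ w + (-1) ^ (|v| |w|) w ⊗ v` and whose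
cobracket vanishes; the sign `(-1) ^ |v|` turns a bracket that is skew on `V[1]` into a map that is
graded symmetric on `V[2]`. -/
def HasBracket (brac : V →ₗ[k] V →ₗ[k] V) : Prop :=
  ∀ a b : ℤ, ∀ v ∈ g.deg a, ∀ w ∈ g.deg b,
    ∃ h : pair .coproduct v w + (a * b).negOnePow • pair .coproduct w v ∈ gerCofree g,
      γ.operation ⟨_, h⟩ = a.negOnePow • brac v w

/-- For `x` of length `l`, the vector `c` is the value at `x` of the obstruction
`Γ_l = - ∑ m_j D_l^j` (the sum over `2 ≤ j ≤ l - 1`), where `D_l^j` is the component of `D` from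
length `l` to length `j` and `m_j` is the restriction of the structure map to length `j`. -/
def IsObstruction (l : ℕ) (x : gerCofree g) (c : V) : Prop :=
  ∃ y : ℕ → gerCofree g,
    (∀ j, (y j : TreeSpace k V) = lengthProj j (γ.D x : TreeSpace k V)) ∧
    c = - ∑ j ∈ Finset.Ico 2 l, γ.operation (y j)

end GInfinityStructure

/-! ## Vertex superalgebras -/

/-- A `ℤ_{≥0}`-graded vertex superalgebra with `comp (i, p)` the subspace of conformal degree `i`
and parity `p`, and `op n a b` the product `a_(n) b`. -/
structure VertexSuperalgebra (k : Type u) (V : Type v) [Field k] [AddCommGroup V] [Module k V] where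
  comp : ℤ × ZMod 2 → Submodule k V
  internal : DirectSum.IsInternal comp
  nonneg : ∀ (i : ℤ) (p : ZMod 2), i < 0 → comp (i, p) = ⊥
  vac : V
  vac_mem : vac ∈ comp (0, 0)
  op : ℤ → V →ₗ[k] V →ₗ[k] V
  op_mem : ∀ (n i j : ℤ) (p q : ZMod 2), ∀ a ∈ comp (i, p), ∀ b ∈ comp (j, q),
    op n a b ∈ comp (i + j - n - 1, p + q)
  vac_op : ∀ (n : ℤ) (a : V), op n vac a = if n = -1 then a else 0
  op_vac : ∀ a : V, op (-1) a vac = a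
  op_vac_nonneg : ∀ n : ℤ, 0 ≤ n → ∀ a : V, op n a vac = 0
  /-- The Borcherds identity; all three sums have only finitely many nonzero terms. -/
  borcherds : ∀ (m n l i j : ℤ) (p q : ZMod 2), ∀ a ∈ comp (i, p), ∀ b ∈ comp (j, q), ∀ c : V,
    ∑ᶠ r : ℕ, Ring.choose m r • op (m + l - r) (op (n + r) a b) c =
      ∑ᶠ r : ℕ, ((-1 : ℤ) ^ r * Ring.choose n r) •
        (op (m + n - r) a (op (l + r) b c)
          - ((n.negOnePow : ℤ) * (-1) ^ (p.val * q.val)) • op (n + l - r) b (op (m + r) a c))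

/-- A `ℤ_{≥0}`-graded topological vertex algebra. -/
structure TopologicalVertexAlgebra (k : Type u) (V : Type v) [Field k] [AddCommGroup V] [Module k V]
    extends VertexSuperalgebra k V where
  L : V
  G : V
  Q : V
  J : V
  L_mem : L ∈ comp (2, 0)
  G_mem : G ∈ comp (2, 1)
  Q_mem : Q ∈ comp (1, 1)
  J_mem : J ∈ comp (1, 0)
  Q_sq : ∀ v, op 0 Q (op 0 Q v) = 0
  G_sq : ∀ v, op 1 G (op 1 G v) = 0
  /-- `[Q_(0), G_(i)] = L_(i)`, the supercommutator of two odd operators. -/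
  Q_G : ∀ (i : ℤ) (v : V), op 0 Q (op i G v) + op i G (op 0 Q v) = op i L v
  L_J_comm : ∀ v, op 1 L (op 0 J v) = op 0 J (op 1 L v)
  /-- `L_(1)` acts on the part of conformal degree `s` by `s`. -/
  L_eigen : ∀ (s : ℤ) (p : ZMod 2), ∀ v ∈ comp (s, p), op 1 L v = (s : k) • v
  /-- `J_(0)` is diagonalizable with integral eigenvalues. -/
  J_diag : ⨆ n : ℤ, Module.End.eigenspace (op 0 J) (n : k) = ⊤
  /-- Modulo 2 the eigenvalue of `J_(0)` is the parity. -/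
  J_parity : ∀ n : ℤ, Module.End.eigenspace (op 0 J) (n : k) ≤ ⨆ s : ℤ, comp (s, (n : ZMod 2))
  /-- The fermionic degrees of `L, G, Q, J` are `0, -1, 1, 0`. -/
  J_L : op 0 J L = 0
  J_G : op 0 J G = -G
  J_Q : op 0 J Q = Q
  J_J : op 0 J J = 0

namespace TopologicalVertexAlgebra

variable [CharZero k] (A : TopologicalVertexAlgebra k V)

/-- The part of conformal degree `s`. -/
def conformal (s : ℤ) : Submodule k V := ⨆ p : ZMod 2, A.comp (s, p)

/-- The fermionic grading. -/
def fermionic : ZGrading k V where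
  deg n := Module.End.eigenspace (A.op 0 A.J) (n : k)
  internal := by
    rw [DirectSum.isInternal_submodule_iff_iSupIndep_and_iSup_eq_top]
    exact ⟨(Module.End.eigenspaces_iSupIndep (A.op 0 A.J)).comp Int.cast_injective, A.J_diag⟩

/-- The BRST differential `Q_(0)`. -/
def differential : V →ₗ[k] V := A.op 0 A.Q

/-- The homotopy `G_(1)`. -/
def homotopy : V →ₗ[k] V := A.op 1 A.G

/-- The Lian-Zuckerman product `x • y = x_(-1) y`. -/
def lzProduct : V →ₗ[k] V →ₗ[k] V := A.op (-1)

/-- The Lian-Zuckerman bracket `{x, y} = (-1) ^ |x| (G_(0) x)_(0) y`. -/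
def lzBracket : V →ₗ[k] V →ₗ[k] V := A.op 0 ∘ₗ A.op 0 A.G ∘ₗ A.fermionic.sign

/-- The symmetrization `(x, y) ↦ (B x y + (-1) ^ (|x| |y|) B y x) / 2`. -/
def symmetrize (B : V →ₗ[k] V →ₗ[k] V) : V →ₗ[k] V →ₗ[k] V :=
  TensorProduct.curry ((2 : k)⁻¹ •
    (TensorProduct.lift B + TensorProduct.lift B ∘ₗ koszulFlip A.fermionic.sign))

/-- The product `x · y = (x_(-1) y + (-1) ^ (|x| |y|) y_(-1) x) / 2`. -/
def product : V →ₗ[k] V →ₗ[k] V := A.symmetrize (A.op (-1))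

/-- The bracket with
`(-1) ^ |x| [x, y] = ((G_(0) x)_(0) y + (-1) ^ (|x| |y|) (G_(0) y)_(0) x) / 2`. -/
def bracket : V →ₗ[k] V →ₗ[k] V := A.symmetrize (A.op 0 ∘ₗ A.op 0 A.G) ∘ₗ A.fermionic.sign

theorem symmetrize_apply (B : V →ₗ[k] V →ₗ[k] V) {a b : ℤ} {x y : V}
    (hx : x ∈ A.fermionic.deg a) (hy : y ∈ A.fermionic.deg b) :
    A.symmetrize B x y = (2 : k)⁻¹ • (B x y + (((a * b).negOnePow : ℤ) : k) • B y x) := by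
  simp only [symmetrize, TensorProduct.curry_apply, LinearMap.smul_apply, LinearMap.add_apply,
    LinearMap.comp_apply, TensorProduct.lift.tmul,
    koszulFlip_tmul _ (A.fermionic.sign_apply hx) (A.fermionic.sign_apply hy), map_smul]

/-- The BRST cohomology `H^*(V, Q_(0))`. -/
abbrev Cohomology : Type v :=
  LinearMap.ker A.differential ⧸ (LinearMap.range A.differential).submoduleOf
    (LinearMap.ker A.differential)

/-- The class of a cocycle. -/
abbrev cls : LinearMap.ker A.differential →ₗ[k] A.Cohomology := Submodule.mkQ _

/-- The part of degree `n` of the BRST cohomology. -/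
def cohomologyDeg (n : ℤ) : Submodule k A.Cohomology :=
  ((A.fermionic.deg n).submoduleOf (LinearMap.ker A.differential)).map A.cls

/-- The operation `mH` on cohomology is induced by the operation `m` on cochains. -/
def Induces (m : V →ₗ[k] V →ₗ[k] V)
    (mH : A.Cohomology →ₗ[k] A.Cohomology →ₗ[k] A.Cohomology) : Prop :=
  ∀ x y : LinearMap.ker A.differential, ∃ h : m x y ∈ LinearMap.ker A.differential,
    mH (A.cls x) (A.cls y) = A.cls ⟨m x y, h⟩

end TopologicalVertexAlgebra

end

/-! Write `q` for `Q_(0)`, `p` for the projection to conformal weight zero, and `h` for `G_(1)`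
divided by the weight `s` (zero in weight zero). Since `[Q_(0), G_(1)] = L_(1)` acts by `s`, one has
`q h + h q = 1 - p`: every part of positive weight is contractible. Weights are non-negative and
additive, so `p` is multiplicative for the binary operations, and in weight zero the Gerstenhaber
identities hold strictly. There all non-negative modes between two elements vanish, so `x_(-1) y` is
graded commutative and associative. The bracket is the defect of `G_(1)` as a derivation of the
product (`preBracket_eq`), and `G_(1)^2 = 0` yields Jacobi (`preBracket_preBracket`), as in
Batalin-Vilkovisky algebra.

On decorated trees a coderivation is freely determined by its corestriction (`coder`). If odd, it
preserves the cofree Gerstenhaber coalgebra, because that is the largest subcoalgebra with the dual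
identities (`mem_gerCofree_of_coderivation`). Hence the structure maps can be built on all trees by
`m_l = h Γ_l` with no symmetry imposed; only `D^2 = 0` has to be tested on the subcoalgebra.

That test is an induction on the length `l` (`D_D_lengthProj`). The square of `D` is a coderivation,
so if it vanishes in smaller lengths its value in length `l` is a single leaf, decorated by `E = q h
Γ - Γ + h Γ d`, where `d` is the length-preserving part of `D`. Commuting `D` with `D^2` gives `q Γ
= Γ d`, and then `E = (q h + h q - 1) Γ = - p Γ`. As `p` kills `h` and all higher operations, `p Γ`
involves only the binary operations in weight zero, and on the cofree coalgebra it vanishes by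
Koszul duality: coassociativity of the coproduct gives the Jacobi terms, co-Jacobi the associativity
terms, co-Leibniz the mixed ones (`IsSymmetricGerstenhaber.quad_coder`, `p_obstruction`). In length
two the statement is that `q` is a derivation of both operations (`ops_q`).

For cohomology, the homotopy makes every cocycle `x` cohomologous to `p x`. So the original
operations, their symmetrizations and the weight-zero operations induce the same maps on classes,
and the last satisfy the identities already on cochains (`ops_sub_zeroOps_mem_range`,
`zeroOps_sub_symmetrize_mem_range`). -/

noncomputable section

namespace Cooperation

/-- The sign `(-1) ^ |o|` of a cooperation: the coproduct is even and the cobracket is odd. -/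
def sgn (k : Type u) [Field k] : Cooperation → k
  | coproduct => 1
  | cobracket => -1

theorem sgn_mul_self (k : Type u) [Field k] (o : Cooperation) : sgn k o * sgn k o = 1 := by
  cases o <;> simp [sgn]

end Cooperation

/-! ### Structural recursion on decorated trees. -/

namespace TreeSpace

open Cooperation

variable {k : Type u} {V : Type v} [Field k] [AddCommGroup V] [Module k V]
variable {N : Type*} [AddCommGroup N] [Module k N]

/-- Vectors as tensors on the one-leaf tree. -/
def leafEquiv : V ≃ₗ[k] ⨂[k]^(CoTree.leaf).leaves V :=
  (PiTensorProduct.subsingletonEquiv (R := k) (s := fun _ : Fin 1 => V) 0).symm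

/-- Concatenation of tensors as tensors on a grafted tree. -/
def nodeEquiv (o : Cooperation) (l r : CoTree) :
    (⨂[k]^l.leaves V) ⊗[k] (⨂[k]^r.leaves V) ≃ₗ[k] ⨂[k]^(CoTree.node o l r).leaves V :=
  TensorPower.mulEquiv (R := k) (M := V)

theorem leafEquiv_apply (v : V) :
    leafEquiv (k := k) v = PiTensorProduct.tprod k (fun _ : Fin (CoTree.leaf).leaves => v) := by
  refine (LinearEquiv.symm_apply_eq _).2 ?_
  exact (PiTensorProduct.subsingletonEquiv_apply_tprod (R := k) (s := fun _ : Fin 1 => V) 0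
    (fun _ => v)).symm

/-- Concatenation of the decorations of two trees. -/
def nodeAppend (o : Cooperation) (l r : CoTree) {α : Type*} (x : Fin l.leaves → α)
    (y : Fin r.leaves → α) : Fin (CoTree.node o l r).leaves → α :=
  Fin.append x y

theorem comp_nodeAppend (o : Cooperation) (l r : CoTree) {α β : Type*} (f : α → β)
    (x : Fin l.leaves → α) (y : Fin r.leaves → α) :
    (fun i => f (nodeAppend o l r x y i)) =
      nodeAppend o l r (fun i => f (x i)) (fun i => f (y i)) := by
  funext i
  refine Fin.addCases (m := l.leaves) (n := r.leaves) (fun i => ?_) (fun i => ?_) i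
  · exact (congrArg f (Fin.append_left x y i)).trans
      (Fin.append_left (fun i => f (x i)) (fun i => f (y i)) i).symm
  · exact (congrArg f (Fin.append_right x y i)).trans
      (Fin.append_right (fun i => f (x i)) (fun i => f (y i)) i).symm

theorem nodeEquiv_tprod (o : Cooperation) (l r : CoTree) (x : Fin l.leaves → V)
    (y : Fin r.leaves → V) :
    nodeEquiv (k := k) o l r (PiTensorProduct.tprod k x ⊗ₜ[k] PiTensorProduct.tprod k y) =
      PiTensorProduct.tprod k (nodeAppend o l r x y) :=
  TensorPower.tprod_mul_tprod k x y

theorem toLeaf_tree_leaf (x : ⨂[k]^(CoTree.leaf).leaves V) :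
    toLeaf (tree .leaf x) = leafEquiv.symm x :=
  treeLift_tree _ CoTree.leaf x

theorem toLeaf_tree_node (o : Cooperation) (l r : CoTree)
    (x : ⨂[k]^(CoTree.node o l r).leaves V) : toLeaf (tree (.node o l r) x) = 0 :=
  treeLift_tree _ (CoTree.node o l r) x

theorem split_tree_leaf (o : Cooperation) (x : ⨂[k]^(CoTree.leaf).leaves V) :
    split o (tree .leaf x) = 0 :=
  treeLift_tree _ CoTree.leaf x

theorem split_tree_node (o o' : Cooperation) (l r : CoTree)
    (x : (⨂[k]^l.leaves V) ⊗[k] (⨂[k]^r.leaves V)) :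
    split o (tree (.node o' l r) (nodeEquiv o' l r x)) =
      if o' = o then TensorProduct.map (tree l) (tree r) x else 0 := by
  refine (treeLift_tree _ (CoTree.node o' l r) (nodeEquiv o' l r x)).trans ?_
  dsimp only
  split_ifs
  · exact congrArg (TensorProduct.map (tree l) (tree r))
      ((TensorPower.mulEquiv (R := k) (M := V)).symm_apply_apply x)
  · rfl

/-- The inclusion of the cogenerators as one-leaf trees. -/
def leafMap : V →ₗ[k] TreeSpace k V := tree .leaf ∘ₗ leafEquiv.toLinearMap

theorem leafMap_eq (v : V) : leafMap (k := k) v = tree .leaf (leafEquiv v) := rfl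

theorem leafMap_apply (v : V) : leafMap (k := k) v = single v := by
  rw [leafMap_eq, leafEquiv_apply]
  rfl

/-- Grafting of two trees on a new root. -/
def join (o : Cooperation) : TreeSpace k V ⊗[k] TreeSpace k V →ₗ[k] TreeSpace k V :=
  TensorProduct.lift (treeLift fun l => (treeLift fun r =>
    (TensorProduct.curry (tree (.node o l r) ∘ₗ (nodeEquiv o l r).toLinearMap)).flip).flip)

theorem join_tree (o : Cooperation) (l r : CoTree) (x : ⨂[k]^l.leaves V) (y : ⨂[k]^r.leaves V) :
    join o (tree l x ⊗ₜ tree r y) = tree (.node o l r) (nodeEquiv o l r (x ⊗ₜ[k] y)) := by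
  simp only [join, TensorProduct.lift.tmul, treeLift_tree, LinearMap.flip_apply]
  rfl

@[elab_as_elim]
theorem induction_tree {P : TreeSpace k V → Prop} (x : TreeSpace k V) (zero : P 0)
    (tree : ∀ (t : CoTree) (x : ⨂[k]^t.leaves V), P (tree t x))
    (add : ∀ x y, P x → P y → P (x + y)) : P x :=
  DirectSum.induction_on (motive := P) x zero tree add

theorem mem_of_tree_mem {W : Submodule k (TreeSpace k V)}
    (h : ∀ (t : CoTree) (x : ⨂[k]^t.leaves V), tree t x ∈ W) (x : TreeSpace k V) : x ∈ W :=
  induction_tree x W.zero_mem h fun _ _ => W.add_mem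

theorem tree_mem {W : Submodule k (TreeSpace k V)} (h1 : ∀ v, leafMap v ∈ W)
    (h2 : ∀ o x y, x ∈ W → y ∈ W → join o (x ⊗ₜ y) ∈ W) :
    ∀ (t : CoTree) (x : ⨂[k]^t.leaves V), tree t x ∈ W
  | .leaf, x => by
    have := h1 (leafEquiv.symm x)
    rwa [leafMap_eq, LinearEquiv.apply_symm_apply] at this
  | .node o l r, x => by
    obtain ⟨z, rfl⟩ := (nodeEquiv o l r).surjective x
    induction z using TensorProduct.induction_on with
    | zero => simp only [map_zero, W.zero_mem]
    | tmul a b =>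
      rw [← join_tree]
      exact h2 _ _ _ (tree_mem h1 h2 l a) (tree_mem h1 h2 r b)
    | add a b ha hb =>
      rw [map_add, map_add]
      exact W.add_mem ha hb

/-- Induction over trees. -/
theorem mem_of_leaf_of_join {W : Submodule k (TreeSpace k V)} (h1 : ∀ v, leafMap v ∈ W)
    (h2 : ∀ o x y, x ∈ W → y ∈ W → join o (x ⊗ₜ y) ∈ W) (x : TreeSpace k V) : x ∈ W :=
  mem_of_tree_mem (tree_mem h1 h2) x

/-- Every tree is grafted from leaves, so later identities are checked on leaves and graftings
without handling tensor powers. -/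
theorem hom_ext {f g : TreeSpace k V →ₗ[k] N} (h1 : ∀ v, f (leafMap v) = g (leafMap v))
    (h2 : ∀ o x y, f x = g x → f y = g y → f (join o (x ⊗ₜ y)) = g (join o (x ⊗ₜ y))) : f = g :=
  LinearMap.ext fun x => mem_of_leaf_of_join (W := LinearMap.eqLocus f g) h1 h2 x

@[simp] theorem toLeaf_leafMap (v : V) : toLeaf (leafMap (k := k) v) = v := by
  rw [leafMap_eq, toLeaf_tree_leaf, LinearEquiv.symm_apply_apply]

@[simp] theorem split_leafMap (o : Cooperation) (v : V) : split o (leafMap (k := k) v) = 0 := by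
  rw [leafMap_eq, split_tree_leaf]

theorem tmul_tree_ext {f g : TreeSpace k V ⊗[k] TreeSpace k V →ₗ[k] N}
    (h : ∀ l r x y, f (tree l x ⊗ₜ tree r y) = g (tree l x ⊗ₜ tree r y)) : f = g := by
  refine TensorProduct.ext' fun x y => ?_
  refine mem_of_tree_mem (W := LinearMap.eqLocus (f ∘ₗ (TensorProduct.mk k _ _).flip y)
    (g ∘ₗ (TensorProduct.mk k _ _).flip y)) (fun l x => ?_) x
  exact mem_of_tree_mem (W := LinearMap.eqLocus (f ∘ₗ TensorProduct.mk k _ _ (tree l x))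
    (g ∘ₗ TensorProduct.mk k _ _ (tree l x))) (fun r y => h l r x y) y

@[simp] theorem toLeaf_join (o : Cooperation) (z : TreeSpace k V ⊗[k] TreeSpace k V) :
    toLeaf (join o z) = 0 := by
  have : toLeaf ∘ₗ join (k := k) (V := V) o = 0 := tmul_tree_ext fun l r x y => by
    rw [LinearMap.comp_apply, join_tree, toLeaf_tree_node]; rfl
  exact LinearMap.congr_fun this z

theorem split_join (o o' : Cooperation) (z : TreeSpace k V ⊗[k] TreeSpace k V) :
    split o (join o' z) = if o' = o then z else 0 := by
  have : split o ∘ₗ join (k := k) (V := V) o' = if o' = o then LinearMap.id else 0 :=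
    tmul_tree_ext fun l r x y => by
      rw [LinearMap.comp_apply, join_tree, split_tree_node]
      split_ifs <;> rfl
  rw [← LinearMap.comp_apply, this]
  split_ifs <;> rfl

@[simp] theorem split_join_self (o : Cooperation) (z : TreeSpace k V ⊗[k] TreeSpace k V) :
    split o (join o z) = z := by
  rw [split_join, if_pos rfl]

/-- A decorated tree is determined by its leaf part and its two cuts at the root. -/
theorem eq_leafMap_add_join (x : TreeSpace k V) :
    x = leafMap (toLeaf x) + join .coproduct (split .coproduct x)
      + join .cobracket (split .cobracket x) := by
  have : LinearMap.id = leafMap ∘ₗ toLeaf + join (k := k) (V := V) .coproduct ∘ₗ split .coproduct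
      + join .cobracket ∘ₗ split .cobracket := by
    refine hom_ext (fun v => ?_) fun o x y _ _ => ?_
    · simp
    · cases o <;> simp [split_join]
  exact LinearMap.congr_fun this x

/-- This is the uniqueness half of cofreeness: by `eq_leafMap_add_join` a tree can be reassembled
from its leaf part and its root cuts. -/
theorem ext_toLeaf_split {x y : TreeSpace k V} (h : toLeaf x = toLeaf y)
    (h' : ∀ o, split o x = split o y) : x = y := by
  rw [eq_leafMap_add_join x, eq_leafMap_add_join y, h, h', h']

section sign

variable (g : ZGrading k V)

theorem sign_tree (t : CoTree) (x : ⨂[k]^t.leaves V) :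
    sign g (tree t x) =
      (-1 : k) ^ t.cobrackets • tree t (PiTensorProduct.map (fun _ => g.sign) x) := by
  rw [sign, treeLift_tree]
  simp

theorem sign_leafMap (v : V) : sign g (leafMap v) = leafMap (g.sign v) := by
  rw [leafMap_eq, leafMap_eq, sign_tree, leafEquiv_apply, leafEquiv_apply,
    PiTensorProduct.map_tprod]
  simp [CoTree.cobrackets]

theorem map_nodeEquiv (o : Cooperation) (l r : CoTree) (f : V →ₗ[k] V)
    (x : (⨂[k]^l.leaves V) ⊗[k] (⨂[k]^r.leaves V)) :
    PiTensorProduct.map (fun _ => f) (nodeEquiv o l r x) =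
      nodeEquiv o l r (TensorProduct.map (PiTensorProduct.map (fun _ => f))
        (PiTensorProduct.map (fun _ => f)) x) := by
  have : PiTensorProduct.map (fun _ => f) ∘ₗ (nodeEquiv o l r).toLinearMap =
      (nodeEquiv o l r).toLinearMap ∘ₗ TensorProduct.map (PiTensorProduct.map (fun _ => f))
        (PiTensorProduct.map (fun _ => f)) := by
    refine TensorProduct.ext ?_
    refine PiTensorProduct.ext (MultilinearMap.ext fun x => ?_)
    refine PiTensorProduct.ext (MultilinearMap.ext fun y => ?_)
    change PiTensorProduct.map (fun _ => f)
        (nodeEquiv o l r (PiTensorProduct.tprod k x ⊗ₜ PiTensorProduct.tprod k y)) =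
      nodeEquiv o l r (PiTensorProduct.map (fun _ => f) (PiTensorProduct.tprod k x) ⊗ₜ
        PiTensorProduct.map (fun _ => f) (PiTensorProduct.tprod k y))
    rw [nodeEquiv_tprod, PiTensorProduct.map_tprod, PiTensorProduct.map_tprod,
      PiTensorProduct.map_tprod, nodeEquiv_tprod, comp_nodeAppend]
  exact LinearMap.congr_fun this x

/-- A cobracket node has odd degree and a coproduct node even degree, which is what `sgn` records.
-/
theorem sign_join (o : Cooperation) (z : TreeSpace k V ⊗[k] TreeSpace k V) :
    sign g (join o z) = sgn k o • join o (TensorProduct.map (sign g) (sign g) z) := by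
  have : sign g ∘ₗ join o = sgn k o • join o ∘ₗ TensorProduct.map (sign g) (sign g) :=
    tmul_tree_ext fun l r x y => by
      simp only [LinearMap.comp_apply, LinearMap.smul_apply, TensorProduct.map_tmul, sign_tree,
        join_tree, map_nodeEquiv, map_smul, TensorProduct.smul_tmul, TensorProduct.tmul_smul,
        smul_smul]
      have e : (-1 : k) ^ (CoTree.node o l r).cobrackets =
          sgn k o * ((-1) ^ r.cobrackets * (-1) ^ l.cobrackets) := by
        cases o <;> simp only [CoTree.cobrackets, sgn] <;> ring
      rw [e, mul_comm ((-1 : k) ^ r.cobrackets)]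
  exact LinearMap.congr_fun this z

end sign

end TreeSpace
end

/-! ### Koszul signs on tensor squares and cubes. -/

noncomputable section

section Koszul

variable {k : Type u} {X : Type v} [Field k] [AddCommGroup X] [Module k X]

/-- With the sign expressed through `ε`, no homogeneity is required, so identities can be checked on
arbitrary pure tensors. -/
theorem koszulFlip_apply_tmul (ε : X →ₗ[k] X) (x y : X) :
    koszulFlip ε (x ⊗ₜ[k] y) =
      (2 : k)⁻¹ • (y ⊗ₜ[k] x + y ⊗ₜ[k] ε x + ε y ⊗ₜ[k] x - ε y ⊗ₜ[k] ε x) := by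
  simp [koszulFlip]

theorem koszulFlip_map {Y : Type*} [AddCommGroup Y] [Module k Y] {ε : X →ₗ[k] X} {ε' : Y →ₗ[k] Y}
    {f : X →ₗ[k] Y} (h : f ∘ₗ ε = ε' ∘ₗ f) :
    koszulFlip ε' ∘ₗ TensorProduct.map f f = TensorProduct.map f f ∘ₗ koszulFlip ε := by
  have h' : ∀ x, ε' (f x) = f (ε x) := fun x => (LinearMap.congr_fun h x).symm
  refine TensorProduct.ext' fun x y => ?_
  simp only [LinearMap.comp_apply, TensorProduct.map_tmul, koszulFlip_apply_tmul, map_smul,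
    map_add, map_sub, h']

theorem koszulFlip₁₂_map {Y : Type*} [AddCommGroup Y] [Module k Y] {ε : X →ₗ[k] X}
    {ε' : Y →ₗ[k] Y} {f : X →ₗ[k] Y} (h : f ∘ₗ ε = ε' ∘ₗ f) :
    koszulFlip₁₂ ε' ∘ₗ TensorProduct.map f (TensorProduct.map f f) =
      TensorProduct.map f (TensorProduct.map f f) ∘ₗ koszulFlip₁₂ ε := by
  have h' : ∀ x y, koszulFlip ε' (f x ⊗ₜ f y) = TensorProduct.map f f (koszulFlip ε (x ⊗ₜ y)) :=
    fun x y => LinearMap.congr_fun (koszulFlip_map h) (x ⊗ₜ y)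
  have h3 : ∀ (w : X ⊗[k] X) z, TensorProduct.assoc k Y Y Y (TensorProduct.map f f w ⊗ₜ f z) =
      TensorProduct.map f (TensorProduct.map f f) (TensorProduct.assoc k X X X (w ⊗ₜ z)) := by
    intro w z
    induction w using TensorProduct.induction_on with
    | zero => simp
    | tmul a b => simp
    | add a b ha hb => simp only [map_add, TensorProduct.add_tmul, ha, hb]
  refine TensorProduct.ext_threefold' fun x y z => ?_
  simp [koszulFlip₁₂, h', h3]

theorem koszulCycle_map {Y : Type*} [AddCommGroup Y] [Module k Y] {ε : X →ₗ[k] X}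
    {ε' : Y →ₗ[k] Y} {f : X →ₗ[k] Y} (h : f ∘ₗ ε = ε' ∘ₗ f) :
    koszulCycle ε' ∘ₗ TensorProduct.map f (TensorProduct.map f f) =
      TensorProduct.map f (TensorProduct.map f f) ∘ₗ koszulCycle ε := by
  rw [koszulCycle, koszulCycle, LinearMap.comp_assoc, ← TensorProduct.map_comp, koszulFlip_map h,
    LinearMap.id_comp]
  nth_rewrite 1 [← LinearMap.comp_id f]
  rw [TensorProduct.map_comp, ← LinearMap.comp_assoc, koszulFlip₁₂_map h, LinearMap.comp_assoc]

/-- The cyclic permutation moves the last factor past the first two. -/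
theorem koszulCycle_assoc [CharZero k] {ε : X →ₗ[k] X} (hε : ε ∘ₗ ε = LinearMap.id)
    (u : X ⊗[k] X) (y : X) :
    koszulCycle ε (TensorProduct.assoc k X X X (u ⊗ₜ y)) =
      (2 : k)⁻¹ • (y ⊗ₜ[k] u + y ⊗ₜ[k] TensorProduct.map ε ε u + ε y ⊗ₜ[k] u
        - ε y ⊗ₜ[k] TensorProduct.map ε ε u) := by
  have h1 : ∀ x, ε (ε x) = x := fun x => LinearMap.congr_fun hε x
  induction u using TensorProduct.induction_on with
  | zero => simp
  | tmul a b =>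
    simp only [koszulCycle, koszulFlip₁₂, LinearMap.comp_apply, TensorProduct.assoc_tmul,
      TensorProduct.map_tmul, LinearMap.id_apply, koszulFlip_apply_tmul, TensorProduct.tmul_smul,
      TensorProduct.tmul_add, TensorProduct.tmul_sub, map_smul, map_add, map_sub,
      LinearEquiv.coe_coe, TensorProduct.assoc_symm_tmul, ← TensorProduct.smul_tmul',
      TensorProduct.add_tmul, TensorProduct.sub_tmul, h1]
    module
  | add a b ha hb =>
    simp only [map_add, TensorProduct.add_tmul, TensorProduct.tmul_add, ha, hb]
    module

/-- The extension `D ⊗ 1 + ε ⊗ D` of an odd map to the tensor square. -/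
def oddExt (ε D : X →ₗ[k] X) : X ⊗[k] X →ₗ[k] X ⊗[k] X :=
  TensorProduct.map D LinearMap.id + TensorProduct.map ε D

/-- The extension of an odd map to the tensor cube. -/
def oddExt₃ (ε D : X →ₗ[k] X) : X ⊗[k] (X ⊗[k] X) →ₗ[k] X ⊗[k] (X ⊗[k] X) :=
  TensorProduct.map D LinearMap.id + TensorProduct.map ε (oddExt ε D)

theorem oddExt_tmul (ε D : X →ₗ[k] X) (x y : X) :
    oddExt ε D (x ⊗ₜ y) = D x ⊗ₜ[k] y + ε x ⊗ₜ[k] D y := by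
  simp [oddExt]

variable {ε D : X →ₗ[k] X}

/-- The flip exchanges the two summands of the extension; the `ε` in the second one is exactly the
Koszul sign for moving `D` past a factor, and the signs match because `D` anticommutes with `ε`. -/
theorem koszulFlip_oddExt (hε : ε ∘ₗ ε = LinearMap.id) (hD : D ∘ₗ ε = -(ε ∘ₗ D)) :
    koszulFlip ε ∘ₗ oddExt ε D = oddExt ε D ∘ₗ koszulFlip ε := by
  have h1 : ∀ x, ε (ε x) = x := fun x => LinearMap.congr_fun hε x
  have h2 : ∀ x, D (ε x) = -ε (D x) := fun x => LinearMap.congr_fun hD x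
  refine TensorProduct.ext' fun x y => ?_
  simp only [LinearMap.comp_apply, oddExt_tmul, koszulFlip_apply_tmul, map_smul,
    map_add, map_sub, h1, h2, TensorProduct.neg_tmul, TensorProduct.tmul_neg]
  module

theorem oddExt₃_assoc (w : X ⊗[k] X) (z : X) :
    oddExt₃ ε D (TensorProduct.assoc k X X X (w ⊗ₜ z)) =
      TensorProduct.assoc k X X X (oddExt ε D w ⊗ₜ z + TensorProduct.map ε ε w ⊗ₜ D z) := by
  induction w using TensorProduct.induction_on with
  | zero => simp
  | tmul a b =>
    simp only [oddExt₃, oddExt, LinearMap.add_apply, TensorProduct.map_tmul,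
      TensorProduct.assoc_tmul, LinearMap.id_apply, TensorProduct.add_tmul, map_add,
      TensorProduct.tmul_add]
    abel
  | add a b ha hb =>
    simp only [map_add, TensorProduct.add_tmul, ha, hb]
    abel

/-- On the first two factors this is `koszulFlip_oddExt`; the term acting on the third sees `ε ⊗ ε`
on the first two, with which the flip commutes. -/
theorem koszulFlip₁₂_oddExt₃ (hε : ε ∘ₗ ε = LinearMap.id) (hD : D ∘ₗ ε = -(ε ∘ₗ D)) :
    koszulFlip₁₂ ε ∘ₗ oddExt₃ ε D = oddExt₃ ε D ∘ₗ koszulFlip₁₂ ε := by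
  have h1 := LinearMap.congr_fun (koszulFlip_oddExt hε hD)
  have h2 : ∀ x y, koszulFlip ε (ε x ⊗ₜ ε y) = TensorProduct.map ε ε (koszulFlip ε (x ⊗ₜ y)) :=
    fun x y => LinearMap.congr_fun (koszulFlip_map (f := ε) rfl) (x ⊗ₜ y)
  simp only [LinearMap.comp_apply] at h1
  refine TensorProduct.ext_threefold' fun x y z => ?_
  rw [LinearMap.comp_apply, LinearMap.comp_apply, ← TensorProduct.assoc_tmul, oddExt₃_assoc]
  simp only [koszulFlip₁₂, LinearMap.comp_apply, LinearEquiv.coe_coe, map_add,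
    LinearEquiv.symm_apply_apply, TensorProduct.map_tmul, LinearMap.id_apply, h1, h2, oddExt₃_assoc]

theorem koszulCycle_oddExt₃ (hε : ε ∘ₗ ε = LinearMap.id) (hD : D ∘ₗ ε = -(ε ∘ₗ D)) :
    koszulCycle ε ∘ₗ oddExt₃ ε D = oddExt₃ ε D ∘ₗ koszulCycle ε := by
  have h : TensorProduct.map LinearMap.id (koszulFlip ε) ∘ₗ oddExt₃ ε D =
      oddExt₃ ε D ∘ₗ TensorProduct.map LinearMap.id (koszulFlip ε) := by
    simp only [oddExt₃, LinearMap.comp_add, LinearMap.add_comp, ← TensorProduct.map_comp,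
      koszulFlip_oddExt hε hD, LinearMap.id_comp, LinearMap.comp_id]
  rw [koszulCycle, LinearMap.comp_assoc, h, ← LinearMap.comp_assoc, koszulFlip₁₂_oddExt₃ hε hD,
    LinearMap.comp_assoc]

end Koszul

theorem TensorProduct.map_mem_range_mapIncl {k : Type u} {X Y : Type*} [Field k]
    [AddCommGroup X] [Module k X] [AddCommGroup Y] [Module k Y] {S : Submodule k X}
    {S' : Submodule k Y} {f g : X →ₗ[k] Y}
    (hf : ∀ x ∈ S, f x ∈ S') (hg : ∀ x ∈ S, g x ∈ S') {z : X ⊗[k] X}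
    (hz : z ∈ LinearMap.range (TensorProduct.mapIncl S S)) :
    TensorProduct.map f g z ∈ LinearMap.range (TensorProduct.mapIncl S' S') := by
  obtain ⟨w, rfl⟩ := hz
  refine ⟨TensorProduct.map (f.restrict hf) (g.restrict hg) w, ?_⟩
  simp only [TensorProduct.mapIncl, ← LinearMap.comp_apply, ← TensorProduct.map_comp]
  rfl

end

/-! ### Parity and length on trees. -/

noncomputable section

namespace ZGrading

variable {k : Type u} {V : Type v} [Field k] [AddCommGroup V] [Module k V]

theorem iSup_deg (g : ZGrading k V) : ⨆ n, g.deg n = ⊤ :=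
  g.internal.submodule_iSup_eq_top

theorem sign_sign (g : ZGrading k V) (x : V) : g.sign (g.sign x) = x := by
  have hx : x ∈ ⨆ n, g.deg n := by rw [iSup_deg]; trivial
  induction hx using Submodule.iSup_induction' with
  | mem n x hx =>
    rw [g.sign_apply hx, map_smul, g.sign_apply hx, smul_smul, ← Int.cast_mul, ← Units.val_mul]
    simp
  | zero => simp
  | add x y _ _ hx hy => rw [map_add, map_add, hx, hy]

end ZGrading

namespace TreeSpace

open Cooperation

variable {k : Type u} {V : Type v} [Field k] [AddCommGroup V] [Module k V]

section sign

variable (g : ZGrading k V)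

theorem sign_sign (x : TreeSpace k V) : sign g (sign g x) = x := by
  have : sign g ∘ₗ sign g = LinearMap.id := by
    refine hom_ext (fun v => ?_) fun o x y hx hy => ?_
    · simp only [LinearMap.comp_apply, sign_leafMap, g.sign_sign, LinearMap.id_apply]
    · simp only [LinearMap.comp_apply, LinearMap.id_apply] at hx hy ⊢
      simp only [sign_join, map_smul, smul_smul, sgn_mul_self, TensorProduct.map_tmul, one_smul,
        hx, hy]
  exact LinearMap.congr_fun this x

theorem sign_comp_sign : sign g ∘ₗ sign g = LinearMap.id := LinearMap.ext (sign_sign g)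

theorem toLeaf_sign (x : TreeSpace k V) : toLeaf (sign g x) = g.sign (toLeaf x) := by
  have : toLeaf ∘ₗ sign g = g.sign ∘ₗ toLeaf := by
    refine hom_ext (fun v => ?_) fun o x y hx hy => ?_
    · simp only [LinearMap.comp_apply, sign_leafMap, toLeaf_leafMap]
    · simp only [LinearMap.comp_apply, sign_join, map_smul, toLeaf_join, smul_zero, map_zero]
  exact LinearMap.congr_fun this x

theorem split_comp_sign (o : Cooperation) :
    split o ∘ₗ sign g = sgn k o • TensorProduct.map (sign g) (sign g) ∘ₗ split o := by
  refine hom_ext (fun v => ?_) fun o' x y hx hy => ?_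
  · simp only [LinearMap.comp_apply, LinearMap.smul_apply, sign_leafMap, split_leafMap, map_zero,
      smul_zero]
  · simp only [LinearMap.comp_apply, LinearMap.smul_apply, sign_join, map_smul, split_join]
    split_ifs with h
    · rw [h]
    · simp

end sign

section length

theorem lengthProj_tree (j : ℕ) (t : CoTree) (x : ⨂[k]^t.leaves V) :
    lengthProj j (tree t x) = if t.leaves = j then tree t x else 0 := by
  rw [lengthProj, treeLift_tree]
  split_ifs <;> rfl

theorem lengthProj_leafMap (j : ℕ) (v : V) :
    lengthProj j (leafMap (k := k) v) = if 1 = j then leafMap v else 0 :=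
  lengthProj_tree j .leaf (leafEquiv v)

theorem lengthProj_join (j : ℕ) (o : Cooperation) (z : TreeSpace k V ⊗[k] TreeSpace k V) :
    lengthProj j (join o z) = ∑ p ∈ Finset.HasAntidiagonal.antidiagonal j,
      join o (TensorProduct.map (lengthProj p.1) (lengthProj p.2) z) := by
  have : lengthProj j ∘ₗ join (k := k) (V := V) o = ∑ p ∈ Finset.HasAntidiagonal.antidiagonal j,
      join o ∘ₗ TensorProduct.map (lengthProj p.1) (lengthProj p.2) :=
    tmul_tree_ext fun l r x y => by
      simp only [LinearMap.comp_apply, LinearMap.sum_apply, TensorProduct.map_tmul,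
        lengthProj_tree]
      rw [join_tree, lengthProj_tree]
      change (if l.leaves + r.leaves = j then _ else _) = _
      split_ifs with h
      · rw [Finset.sum_eq_single (l.leaves, r.leaves)]
        · simp [join_tree]
        · rintro ⟨a, b⟩ _ hne
          by_cases ha : l.leaves = a
          · rw [if_neg (c := r.leaves = b), TensorProduct.tmul_zero, map_zero]
            rintro rfl; exact hne (by rw [ha])
          · rw [if_neg ha, TensorProduct.zero_tmul, map_zero]
        · intro hn; exact absurd (Finset.HasAntidiagonal.mem_antidiagonal.2 h) hn
      · symm
        refine Finset.sum_eq_zero fun p hp => ?_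
        rw [Finset.HasAntidiagonal.mem_antidiagonal] at hp
        by_cases ha : l.leaves = p.1
        · rw [if_neg (c := r.leaves = p.2), TensorProduct.tmul_zero, map_zero]
          rintro hb; exact h (by rw [ha, hb, hp])
        · rw [if_neg ha, TensorProduct.zero_tmul, map_zero]
  rw [← LinearMap.comp_apply, this]
  simp only [LinearMap.sum_apply, LinearMap.comp_apply]

theorem split_lengthProj (o : Cooperation) (j : ℕ) (x : TreeSpace k V) :
    split o (lengthProj j x) = ∑ p ∈ Finset.HasAntidiagonal.antidiagonal j,
      TensorProduct.map (lengthProj p.1) (lengthProj p.2) (split o x) := by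
  have : split o ∘ₗ lengthProj j = ∑ p ∈ Finset.HasAntidiagonal.antidiagonal j,
      TensorProduct.map (lengthProj p.1) (lengthProj p.2) ∘ₗ split (k := k) (V := V) o := by
    refine hom_ext (fun v => ?_) fun o' x y hx hy => ?_
    · simp only [LinearMap.comp_apply, LinearMap.sum_apply, lengthProj_leafMap, split_leafMap,
        map_zero, Finset.sum_const_zero]
      split_ifs <;> simp
    · simp only [LinearMap.comp_apply, LinearMap.sum_apply, lengthProj_join, map_sum, split_join]
      split_ifs with h
      · rfl
      · simp
  rw [← LinearMap.comp_apply, this]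
  simp only [LinearMap.sum_apply, LinearMap.comp_apply]

theorem _root_.CoTree.leaves_pos : ∀ t : CoTree, 0 < t.leaves
  | .leaf => Nat.one_pos
  | .node _ l _ => Nat.add_pos_left l.leaves_pos _

theorem treeHom_ext {N : Type*} [AddCommGroup N] [Module k N] {f g : TreeSpace k V →ₗ[k] N}
    (h : ∀ t x, f (tree t x) = g (tree t x)) : f = g :=
  LinearMap.ext fun x => mem_of_tree_mem (W := LinearMap.eqLocus f g) h x

@[simp] theorem lengthProj_zero : lengthProj (k := k) (V := V) 0 = 0 :=
  treeHom_ext fun t x => by rw [lengthProj_tree, if_neg t.leaves_pos.ne']; rfl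

theorem lengthProj_lengthProj (i j : ℕ) (x : TreeSpace k V) :
    lengthProj i (lengthProj j x) = if i = j then lengthProj j x else 0 := by
  have : lengthProj i ∘ₗ lengthProj j = if i = j then lengthProj (k := k) (V := V) j else 0 :=
    treeHom_ext fun t x => by
      rw [LinearMap.comp_apply, lengthProj_tree]
      by_cases hj : t.leaves = j
      · subst hj
        rw [if_pos rfl, lengthProj_tree]
        by_cases hi : i = t.leaves
        · rw [if_pos hi.symm, if_pos hi, lengthProj_tree, if_pos rfl]
        · rw [if_neg hi, if_neg (Ne.symm hi)]; rfl
      · rw [if_neg hj, map_zero]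
        split_ifs
        · rw [lengthProj_tree, if_neg hj]
        · rfl
  rw [← LinearMap.comp_apply, this]
  split_ifs <;> rfl

theorem lengthProj_one (x : TreeSpace k V) : lengthProj 1 x = leafMap (toLeaf x) := by
  have : lengthProj 1 = leafMap ∘ₗ toLeaf (k := k) (V := V) := by
    refine hom_ext (fun v => ?_) fun o x y hx hy => ?_
    · simp [lengthProj_leafMap]
    · rw [lengthProj_join]
      simp [Finset.Nat.antidiagonal_succ]
  exact LinearMap.congr_fun this x

theorem toLeaf_lengthProj (j : ℕ) (x : TreeSpace k V) :
    toLeaf (lengthProj j x) = if 1 = j then toLeaf x else 0 := by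
  have h := congrArg toLeaf (lengthProj_lengthProj 1 j x)
  rw [lengthProj_one, toLeaf_leafMap] at h
  rw [h]
  split_ifs with hj
  · rw [← hj, lengthProj_one, toLeaf_leafMap]
  · simp

theorem lengthProj_of_mem_length {j : ℕ} {x : TreeSpace k V} (hx : x ∈ length (k := k) (V := V) j) :
    lengthProj j x = x := by
  have : length (k := k) (V := V) j ≤ LinearMap.eqLocus (lengthProj j) LinearMap.id := by
    refine Submodule.span_le.2 ?_
    rintro _ ⟨t, v, rfl, rfl⟩
    exact (lengthProj_tree _ t _).trans (if_pos rfl)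
  exact this hx

/-- The cutoff is allowed to grow so that several vectors, or a prescribed bound, can share it. -/
theorem exists_sum_lengthProj (x : TreeSpace k V) :
    ∃ n, ∀ N ≥ n, ∑ j ∈ Finset.range N, lengthProj j x = x := by
  induction x using induction_tree with
  | zero => exact ⟨0, fun N _ => by simp⟩
  | tree t x =>
    refine ⟨t.leaves + 1, fun N hN => ?_⟩
    simp only [lengthProj_tree]
    rw [Finset.sum_ite_eq, if_pos (Finset.mem_range.2 (by omega))]
  | add x y hx hy =>
    obtain ⟨n, hn⟩ := hx
    obtain ⟨m, hm⟩ := hy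
    refine ⟨max n m, fun N hN => ?_⟩
    simp only [map_add, Finset.sum_add_distrib, hn N (le_trans (le_max_left _ _) hN),
      hm N (le_trans (le_max_right _ _) hN)]

theorem lengthProj_sign (g : ZGrading k V) (j : ℕ) (x : TreeSpace k V) :
    lengthProj j (sign g x) = sign g (lengthProj j x) := by
  have : lengthProj j ∘ₗ sign g = sign g ∘ₗ lengthProj j :=
    treeHom_ext fun t x => by
      simp only [LinearMap.comp_apply, sign_tree, lengthProj_tree, map_smul]
      split_ifs <;> simp [sign_tree]
  exact LinearMap.congr_fun this x

/-- Multiplication by `c ^ l` on trees with `l` leaves. -/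
def lengthScale (c : k) : TreeSpace k V →ₗ[k] TreeSpace k V :=
  treeLift fun t => c ^ t.leaves • tree t

theorem lengthScale_tree (c : k) (t : CoTree) (x : ⨂[k]^t.leaves V) :
    lengthScale c (tree t x) = c ^ t.leaves • tree t x := by
  rw [lengthScale, treeLift_tree]; rfl

theorem lengthScale_join (c : k) (o : Cooperation) (z : TreeSpace k V ⊗[k] TreeSpace k V) :
    lengthScale c (join o z) =
      join o (TensorProduct.map (lengthScale c) (lengthScale c) z) := by
  have : lengthScale c ∘ₗ join (k := k) (V := V) o =
      join o ∘ₗ TensorProduct.map (lengthScale c) (lengthScale c) :=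
    tmul_tree_ext fun l r x y => by
      simp only [LinearMap.comp_apply, TensorProduct.map_tmul, lengthScale_tree,
        TensorProduct.tmul_smul, ← TensorProduct.smul_tmul', map_smul]
      rw [join_tree, lengthScale_tree, smul_smul, ← pow_add, add_comm r.leaves]
      rfl
  exact LinearMap.congr_fun this z

/-- Leaf counts add under grafting, so a dilation is a coalgebra endomorphism. Dilations serve to
isolate the components of fixed length in `lengthProj_mem_gerCofree`. -/
theorem split_comp_lengthScale (c : k) (o : Cooperation) :
    split o ∘ₗ lengthScale c =
      TensorProduct.map (lengthScale c) (lengthScale c) ∘ₗ split (k := k) (V := V) o := by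
  refine hom_ext (fun v => ?_) fun o' x y _ _ => ?_
  · rw [LinearMap.comp_apply, leafMap_eq, lengthScale_tree, ← leafMap_eq]
    simp
  · simp only [LinearMap.comp_apply, lengthScale_join, split_join]
    split_ifs
    · rfl
    · simp

theorem lengthScale_lengthProj (c : k) (j : ℕ) (x : TreeSpace k V) :
    lengthScale c (lengthProj j x) = c ^ j • lengthProj j x := by
  have : lengthScale c ∘ₗ lengthProj j = c ^ j • lengthProj (k := k) (V := V) j :=
    treeHom_ext fun t x => by
      simp only [LinearMap.comp_apply, LinearMap.smul_apply, lengthProj_tree]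
      split_ifs with h
      · subst h
        rw [lengthScale_tree]
      · simp
  exact LinearMap.congr_fun this x

theorem lengthScale_comp_sign (c : k) (g : ZGrading k V) :
    lengthScale c ∘ₗ sign g = sign g ∘ₗ lengthScale c :=
  treeHom_ext fun t x => by
    simp only [LinearMap.comp_apply, sign_tree, lengthScale_tree, map_smul]
    rw [smul_comm]

end length

end TreeSpace
end

/-! ### Stability of the cofree Gerstenhaber coalgebra under homomorphisms. -/

noncomputable section

namespace TreeSpace

open Cooperation

variable {k : Type u} {V : Type v} [Field k] [AddCommGroup V] [Module k V] {g : ZGrading k V}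

theorem map_split_id_map {F : TreeSpace k V →ₗ[k] TreeSpace k V} {o : Cooperation} {c : k}
    (h : split o ∘ₗ F = c • TensorProduct.map F F ∘ₗ split o)
    (z : TreeSpace k V ⊗[k] TreeSpace k V) :
    TensorProduct.assoc k _ _ _ (TensorProduct.map (split o) LinearMap.id
        (TensorProduct.map F F z)) =
      c • TensorProduct.map F (TensorProduct.map F F) (TensorProduct.assoc k _ _ _
        (TensorProduct.map (split o) LinearMap.id z)) := by
  have h' : ∀ x, split o (F x) = c • TensorProduct.map F F (split o x) :=
    fun x => LinearMap.congr_fun h x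
  have h3 : ∀ (w : TreeSpace k V ⊗[k] TreeSpace k V) z,
      TensorProduct.assoc k _ _ _ (TensorProduct.map F F w ⊗ₜ F z) =
      TensorProduct.map F (TensorProduct.map F F) (TensorProduct.assoc k _ _ _ (w ⊗ₜ z)) := by
    intro w z
    induction w using TensorProduct.induction_on with
    | zero => simp
    | tmul a b => simp
    | add a b ha hb => simp only [map_add, TensorProduct.add_tmul, ha, hb]
  induction z using TensorProduct.induction_on with
  | zero => simp
  | tmul a b =>
    simp only [TensorProduct.map_tmul, LinearMap.id_apply, h', ← TensorProduct.smul_tmul', map_smul,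
      h3]
  | add a b ha hb => simp only [map_add, ha, hb, smul_add]

/-- The map `H` in the first slot lets one statement serve coassociativity, with `H` the identity,
and the co-Leibniz rule, with `H` the parity operator. -/
theorem map_split_map {F G H : TreeSpace k V →ₗ[k] TreeSpace k V} {o : Cooperation} {c : k}
    (hG : H ∘ₗ G = G ∘ₗ H)
    (h : split o ∘ₗ F = c • TensorProduct.map F F ∘ₗ split o)
    (z : TreeSpace k V ⊗[k] TreeSpace k V) :
    TensorProduct.map H (split o) (TensorProduct.map G F z) =
      c • TensorProduct.map G (TensorProduct.map F F) (TensorProduct.map H (split o) z) := by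
  have h' : ∀ x, split o (F x) = c • TensorProduct.map F F (split o x) :=
    fun x => LinearMap.congr_fun h x
  have hG' : ∀ x, H (G x) = G (H x) := fun x => LinearMap.congr_fun hG x
  induction z using TensorProduct.induction_on with
  | zero => simp
  | tmul a b => simp only [TensorProduct.map_tmul, h', hG', TensorProduct.tmul_smul]
  | add a b ha hb => simp only [map_add, ha, hb, smul_add]

/-- Homomorphisms, possibly scaling the cooperations, preserve the cofree Gerstenhaber
coalgebra. -/
theorem mem_gerCofree_of_hom {F : TreeSpace k V →ₗ[k] TreeSpace k V} (c : Cooperation → k)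
    (h : ∀ o, split o ∘ₗ F = c o • TensorProduct.map F F ∘ₗ split o)
    (hs : F ∘ₗ sign g = sign g ∘ₗ F) {x : TreeSpace k V} (hx : x ∈ gerCofree g) :
    F x ∈ gerCofree g := by
  have hS := gerCofree_isGerstenhaberSubcoalgebra g
  have h' : ∀ o x, split o (F x) = c o • TensorProduct.map F F (split o x) :=
    fun o x => LinearMap.congr_fun (h o) x
  have hflip : ∀ z, koszulFlip (sign g) (TensorProduct.map F F z) =
      TensorProduct.map F F (koszulFlip (sign g) z) := fun z =>
    LinearMap.congr_fun (koszulFlip_map hs) z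
  have hcyc : ∀ z, koszulCycle (sign g) (TensorProduct.map F (TensorProduct.map F F) z) =
      TensorProduct.map F (TensorProduct.map F F) (koszulCycle (sign g) z) := fun z =>
    LinearMap.congr_fun (koszulCycle_map hs) z
  have hflip₁₂ : ∀ z, koszulFlip₁₂ (sign g) (TensorProduct.map F (TensorProduct.map F F) z) =
      TensorProduct.map F (TensorProduct.map F F) (koszulFlip₁₂ (sign g) z) := fun z =>
    LinearMap.congr_fun (koszulFlip₁₂_map hs) z
  -- `gerCofree g` is the largest Gerstenhaber subcoalgebra, so it contains its image as soon as the
  -- image is one.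
  suffices IsGerstenhaberSubcoalgebra g ((gerCofree g).map F) from
    le_sSup (a := (gerCofree g).map F) this (Submodule.mem_map_of_mem hx)
  refine ⟨?_, ?_, ?_, ?_, ?_, ?_⟩
  · rintro o _ ⟨x, hx, rfl⟩
    rw [h']
    exact Submodule.smul_mem _ _ (TensorProduct.map_mem_range_mapIncl
      (fun y hy => Submodule.mem_map_of_mem hy) (fun y hy => Submodule.mem_map_of_mem hy)
      (hS.closed o x hx))
  · rintro _ ⟨x, hx, rfl⟩
    rw [h', map_smul, hflip, hS.cocommutative x hx]
  · rintro _ ⟨x, hx, rfl⟩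
    simp only [h', map_smul]
    rw [map_split_id_map (h .coproduct), map_split_map (G := F) (H := LinearMap.id) rfl (h .coproduct), hS.coassociative x hx]
  · rintro _ ⟨x, hx, rfl⟩
    rw [h', map_smul, hflip, hS.cosymmetric x hx]
  · rintro _ ⟨x, hx, rfl⟩ _ rfl
    simp only [h', map_smul]
    rw [map_split_id_map (h .cobracket)]
    simp only [map_smul, hcyc]
    rw [← smul_add, ← smul_add, ← smul_add, ← smul_add, ← map_add, ← map_add,
      hS.coJacobi x hx _ rfl]
    simp
  · rintro _ ⟨x, hx, rfl⟩
    simp only [h', map_smul]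
    rw [map_split_id_map (h .cobracket), map_split_map (G := F) (H := LinearMap.id) rfl (h .coproduct),
      map_split_map hs.symm (h .cobracket), hS.coLeibniz x hx]
    simp only [map_smul, hflip₁₂, map_add]
    module

theorem sign_mem_gerCofree {x : TreeSpace k V} (hx : x ∈ gerCofree g) :
    sign g x ∈ gerCofree g :=
  mem_gerCofree_of_hom (sgn k) (split_comp_sign g) rfl hx

/-- A supremum of subspaces is not visibly graded by length. Dilations preserve it, however, and as
the powers of `2` are distinct in characteristic zero, Lagrange interpolation expresses each length
component as a combination of dilates. -/
theorem lengthProj_mem_gerCofree [CharZero k] {x : TreeSpace k V} (hx : x ∈ gerCofree g) (j : ℕ) :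
    lengthProj j x ∈ gerCofree g := by
  obtain ⟨n, hn⟩ := exists_sum_lengthProj x
  -- a combination of dilations isolates the `j`-th component
  have key : ∀ p : Polynomial k,
      ∑ i ∈ Finset.range n, p.eval ((2 : k) ^ i) • lengthProj i x ∈ gerCofree g := by
    intro p
    induction p using Polynomial.induction_on' with
    | add p q hp hq =>
      simp only [Polynomial.eval_add, add_smul, Finset.sum_add_distrib]
      exact add_mem hp hq
    | monomial m a =>
      -- The value of `X ^ m` at `2 ^ i` equals `(2 ^ m) ^ i`, the scalar by which dilation by `2 ^
      -- m` acts in length `i`.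
      have := mem_gerCofree_of_hom (F := lengthScale ((2 : k) ^ m)) (fun _ => 1)
        (fun o => by rw [one_smul, split_comp_lengthScale]) (lengthScale_comp_sign _ g) hx
      rw [← hn n le_rfl, map_sum] at this
      have h2 := (gerCofree g).smul_mem a this
      rw [Finset.smul_sum] at h2
      convert h2 using 2 with i
      rw [lengthScale_lengthProj, smul_smul, Polynomial.eval_monomial, ← pow_mul, ← pow_mul,
        mul_comm i m]
  by_cases hj : j < n
  · have h := key (Lagrange.basis (Finset.range n) (fun i => (2 : k) ^ i) j)
    have hinj : Set.InjOn (fun i : ℕ => (2 : k) ^ i) (Finset.range n) := by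
      intro a _ b _ hab
      have : (2 : ℕ) ^ a = 2 ^ b := by
        have h' : (2 : k) ^ a = (2 : k) ^ b := hab
        exact_mod_cast h'
      exact Nat.pow_right_injective le_rfl this
    rw [Finset.sum_eq_single j] at h
    · rwa [Lagrange.eval_basis_self hinj (Finset.mem_range.2 hj), one_smul] at h
    · intro b hb hbj
      rw [Lagrange.eval_basis_of_ne (v := fun i => (2 : k) ^ i) hbj.symm hb, zero_smul]
    · intro hn; exact absurd (Finset.mem_range.2 hj) hn
  -- Beyond the cutoff two successive partial sums agree, so the component is zero.
  · have h1 := hn (j + 1) (by omega)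
    rw [Finset.sum_range_succ, hn j (by omega)] at h1
    rw [left_eq_add.1 h1.symm]
    exact zero_mem _

end TreeSpace
end

/-! ### Coderivations of the tree coalgebra. -/

noncomputable section

namespace TreeSpace

open Cooperation

variable {k : Type u} {V : Type v} [Field k] [AddCommGroup V] [Module k V]

section preserve

variable {g : ZGrading k V} {D : TreeSpace k V →ₗ[k] TreeSpace k V}

/-- Cutting the left factor turns the extension of `D` to the square into its extension to the cube.
Both terms cost `sgn`: one from the rule for `D`, the other because `sign g` becomes `sgn` times its
tensor square when cut. -/
theorem assoc_map_split_oddExt {o : Cooperation}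
    (h : split o ∘ₗ D = sgn k o • oddExt (sign g) D ∘ₗ split o)
    (z : TreeSpace k V ⊗[k] TreeSpace k V) :
    TensorProduct.assoc k _ _ _
        (TensorProduct.map (split o) LinearMap.id (oddExt (sign g) D z)) =
      sgn k o • oddExt₃ (sign g) D (TensorProduct.assoc k _ _ _
        (TensorProduct.map (split o) LinearMap.id z)) := by
  have h' : ∀ x, split o (D x) = sgn k o • oddExt (sign g) D (split o x) :=
    fun x => LinearMap.congr_fun h x
  have hs : ∀ x, split o (sign g x) = sgn k o • TensorProduct.map (sign g) (sign g) (split o x) :=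
    fun x => LinearMap.congr_fun (split_comp_sign g o) x
  induction z using TensorProduct.induction_on with
  | zero => simp
  | tmul a b =>
    simp only [oddExt_tmul, map_add, TensorProduct.map_tmul, LinearMap.id_apply, h', hs,
      ← TensorProduct.smul_tmul', map_smul, oddExt₃_assoc, smul_add]
  | add a b ha hb => simp only [map_add, ha, hb, smul_add]

theorem map_id_split_oddExt
    (h : split .coproduct ∘ₗ D = sgn k .coproduct • oddExt (sign g) D ∘ₗ split .coproduct)
    (z : TreeSpace k V ⊗[k] TreeSpace k V) :
    TensorProduct.map LinearMap.id (split .coproduct) (oddExt (sign g) D z) =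
      oddExt₃ (sign g) D (TensorProduct.map LinearMap.id (split .coproduct) z) := by
  have h' : ∀ x, split .coproduct (D x) = oddExt (sign g) D (split .coproduct x) :=
    fun x => by simpa [sgn] using LinearMap.congr_fun h x
  induction z using TensorProduct.induction_on with
  | zero => simp
  | tmul a b =>
    simp only [oddExt_tmul, oddExt₃, LinearMap.add_apply, map_add, TensorProduct.map_tmul,
      LinearMap.id_apply, h']
  | add a b ha hb => simp only [map_add, ha, hb]

/-- The odd cobracket passes the first factor, hence `sign g` there. The overall minus comes from
`D` anticommuting with `sign g` in one term and with the cobracket in the other. -/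
theorem map_sign_split_oddExt
    (h : split .cobracket ∘ₗ D = sgn k .cobracket • oddExt (sign g) D ∘ₗ split .cobracket)
    (hD : D ∘ₗ sign g = -(sign g ∘ₗ D)) (z : TreeSpace k V ⊗[k] TreeSpace k V) :
    TensorProduct.map (sign g) (split .cobracket) (oddExt (sign g) D z) =
      -oddExt₃ (sign g) D (TensorProduct.map (sign g) (split .cobracket) z) := by
  have h' : ∀ x, split .cobracket (D x) = -oddExt (sign g) D (split .cobracket x) :=
    fun x => by simpa [sgn] using LinearMap.congr_fun h x
  have hD' : ∀ x, D (sign g x) = -sign g (D x) := fun x => LinearMap.congr_fun hD x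
  induction z using TensorProduct.induction_on with
  | zero => simp
  | tmul a b =>
    simp only [oddExt_tmul, oddExt₃, LinearMap.add_apply, map_add, TensorProduct.map_tmul,
      LinearMap.id_apply, h', hD', TensorProduct.neg_tmul, TensorProduct.tmul_neg, neg_add, neg_neg]
  | add a b ha hb => simp only [map_add, ha, hb, neg_add]

/-- Odd coderivations preserve the cofree Gerstenhaber coalgebra. -/
theorem mem_gerCofree_of_coderivation
    (h : ∀ o, split o ∘ₗ D = sgn k o • oddExt (sign g) D ∘ₗ split o)
    (hD : D ∘ₗ sign g = -(sign g ∘ₗ D)) {x : TreeSpace k V} (hx : x ∈ gerCofree g) :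
    D x ∈ gerCofree g := by
  have hS := gerCofree_isGerstenhaberSubcoalgebra g
  have h' : ∀ o x, split o (D x) = sgn k o • oddExt (sign g) D (split o x) :=
    fun o x => LinearMap.congr_fun (h o) x
  have hflip := LinearMap.congr_fun (koszulFlip_oddExt (sign_comp_sign g) hD)
  have hcyc := LinearMap.congr_fun (koszulCycle_oddExt₃ (sign_comp_sign g) hD)
  have hflip₁₂ := LinearMap.congr_fun (koszulFlip₁₂_oddExt₃ (sign_comp_sign g) hD)
  simp only [LinearMap.comp_apply] at hflip hcyc hflip₁₂
  -- Maximality again, but applied to the sum: the image of `D` alone is not visibly closed under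
  -- cuts, since a cut of `D x` has undifferentiated factors.
  suffices IsGerstenhaberSubcoalgebra g (gerCofree g ⊔ (gerCofree g).map D) from
    le_sSup (a := gerCofree g ⊔ (gerCofree g).map D) this
      (Submodule.mem_sup_right (Submodule.mem_map_of_mem hx))
  have hsup : ∀ P : TreeSpace k V → Prop, (∀ x ∈ gerCofree g, P x) →
      (∀ x ∈ gerCofree g, P (D x)) → (∀ x y, P x → P y → P (x + y)) →
      ∀ x ∈ gerCofree g ⊔ (gerCofree g).map D, P x := by
    intro P h1 h2 h3 x hx
    obtain ⟨a, ha, _, ⟨b, hb, rfl⟩, rfl⟩ := Submodule.mem_sup.1 hx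
    exact h3 _ _ (h1 a ha) (h2 b hb)
  have hle : ∀ x ∈ gerCofree g, x ∈ gerCofree g ⊔ (gerCofree g).map D :=
    fun x hx => Submodule.mem_sup_left hx
  have hle' : ∀ x ∈ gerCofree g, D x ∈ gerCofree g ⊔ (gerCofree g).map D :=
    fun x hx => Submodule.mem_sup_right (Submodule.mem_map_of_mem hx)
  refine ⟨fun o => hsup _ (fun x hx => ?_) (fun x hx => ?_) (fun x y hx hy => ?_),
    hsup _ hS.cocommutative (fun x hx => ?_) (fun x y hx hy => ?_),
    hsup _ hS.coassociative (fun x hx => ?_) (fun x y hx hy => ?_),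
    hsup _ hS.cosymmetric (fun x hx => ?_) (fun x y hx hy => ?_),
    hsup _ hS.coJacobi (fun x hx => ?_) (fun x y hx hy => ?_),
    hsup _ hS.coLeibniz (fun x hx => ?_) (fun x y hx hy => ?_)⟩
  · have := TensorProduct.map_mem_range_mapIncl (f := LinearMap.id) (g := LinearMap.id) hle hle
      (hS.closed o x hx)
    rwa [TensorProduct.map_id] at this
  · rw [h']
    exact Submodule.smul_mem _ _ (add_mem
      (TensorProduct.map_mem_range_mapIncl hle' hle (hS.closed o x hx))
      (TensorProduct.map_mem_range_mapIncl (fun y hy => hle _ (sign_mem_gerCofree hy)) hle'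
        (hS.closed o x hx)))
  · rw [map_add]; exact add_mem hx hy
  · rw [h', map_smul, hflip, hS.cocommutative x hx]
  · rw [map_add, map_add, hx, hy]
  · simp only [h', map_smul, assoc_map_split_oddExt (h _), map_id_split_oddExt (h _),
      hS.coassociative x hx]
    simp [sgn]
  · simp only [map_add, hx, hy]
  · rw [h', map_smul, hflip, hS.cosymmetric x hx]
  · rw [map_add, map_add, hx, hy]
  · rintro _ rfl
    simp only [h', map_smul, assoc_map_split_oddExt (h _), hcyc]
    rw [← smul_add, ← smul_add, ← smul_add, ← smul_add, ← map_add, ← map_add,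
      hS.coJacobi x hx _ rfl]
    simp
  · rintro _ rfl
    have e1 := hx _ rfl
    have e2 := hy _ rfl
    simp only [map_add]
    rw [← add_zero (0 : TreeSpace k V ⊗[k] (TreeSpace k V ⊗[k] TreeSpace k V))]
    nth_rewrite 1 [← e1]
    rw [← e2]
    abel
  · simp only [h', map_smul, map_id_split_oddExt (h _), assoc_map_split_oddExt (h _),
      map_sign_split_oddExt (h _) hD, hS.coLeibniz x hx, map_neg, hflip₁₂, map_add]
    simp [sgn]
  · simp only [map_add, hx, hy]
    abel

end preserve

section coder

variable (g : ZGrading k V) (m : TreeSpace k V →ₗ[k] V)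

/-- The restriction to a tree of the coderivation with corestriction `m`. -/
def coderTree : ∀ t : CoTree, (⨂[k]^t.leaves V) →ₗ[k] TreeSpace k V
  | .leaf => leafMap ∘ₗ m ∘ₗ tree .leaf
  | .node o l r => leafMap ∘ₗ m ∘ₗ tree (.node o l r) + sgn k o • join o ∘ₗ
      (TensorProduct.map (coderTree l) (tree r) +
        TensorProduct.map (sign g ∘ₗ tree l) (coderTree r)) ∘ₗ (nodeEquiv o l r).symm.toLinearMap

/-- The coderivation of degree one of the space of trees with corestriction `m`. -/
def coder : TreeSpace k V →ₗ[k] TreeSpace k V := treeLift (coderTree g m)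

theorem coder_tree (t : CoTree) (x : ⨂[k]^t.leaves V) : coder g m (tree t x) = coderTree g m t x :=
  treeLift_tree _ t x

theorem coder_leafMap (v : V) : coder g m (leafMap v) = leafMap (m (leafMap v)) :=
  coder_tree g m .leaf (leafEquiv v)

theorem coder_join (o : Cooperation) (z : TreeSpace k V ⊗[k] TreeSpace k V) :
    coder g m (join o z) =
      leafMap (m (join o z)) + sgn k o • join o (oddExt (sign g) (coder g m) z) := by
  have : coder g m ∘ₗ join o =
      leafMap ∘ₗ m ∘ₗ join o + sgn k o • join o ∘ₗ oddExt (sign g) (coder g m) :=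
    tmul_tree_ext fun l r x y => by
      simp only [LinearMap.comp_apply, LinearMap.add_apply, LinearMap.smul_apply, oddExt_tmul]
      rw [join_tree, coder_tree, coder_tree, coder_tree]
      simp only [coderTree, LinearMap.comp_apply, LinearMap.add_apply, LinearMap.smul_apply,
        LinearEquiv.coe_coe, LinearEquiv.symm_apply_apply, TensorProduct.map_tmul]
  exact LinearMap.congr_fun this z

@[simp] theorem toLeaf_coder (x : TreeSpace k V) : toLeaf (coder g m x) = m x := by
  have : toLeaf ∘ₗ coder g m = m := by
    refine hom_ext (fun v => ?_) fun o x y _ _ => ?_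
    · simp [coder_leafMap]
    · simp [coder_join]
  exact LinearMap.congr_fun this x

theorem split_comp_coder (o : Cooperation) :
    split o ∘ₗ coder g m = sgn k o • oddExt (sign g) (coder g m) ∘ₗ split o := by
  refine hom_ext (fun v => ?_) fun o' x y _ _ => ?_
  · simp [coder_leafMap]
  · simp only [LinearMap.comp_apply, LinearMap.smul_apply, coder_join, map_add, split_leafMap,
      map_smul, split_join, zero_add]
    split_ifs with h
    · rw [h]
    · simp

theorem split_coder (o : Cooperation) (x : TreeSpace k V) :
    split o (coder g m x) = sgn k o • oddExt (sign g) (coder g m) (split o x) :=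
  LinearMap.congr_fun (split_comp_coder g m o) x

variable {g m}

/-- Oddness is expressed by anticommutation with the parity operators; it passes from the
corestriction to the coderivation by recursion on trees. -/
theorem coder_comp_sign (hm : ∀ x, m (sign g x) = -g.sign (m x)) :
    coder g m ∘ₗ sign g = -(sign g ∘ₗ coder g m) := by
  refine hom_ext (fun v => ?_) fun o x y hx hy => ?_
  · have := hm (leafMap v)
    rw [sign_leafMap] at this
    simp only [LinearMap.comp_apply, LinearMap.neg_apply, sign_leafMap, coder_leafMap, this, map_neg]
  · simp only [LinearMap.comp_apply, LinearMap.neg_apply] at hx hy ⊢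
    have := hm (join o (x ⊗ₜ y))
    simp only [sign_join, map_smul, TensorProduct.map_tmul] at this
    simp only [coder_join, map_add, map_smul, sign_join, sign_leafMap, oddExt_tmul,
      TensorProduct.map_tmul, hx, hy, TensorProduct.neg_tmul, TensorProduct.tmul_neg, smul_add,
      ← map_smul leafMap, this, map_neg, smul_neg]
    abel

theorem coder_mem_gerCofree (hm : ∀ x, m (sign g x) = -g.sign (m x)) {x : TreeSpace k V}
    (hx : x ∈ gerCofree g) : coder g m x ∈ gerCofree g :=
  mem_gerCofree_of_coderivation (split_comp_coder g m) (coder_comp_sign hm) hx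

/-- The square of an odd coderivation is a coderivation. -/
theorem split_coder_coder (hm : ∀ x, m (sign g x) = -g.sign (m x)) (o : Cooperation)
    (x : TreeSpace k V) :
    split o (coder g m (coder g m x)) =
      TensorProduct.map (coder g m ∘ₗ coder g m) LinearMap.id (split o x) +
        TensorProduct.map LinearMap.id (coder g m ∘ₗ coder g m) (split o x) := by
  have hs : ∀ x, coder g m (sign g x) = -sign g (coder g m x) :=
    fun x => LinearMap.congr_fun (coder_comp_sign hm) x
  rw [split_coder, split_coder, map_smul, smul_smul, sgn_mul_self, one_smul]
  induction split o x using TensorProduct.induction_on with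
  | zero => simp
  | tmul a b =>
    -- The cross terms cancel because `D` anticommutes with the parity operator.
    simp only [oddExt_tmul, map_add, hs, sign_sign, TensorProduct.map_tmul,
      LinearMap.comp_apply, LinearMap.id_apply, TensorProduct.neg_tmul]
    abel
  | add a b ha hb =>
    simp only [map_add, ha, hb]
    abel

/-- Coderivations whose corestrictions agree on shorter trees differ by a leaf. -/
theorem coderTree_congr {m m' : TreeSpace k V →ₗ[k] V} : ∀ t : CoTree,
    (∀ (t' : CoTree) (x : ⨂[k]^t'.leaves V), t'.leaves < t.leaves → m (tree t' x) = m' (tree t' x)) →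
    ∀ x : ⨂[k]^t.leaves V, coder g m (tree t x) =
      coder g m' (tree t x) + leafMap (m (tree t x) - m' (tree t x))
  | .leaf, _, x => by
    rw [coder_tree, coder_tree]
    simp [coderTree]
  | .node o l r, h, x => by
    have hl : l.leaves < (CoTree.node o l r).leaves := Nat.lt_add_of_pos_right r.leaves_pos
    have hr : r.leaves < (CoTree.node o l r).leaves := Nat.lt_add_of_pos_left l.leaves_pos
    obtain ⟨z, rfl⟩ := (nodeEquiv o l r).surjective x
    induction z using TensorProduct.induction_on with
    | zero => simp
    | add a b ha hb =>
      simp only [map_add, ha, hb, map_sub]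
      abel
    | tmul a b =>
      rw [← join_tree, coder_join, coder_join, oddExt_tmul, oddExt_tmul,
        coderTree_congr l (fun t' x ht => h t' x (ht.trans hl)) a, h l a hl,
        coderTree_congr r (fun t' x ht => h t' x (ht.trans hr)) b, h r b hr]
      simp
      abel

theorem eq_lengthProj_induction {l : ℕ} {N : Type*} [AddCommGroup N] [Module k N]
    {f f' : TreeSpace k V →ₗ[k] N} (h : ∀ t x, t.leaves = l → f (tree t x) = f' (tree t x))
    (x : TreeSpace k V) : f (lengthProj l x) = f' (lengthProj l x) := by
  have : f ∘ₗ lengthProj l = f' ∘ₗ lengthProj l := treeHom_ext fun t x => by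
    simp only [LinearMap.comp_apply, lengthProj_tree]
    split_ifs with ht
    · exact h t x ht
    · simp
  exact LinearMap.congr_fun this x

/-- In length `l` the map `m_l` enters the coderivation only through the one-leaf term. This is what
makes a recursion on length for the higher operations possible. -/
theorem coder_lengthProj_congr {m m' : TreeSpace k V →ₗ[k] V} {l : ℕ}
    (h : ∀ j < l, ∀ x, m (lengthProj j x) = m' (lengthProj j x)) (x : TreeSpace k V) :
    coder g m (lengthProj l x) =
      coder g m' (lengthProj l x) + leafMap (m (lengthProj l x) - m' (lengthProj l x)) := by
  refine eq_lengthProj_induction (f := coder g m)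
    (f' := coder g m' + leafMap ∘ₗ (m - m')) (fun t x ht => ?_) x
  refine coderTree_congr t (fun t' x ht' => ?_) x
  have := h t'.leaves (by omega) (tree t' x)
  rwa [lengthProj_tree, if_pos rfl] at this

/-- The subspace of trees with at most `l` leaves. -/
def lengthLE (l : ℕ) : Submodule k (TreeSpace k V) :=
  ⨅ j : Set.Ioi l, LinearMap.ker (lengthProj (j : ℕ))

theorem mem_lengthLE {l : ℕ} {x : TreeSpace k V} :
    x ∈ lengthLE (k := k) l ↔ ∀ j, l < j → lengthProj j x = 0 := by
  simp [lengthLE]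

theorem join_mem_lengthLE {a b l : ℕ} (hl : a + b ≤ l) (o : Cooperation) {x y : TreeSpace k V}
    (hx : x ∈ lengthLE (k := k) a) (hy : y ∈ lengthLE (k := k) b) :
    join o (x ⊗ₜ y) ∈ lengthLE (k := k) l := by
  rw [mem_lengthLE] at *
  intro j hj
  rw [lengthProj_join]
  refine Finset.sum_eq_zero fun p hp => ?_
  rw [Finset.HasAntidiagonal.mem_antidiagonal] at hp
  rw [TensorProduct.map_tmul]
  by_cases h : a < p.1
  · rw [hx _ h, TensorProduct.zero_tmul, map_zero]
  · rw [hy _ (by omega), TensorProduct.tmul_zero, map_zero]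

theorem tree_mem_lengthLE {t : CoTree} {l : ℕ} (hl : t.leaves ≤ l) (x : ⨂[k]^t.leaves V) :
    tree t x ∈ lengthLE (k := k) l := by
  rw [mem_lengthLE]
  intro j hj
  rw [lengthProj_tree, if_neg (by omega)]

theorem leafMap_mem_lengthLE {l : ℕ} (hl : 1 ≤ l) (v : V) : leafMap v ∈ lengthLE (k := k) l :=
  tree_mem_lengthLE (t := .leaf) hl (leafEquiv v)

/-- A coderivation replaces a subtree by a leaf, which never increases the number of leaves. -/
theorem coder_tree_mem_lengthLE : ∀ (t : CoTree) (x : ⨂[k]^t.leaves V),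
    coder g m (tree t x) ∈ lengthLE (k := k) t.leaves
  | .leaf, x => by
    rw [coder_tree]
    exact leafMap_mem_lengthLE le_rfl _
  | .node o l r, x => by
    obtain ⟨z, rfl⟩ := (nodeEquiv o l r).surjective x
    induction z using TensorProduct.induction_on with
    | zero => simp only [map_zero, zero_mem]
    | add a b ha hb => simp only [map_add]; exact add_mem ha hb
    | tmul a b =>
      rw [← join_tree, coder_join, oddExt_tmul, map_add]
      have hs : sign g (tree l a) ∈ lengthLE (k := k) (V := V) l.leaves := by
        rw [sign_tree]
        exact Submodule.smul_mem _ _ (tree_mem_lengthLE le_rfl _)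
      exact add_mem (leafMap_mem_lengthLE (CoTree.leaves_pos _) _) (Submodule.smul_mem _ _ (add_mem
        (join_mem_lengthLE le_rfl o (coder_tree_mem_lengthLE l a) (tree_mem_lengthLE le_rfl b))
        (join_mem_lengthLE le_rfl o hs (coder_tree_mem_lengthLE r b))))

theorem lengthProj_coder_lengthProj {j l : ℕ} (h : l < j) (x : TreeSpace k V) :
    lengthProj j (coder g m (lengthProj l x)) = 0 := by
  refine eq_lengthProj_induction (f := lengthProj j ∘ₗ coder g m) (f' := 0) (fun t x ht => ?_) x
  exact mem_lengthLE.1 (coder_tree_mem_lengthLE t x) j (ht ▸ h)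

theorem coder_lengthProj_eq_sum (l : ℕ) (x : TreeSpace k V) :
    coder g m (lengthProj l x) =
      ∑ j ∈ Finset.range (l + 1), lengthProj j (coder g m (lengthProj l x)) := by
  obtain ⟨n, hn⟩ := exists_sum_lengthProj (coder g m (lengthProj l x))
  refine (hn (max n (l + 1)) (le_max_left _ _)).symm.trans ?_
  refine (Finset.sum_subset (Finset.range_mono (le_max_right _ _)) fun j _ hj => ?_).symm
  exact lengthProj_coder_lengthProj (by simpa using hj) x

end coder

end TreeSpace
end

/-! ### Gradings on trees and structure maps with at most two inputs. -/

noncomputable section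

namespace TreeSpace

open Cooperation

variable {k : Type u} {V : Type v} [Field k] [AddCommGroup V] [Module k V]

theorem pureTree_leaf (v : Fin (CoTree.leaf).leaves → V) :
    pureTree (k := k) .leaf v = leafMap (v (0 : Fin 1)) := by
  rw [leafMap_eq, leafEquiv_apply, pureTree]
  congr 2
  funext i
  exact congrArg v (Subsingleton.elim (α := Fin 1) _ _)

theorem pureTree_node (o : Cooperation) (l r : CoTree) (x : Fin l.leaves → V)
    (y : Fin r.leaves → V) :
    pureTree (k := k) (.node o l r) (nodeAppend o l r x y) =
      join o (pureTree l x ⊗ₜ pureTree r y) := by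
  rw [pureTree, pureTree, pureTree, join_tree, nodeEquiv_tprod]

theorem exists_nodeAppend (o : Cooperation) (l r : CoTree) {α : Type*}
    (v : Fin (CoTree.node o l r).leaves → α) :
    v = nodeAppend o l r (fun i => v (Fin.castAdd r.leaves i)) (fun i => v (Fin.natAdd l.leaves i)) :=
  (Fin.append_castAdd_natAdd (m := l.leaves) (n := r.leaves) (f := v)).symm

/-- The number of cobrackets of a single node. -/
def _root_.Cooperation.count : Cooperation → ℤ
  | coproduct => 0
  | cobracket => 1

theorem _root_.CoTree.cobrackets_node (o : Cooperation) (l r : CoTree) :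
    ((CoTree.node o l r).cobrackets : ℤ) = l.cobrackets + r.cobrackets + o.count := by
  cases o <;> simp [CoTree.cobrackets, count]

/-- The part of degree `n` for a family `F` of subspaces of `V` shifted by `e`, each cobracket
contributing `c`. -/
def gradedPart (F : ℤ → Submodule k V) (e c n : ℤ) : Submodule k (TreeSpace k V) :=
  Submodule.span k {x | ∃ (t : CoTree) (v : Fin t.leaves → V) (d : Fin t.leaves → ℤ),
    (∀ i, v i ∈ F (d i)) ∧ ∑ i, (d i + e) + c * t.cobrackets = n ∧ x = pureTree t v}

/-- Fermionic degree (shift `-2`, cobrackets counted) and conformal weight (no shift, cobrackets not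
counted) are instances of one construction, so homogeneity of coderivations is proved once. -/
theorem degree_eq (g : ZGrading k V) (n : ℤ) : degree g n = gradedPart g.deg (-2) 1 n := by
  simp only [degree, gradedPart, one_mul, sub_eq_add_neg]

theorem weight_eq (F : ℤ → Submodule k V) (n : ℤ) : weight F n = gradedPart F 0 0 n := by
  simp only [weight, gradedPart, zero_mul, add_zero]

variable {F : ℤ → Submodule k V} {e c : ℤ}

theorem pureTree_mem_of_graded {W : ℤ → Submodule k (TreeSpace k V)}
    (h1 : ∀ a, ∀ v ∈ F a, leafMap v ∈ W (a + e))
    (h2 : ∀ o a b x y, x ∈ W a → y ∈ W b → join o (x ⊗ₜ y) ∈ W (a + b + c * o.count)) :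
    ∀ (t : CoTree) (v : Fin t.leaves → V) (d : Fin t.leaves → ℤ), (∀ i, v i ∈ F (d i)) →
      pureTree t v ∈ W (∑ i, (d i + e) + c * t.cobrackets)
  | .leaf, v, d, h => by
    rw [pureTree_leaf]
    convert h1 _ _ (h (0 : Fin 1)) using 2
    simp only [CoTree.cobrackets, Nat.cast_zero, mul_zero, add_zero]
    exact Fin.sum_univ_one (fun i : Fin 1 => d i + e)
  | .node o l r, v, d, h => by
    rw [exists_nodeAppend o l r v, pureTree_node]
    convert h2 o _ _ _ _
      (pureTree_mem_of_graded h1 h2 l (fun i => v (Fin.castAdd r.leaves i))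
        (fun i => d (Fin.castAdd r.leaves i)) fun i => h _)
      (pureTree_mem_of_graded h1 h2 r (fun i => v (Fin.natAdd l.leaves i))
        (fun i => d (Fin.natAdd l.leaves i)) fun i => h _) using 2
    rw [CoTree.cobrackets_node]
    have := Fin.sum_univ_add (fun i : Fin (l.leaves + r.leaves) => d i + e)
    change ∑ i : Fin (l.leaves + r.leaves), (d i + e) + _ = _
    rw [this]
    ring

/-- An induction principle: the graded parts form the smallest family containing the homogeneous
leaves and compatible with grafting. -/
theorem gradedPart_le {W : ℤ → Submodule k (TreeSpace k V)}
    (h1 : ∀ a, ∀ v ∈ F a, leafMap v ∈ W (a + e))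
    (h2 : ∀ o a b x y, x ∈ W a → y ∈ W b → join o (x ⊗ₜ y) ∈ W (a + b + c * o.count)) (n : ℤ) :
    gradedPart F e c n ≤ W n := by
  refine Submodule.span_le.2 ?_
  rintro _ ⟨t, v, d, h, rfl, rfl⟩
  exact pureTree_mem_of_graded h1 h2 t v d h

theorem leafMap_mem_gradedPart {a n : ℤ} {v : V} (hv : v ∈ F a) (hn : a + e = n) :
    leafMap v ∈ gradedPart F e c n := by
  refine Submodule.subset_span ⟨.leaf, fun _ => v, fun _ => a, fun _ => hv, ?_, ?_⟩
  · rw [← hn]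
    simp only [CoTree.cobrackets, Nat.cast_zero, mul_zero, add_zero]
    exact Fin.sum_univ_one (fun i : Fin 1 => a + e)
  · exact (pureTree_leaf (k := k) fun _ => v).symm

theorem join_mem_gradedPart {a b n : ℤ} {o : Cooperation} {x y : TreeSpace k V}
    (hx : x ∈ gradedPart F e c a) (hy : y ∈ gradedPart F e c b) (hn : a + b + c * o.count = n) :
    join o (x ⊗ₜ y) ∈ gradedPart F e c n := by
  subst hn
  suffices gradedPart (k := k) F e c a ≤ ((gradedPart F e c (a + b + c * o.count)).comap
      (join o ∘ₗ (TensorProduct.mk k _ _).flip y)) from this hx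
  refine Submodule.span_le.2 ?_
  rintro _ ⟨t, v, d, h, rfl, rfl⟩
  suffices gradedPart (k := k) F e c b ≤
      ((gradedPart F e c (∑ i, (d i + e) + c * t.cobrackets + b + c * o.count)).comap
      (join o ∘ₗ TensorProduct.mk k _ _ (pureTree t v))) from this hy
  refine Submodule.span_le.2 ?_
  rintro _ ⟨t', v', d', h', rfl, rfl⟩
  change join o (pureTree (k := k) t v ⊗ₜ pureTree t' v') ∈ gradedPart F e c _
  rw [← pureTree_node]
  refine Submodule.subset_span ⟨_, _, nodeAppend o t t' d d', ?_, ?_, rfl⟩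
  · intro i
    refine Fin.addCases (m := t.leaves) (n := t'.leaves) (fun i => ?_) (fun i => ?_) i
    · convert h i using 1
      · exact congrArg F (Fin.append_left d d' i)
      · exact Fin.append_left v v' i
    · convert h' i using 1
      · exact congrArg F (Fin.append_right d d' i)
      · exact Fin.append_right v v' i
  · rw [CoTree.cobrackets_node]
    have := Fin.sum_univ_add (fun i : Fin (t.leaves + t'.leaves) => Fin.append d d' i + e)
    change ∑ i : Fin (t.leaves + t'.leaves), (Fin.append d d' i + e) + _ = _
    rw [this]
    simp only [Fin.append_left, Fin.append_right]
    ring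

theorem sign_mem_gradedPart {g : ZGrading k V} (hs : ∀ a, ∀ v ∈ F a, g.sign v ∈ F a) {n : ℤ}
    {x : TreeSpace k V} (hx : x ∈ gradedPart F e c n) : sign g x ∈ gradedPart F e c n := by
  refine gradedPart_le (W := fun n => (gradedPart F e c n).comap (sign g)) (fun a v hv => ?_)
    (fun o a b x y hx hy => ?_) n hx
  · rw [Submodule.mem_comap, sign_leafMap]
    exact leafMap_mem_gradedPart (hs a v hv) rfl
  · rw [Submodule.mem_comap, sign_join]
    exact Submodule.smul_mem _ _ (join_mem_gradedPart hx hy rfl)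

theorem lengthProj_mem_gradedPart (j : ℕ) {n : ℤ}
    {x : TreeSpace k V} (hx : x ∈ gradedPart F e c n) : lengthProj j x ∈ gradedPart F e c n := by
  suffices gradedPart (k := k) F e c n ≤ (gradedPart F e c n).comap (lengthProj j) from this hx
  refine Submodule.span_le.2 ?_
  rintro _ ⟨t, v, d, h, hn, rfl⟩
  change lengthProj j (tree t (PiTensorProduct.tprod k v)) ∈ gradedPart F e c n
  rw [lengthProj_tree]
  split_ifs
  · exact Submodule.subset_span ⟨t, v, d, h, hn, rfl⟩
  · exact zero_mem _

theorem toLeaf_mem_of_gradedPart {n a : ℤ} {x : TreeSpace k V} (hx : x ∈ gradedPart F e c n)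
    (hn : a + e = n) : toLeaf x ∈ F a := by
  obtain rfl : a = n - e := by omega
  refine gradedPart_le (W := fun n => (F (n - e)).comap toLeaf) (fun a v hv => ?_)
    (fun o a b x y hx hy => ?_) n hx
  · rw [Submodule.mem_comap, toLeaf_leafMap, add_sub_cancel_right]
    exact hv
  · rw [Submodule.mem_comap, toLeaf_join]
    exact zero_mem _

/-- A coderivation is homogeneous when its corestriction is. -/
theorem coder_mem_gradedPart {g : ZGrading k V} (hs : ∀ a, ∀ v ∈ F a, g.sign v ∈ F a)
    {m : TreeSpace k V →ₗ[k] V} {r : ℤ}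
    (hm : ∀ n, ∀ x ∈ gradedPart F e c n, m x ∈ F (n + r - e)) {n : ℤ}
    {x : TreeSpace k V} (hx : x ∈ gradedPart F e c n) :
    coder g m x ∈ gradedPart F e c (n + r) := by
  -- The induction carries the homogeneity of the argument along, because the coderivation of a
  -- grafting also involves the uncorrected factors.
  refine (gradedPart_le (W := fun n => gradedPart F e c n ⊓ (gradedPart F e c (n + r)).comap
    (coder g m)) (fun a v hv => ?_) (fun o a a' x y hx hy => ?_) n hx).2
  · have h := leafMap_mem_gradedPart (c := c) hv (rfl : a + e = _)
    refine ⟨h, ?_⟩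
    rw [SetLike.mem_coe, Submodule.mem_comap, coder_leafMap]
    exact leafMap_mem_gradedPart (hm _ _ h) (by ring)
  · have h := join_mem_gradedPart (o := o) hx.1 hy.1 rfl
    refine ⟨h, ?_⟩
    rw [SetLike.mem_coe, Submodule.mem_comap, coder_join, oddExt_tmul, map_add]
    exact add_mem (leafMap_mem_gradedPart (hm _ _ h) (by ring)) (Submodule.smul_mem _ _ (add_mem
      (join_mem_gradedPart hx.2 hy.1 (by ring))
      (join_mem_gradedPart (sign_mem_gradedPart hs hx.1) hy.2 (by ring))))

/-- The linear map on trees with at most two leaves given by an endomorphism and two binary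
operations. -/
def quad (q : V →ₗ[k] V) (b : Cooperation → V →ₗ[k] V →ₗ[k] V) : TreeSpace k V →ₗ[k] V :=
  q ∘ₗ toLeaf
    + TensorProduct.lift (b .coproduct) ∘ₗ TensorProduct.map toLeaf toLeaf ∘ₗ split .coproduct
    + TensorProduct.lift (b .cobracket) ∘ₗ TensorProduct.map toLeaf toLeaf ∘ₗ split .cobracket

variable (q : V →ₗ[k] V) (b : Cooperation → V →ₗ[k] V →ₗ[k] V)

@[simp] theorem quad_leafMap (v : V) : quad q b (leafMap v) = q v := by
  simp [quad]

@[simp] theorem quad_join (o : Cooperation) (x y : TreeSpace k V) :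
    quad q b (join o (x ⊗ₜ y)) = b o (toLeaf x) (toLeaf y) := by
  cases o <;> simp [quad, split_join]

/-- With three or more leaves one side of the root is not a leaf, and `toLeaf` kills it. -/
theorem quad_tree_eq_zero : ∀ (t : CoTree), 3 ≤ t.leaves → ∀ x, quad q b (tree t x) = 0
  | .leaf, h, _ => absurd h (by decide)
  | .node o l r, h, x => by
    obtain ⟨z, rfl⟩ := (nodeEquiv o l r).surjective x
    induction z using TensorProduct.induction_on with
    | zero => simp only [map_zero]
    | add a b ha hb => simp only [map_add, ha, hb, add_zero]
    | tmul x y =>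
      rw [← join_tree, quad_join]
      change 3 ≤ l.leaves + r.leaves at h
      rcases l with _ | ⟨o', l, l'⟩
      · rcases r with _ | ⟨o', r, r'⟩
        · exact absurd h (by decide)
        · rw [toLeaf_tree_node, map_zero]
      · rw [toLeaf_tree_node, map_zero, LinearMap.zero_apply]

theorem quad_lengthProj_eq_zero {l : ℕ} (hl : 3 ≤ l) (x : TreeSpace k V) :
    quad q b (lengthProj l x) = 0 :=
  eq_lengthProj_induction (f := quad q b) (f' := 0)
    (fun t x ht => quad_tree_eq_zero q b t (ht ▸ hl) x) x

theorem quad_mem {q : V →ₗ[k] V} {b : Cooperation → V →ₗ[k] V →ₗ[k] V} {r : ℤ}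
    (hq : ∀ a, ∀ v ∈ F a, q v ∈ F (a + r))
    (hb : ∀ o a a', ∀ v ∈ F a, ∀ w ∈ F a', b o v w ∈ F (a + a' + e + c * o.count + r)) {n : ℤ}
    {x : TreeSpace k V} (hx : x ∈ gradedPart F e c n) : quad q b x ∈ F (n + r - e) := by
  refine (gradedPart_le (W := fun n => gradedPart F e c n ⊓ (F (n + r - e)).comap (quad q b))
    (fun a v hv => ?_) (fun o a a' x y hx hy => ?_) n hx).2
  · refine ⟨leafMap_mem_gradedPart hv rfl, ?_⟩
    rw [SetLike.mem_coe, Submodule.mem_comap, quad_leafMap]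
    convert hq a v hv using 2
    ring
  · refine ⟨join_mem_gradedPart hx.1 hy.1 rfl, ?_⟩
    rw [SetLike.mem_coe, Submodule.mem_comap, quad_join]
    convert hb o (a - e) (a' - e) _ (toLeaf_mem_of_gradedPart hx.1 (by ring)) _
      (toLeaf_mem_of_gradedPart hy.1 (by ring)) using 2
    ring

end TreeSpace
end

/-! ### The recursion for the structure map and the vanishing of the square. -/

noncomputable section

open TreeSpace Cooperation

/-- A differential `q` with two binary operations of which it is a derivation, and a contracting
homotopy `h` of `q` onto the image of a projection `p` on which the operations satisfy the
Gerstenhaber identities. -/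
structure HomotopyGerstenhaber {k : Type u} {V : Type v} [Field k] [AddCommGroup V] [Module k V]
    (g : ZGrading k V) where
  q : V →ₗ[k] V
  h : V →ₗ[k] V
  p : V →ₗ[k] V
  b : Cooperation → V →ₗ[k] V →ₗ[k] V
  q_sign : ∀ v, q (g.sign v) = -g.sign (q v)
  h_sign : ∀ v, h (g.sign v) = -g.sign (h v)
  b_sign : ∀ o v w, g.sign (b o v w) = -(sgn k o • b o (g.sign v) (g.sign w))
  q_q : ∀ v, q (q v) = 0
  q_b : ∀ o v w, q (b o v w) + sgn k o • (b o (q v) w + b o (g.sign v) (q w)) = 0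
  q_h : ∀ v, q (h v) + h (q v) = v - p v
  p_p : ∀ v, p (p v) = p v
  p_h : ∀ v, p (h v) = 0
  p_b : ∀ o v w, p (b o v w) = b o (p v) (p w)
  -- The Gerstenhaber identities enter only in this form, evaluated on the cofree coalgebra and on
  -- the image of `p`.
  quad_coder : ∀ x ∈ gerCofree g, quad 0 (fun o => (b o).compl₁₂ p p)
    (coder g (quad 0 fun o => (b o).compl₁₂ p p) x) = 0

namespace HomotopyGerstenhaber

variable {k : Type u} {V : Type v} [Field k] [AddCommGroup V] [Module k V] {g : ZGrading k V}
variable (H : HomotopyGerstenhaber g)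

/-- The structure map on trees with at most `n + 2` leaves. -/
def partialMap : ℕ → TreeSpace k V →ₗ[k] V
  | 0 => quad H.q H.b
  -- Length `n + 3` is the first one on which `partialMap n` is zero; there `- m D` is the
  -- obstruction, whence the minus sign.
  | n + 1 => partialMap n - H.h ∘ₗ partialMap n ∘ₗ coder g (partialMap n) ∘ₗ lengthProj (n + 3)

/-- The structure map. -/
def total : TreeSpace k V →ₗ[k] V := treeLift fun t => H.partialMap t.leaves ∘ₗ tree t

theorem partialMap_succ_lengthProj (n l : ℕ) (x : TreeSpace k V) :
    H.partialMap (n + 1) (lengthProj l x) = H.partialMap n (lengthProj l x) -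
      if n + 3 = l then H.h (H.partialMap n (coder g (H.partialMap n) (lengthProj l x)))
      else 0 := by
  simp only [partialMap, LinearMap.sub_apply, LinearMap.comp_apply, lengthProj_lengthProj]
  split_ifs <;> simp

theorem partialMap_lengthProj_eq_zero (n l : ℕ) (h : n + 3 ≤ l) (x : TreeSpace k V) :
    H.partialMap n (lengthProj l x) = 0 := by
  induction n with
  | zero => exact quad_lengthProj_eq_zero _ _ h x
  | succ n ih => rw [partialMap_succ_lengthProj, ih (by omega), if_neg (by omega), sub_zero]

theorem partialMap_lengthProj_of_le {n N l : ℕ} (h : l ≤ n + 2) (hN : n ≤ N)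
    (x : TreeSpace k V) :
    H.partialMap N (lengthProj l x) = H.partialMap n (lengthProj l x) := by
  induction N, hN using Nat.le_induction with
  | base => rfl
  | succ N hN ih => rw [partialMap_succ_lengthProj, ih, if_neg (by omega), sub_zero]

/-- The partial maps are already stable in length `l` once `l ≤ n + 2`, so any such index computes
the structure map. -/
theorem total_lengthProj {n l : ℕ} (h : l ≤ n + 2) (x : TreeSpace k V) :
    H.total (lengthProj l x) = H.partialMap n (lengthProj l x) := by
  refine eq_lengthProj_induction (fun t x ht => ?_) x
  rw [total, treeLift_tree, LinearMap.comp_apply]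
  have e : tree t x = lengthProj l (tree t x) := by rw [lengthProj_tree, if_pos ht]
  rw [e]
  rcases le_total n t.leaves with h' | h'
  · exact H.partialMap_lengthProj_of_le h h' _
  · exact (H.partialMap_lengthProj_of_le (by omega) h' _).symm

theorem total_leafMap (v : V) : H.total (leafMap v) = H.q v := by
  have := H.total_lengthProj (n := 0) (l := 1) (by omega) (leafMap v)
  rwa [lengthProj_leafMap, if_pos rfl, partialMap, quad_leafMap] at this

theorem total_join_leafMap (o : Cooperation) (v w : V) :
    H.total (join o (leafMap v ⊗ₜ leafMap w)) = H.b o v w := by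
  have := H.total_lengthProj (n := 0) (l := 2) (by omega) (join o (leafMap v ⊗ₜ leafMap w))
  have e : lengthProj 2 (join o (leafMap v ⊗ₜ leafMap w)) =
      join (k := k) o (leafMap v ⊗ₜ leafMap w) := by
    rw [lengthProj_join]
    simp [Finset.Nat.antidiagonal_succ, lengthProj_leafMap]
  rwa [e, partialMap, quad_join, toLeaf_leafMap, toLeaf_leafMap] at this

/-- The coderivation of the space of trees determined by the structure map. -/
abbrev D : TreeSpace k V →ₗ[k] TreeSpace k V := coder g H.total

/-- The obstruction `Γ_l = - ∑ m_j D_l^j`. -/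
def obstruction (l : ℕ) (x : TreeSpace k V) : V :=
  -∑ j ∈ Finset.Ico 2 l, H.total (lengthProj j (H.D x))

/-- The recursion uses a truncated map and its coderivation, whereas `obstruction` uses the final
ones. The two coderivations differ by the one-leaf term only, and the truncated map kills the part
of top length, so exactly the lengths `2 ≤ j < l` remain. -/
theorem total_eq_h_obstruction {l : ℕ} (hl : 3 ≤ l) (x : TreeSpace k V) :
    H.total (lengthProj l x) = H.h (H.obstruction l (lengthProj l x)) := by
  obtain ⟨n, rfl⟩ := Nat.exists_eq_add_of_le' hl
  rw [H.total_lengthProj (n := n + 1) (by omega), partialMap_succ_lengthProj, if_pos rfl,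
    partialMap_lengthProj_eq_zero _ _ _ le_rfl, zero_sub, ← map_neg, obstruction]
  congr 2
  -- Since the truncated map vanishes in length `n + 3`, the truncated coderivation is `D` with its
  -- one-leaf component removed.
  have hc := coder_lengthProj_congr (g := g) (m := H.total) (m' := H.partialMap n) (l := n + 3)
    (fun j hj x => H.total_lengthProj (by omega) x) x
  rw [partialMap_lengthProj_eq_zero _ _ _ le_rfl, sub_zero] at hc
  set z := coder g H.total (lengthProj (n + 3) x) with hz
  have hz1 : lengthProj 1 z = leafMap (H.total (lengthProj (n + 3) x)) := by
    rw [lengthProj_one, hz, toLeaf_coder]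
  rw [← sub_eq_iff_eq_add] at hc
  have hsum := coder_lengthProj_eq_sum (g := g) (m := H.total) (n + 3) x
  rw [← hz] at hsum
  rw [← hc, map_sub, ← hz1]
  nth_rewrite 1 [hsum]
  rw [map_sum, Finset.sum_range_succ, partialMap_lengthProj_eq_zero _ _ _ le_rfl, add_zero,
    Finset.range_eq_Ico, Finset.sum_eq_sum_Ico_succ_bot (by omega),
    Finset.sum_eq_sum_Ico_succ_bot (by omega)]
  simp only [zero_add, lengthProj_zero, LinearMap.zero_apply, map_zero, add_sub_cancel_left]
  refine Finset.sum_congr rfl fun j hj => ?_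
  rw [Finset.mem_Ico] at hj
  exact (H.total_lengthProj (by omega) z).symm

theorem quad_sign (x : TreeSpace k V) :
    quad H.q H.b (sign g x) = -g.sign (quad H.q H.b x) := by
  have : quad H.q H.b ∘ₗ sign g = -(g.sign ∘ₗ quad H.q H.b) := by
    refine hom_ext (fun v => ?_) fun o x y _ _ => ?_
    · simp only [LinearMap.comp_apply, LinearMap.neg_apply, sign_leafMap, quad_leafMap, H.q_sign]
    · simp only [LinearMap.comp_apply, LinearMap.neg_apply, sign_join, map_smul,
        TensorProduct.map_tmul, quad_join, toLeaf_sign, H.b_sign, neg_neg]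
  exact LinearMap.congr_fun this x

theorem partialMap_sign (n : ℕ) (x : TreeSpace k V) :
    H.partialMap n (sign g x) = -g.sign (H.partialMap n x) := by
  induction n generalizing x with
  | zero => exact H.quad_sign x
  | succ n ih =>
    have hc : ∀ x, coder g (H.partialMap n) (sign g x) = -sign g (coder g (H.partialMap n) x) :=
      LinearMap.congr_fun (coder_comp_sign ih)
    simp only [partialMap, LinearMap.sub_apply, LinearMap.comp_apply, lengthProj_sign, hc,
      map_neg, ih, map_sub, H.h_sign]
    abel

theorem total_sign (x : TreeSpace k V) : H.total (sign g x) = -g.sign (H.total x) := by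
  have : H.total ∘ₗ sign g = -(g.sign ∘ₗ H.total) := treeHom_ext fun t x => by
    rw [LinearMap.comp_apply, LinearMap.neg_apply, LinearMap.comp_apply]
    have e : tree t x = lengthProj t.leaves (tree t x) := by rw [lengthProj_tree, if_pos rfl]
    rw [e, ← lengthProj_sign, H.total_lengthProj (n := t.leaves) (by omega),
      H.total_lengthProj (n := t.leaves) (by omega), lengthProj_sign, partialMap_sign]
  exact LinearMap.congr_fun this x

theorem D_mem {x : TreeSpace k V} (hx : x ∈ gerCofree g) : H.D x ∈ gerCofree g :=
  coder_mem_gerCofree H.total_sign hx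

/-- The binary operations restricted to the image of the projection. -/
def core : TreeSpace k V →ₗ[k] V := quad 0 fun o => (H.b o).compl₁₂ H.p H.p

theorem core_apply (x : TreeSpace k V) :
    H.core x = TensorProduct.lift ((H.b .coproduct).compl₁₂ H.p H.p)
        (TensorProduct.map toLeaf toLeaf (split .coproduct x)) +
      TensorProduct.lift ((H.b .cobracket).compl₁₂ H.p H.p)
        (TensorProduct.map toLeaf toLeaf (split .cobracket x)) := by
  simp [core, quad]

theorem core_leafMap (v : V) : H.core (leafMap v) = 0 := by simp [core]

theorem core_join (o : Cooperation) (x y : TreeSpace k V) :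
    H.core (join o (x ⊗ₜ y)) = H.b o (H.p (toLeaf x)) (H.p (toLeaf y)) := by simp [core]

theorem p_core (x : TreeSpace k V) : H.p (H.core x) = H.core x := by
  have : H.p ∘ₗ H.core = H.core := by
    refine hom_ext (fun v => ?_) fun o x y _ _ => ?_
    · simp only [LinearMap.comp_apply, core_leafMap, map_zero]
    · simp only [LinearMap.comp_apply, core_join, H.p_b, H.p_p]
  exact LinearMap.congr_fun this x

/-- Every higher operation lies in the image of `h`, which `p` annihilates; only the differential
and the binary operations survive. -/
theorem p_total (x : TreeSpace k V) :
    H.p (H.total x) = H.p (H.q (toLeaf x)) + H.core x := by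
  have hp : ∀ n x, H.p (H.partialMap n x) = H.p (quad H.q H.b x) := by
    intro n x
    induction n with
    | zero => rfl
    | succ n ih => simp only [partialMap, LinearMap.sub_apply, LinearMap.comp_apply, map_sub, ih,
        H.p_h, sub_zero]
  have h1 : H.p ∘ₗ H.total = H.p ∘ₗ quad H.q H.b := treeHom_ext fun t x => by
    rw [LinearMap.comp_apply, total, treeLift_tree]
    exact hp _ _
  have h2 : H.p ∘ₗ quad H.q H.b = H.p ∘ₗ H.q ∘ₗ toLeaf + H.core := by
    refine hom_ext (fun v => ?_) fun o x y _ _ => ?_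
    · simp [core_leafMap]
    · simp [core_join, H.p_b]
  exact LinearMap.congr_fun (h1.trans h2) x

theorem core_lengthProj (l : ℕ) (x : TreeSpace k V) :
    H.core (lengthProj l x) = if 2 = l then H.core x else 0 := by
  have h1 : ∀ l, l ≠ 2 → ∀ x, H.core (lengthProj l x) = 0 := by
    intro l hl x
    rcases Nat.lt_or_ge l 3 with h | h
    · interval_cases l
      · simp
      · rw [lengthProj_one, core_leafMap]
      · exact absurd rfl hl
    · exact quad_lengthProj_eq_zero _ _ h x
  split_ifs with h
  · obtain ⟨n, hn⟩ := exists_sum_lengthProj x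
    have := hn (max n 3) (le_max_left _ _)
    conv_rhs => rw [← this, map_sum]
    rw [Finset.sum_eq_single 2 (fun j _ hj => h1 j hj x) fun h2 =>
      absurd (Finset.mem_range.2 (lt_of_lt_of_le (by omega) (le_max_right _ _))) h2, h]
  · exact h1 l (Ne.symm h) x

/-- By `p_total` the two sides can differ only through terms in which `q` acts on a pair of leaves,
and a cut of a tree with three or more leaves never produces two leaves. -/
theorem core_coder_eq (l : ℕ) (hl : 3 ≤ l) (x : TreeSpace k V) :
    H.core (H.D (lengthProj l x)) = H.core (coder g H.core (lengthProj l x)) := by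
  have key : ∀ z : TreeSpace k V, (∀ o, TensorProduct.map toLeaf toLeaf (split o z) = 0) →
      H.core (H.D z) = H.core (coder g H.core z) := by
    intro z hz
    have hcomm : ∀ o (w : TreeSpace k V ⊗[k] TreeSpace k V),
        TensorProduct.lift ((H.b o).compl₁₂ H.p H.p) (TensorProduct.map toLeaf toLeaf
          (oddExt (sign g) H.D w)) =
        TensorProduct.lift ((H.b o).compl₁₂ H.p H.p) (TensorProduct.map toLeaf toLeaf
          (oddExt (sign g) (coder g H.core) w)) +
        (TensorProduct.lift ((H.b o).compl₁₂ H.p H.p) (TensorProduct.map H.q LinearMap.id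
            (TensorProduct.map toLeaf toLeaf w)) +
          TensorProduct.lift ((H.b o).compl₁₂ H.p H.p) (TensorProduct.map g.sign H.q
            (TensorProduct.map toLeaf toLeaf w))) := by
      intro o w
      induction w using TensorProduct.induction_on with
      | zero => simp
      | tmul a c =>
        simp only [oddExt_tmul, map_add, TensorProduct.map_tmul, toLeaf_coder,
          TensorProduct.lift.tmul, LinearMap.compl₁₂_apply, p_total, p_core, toLeaf_sign,
          LinearMap.add_apply, LinearMap.id_apply]
        abel
      | add a c ha hc =>
        simp only [map_add, ha, hc]
        abel
    rw [core_apply H (H.D z), core_apply H (coder g H.core z)]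
    simp only [split_coder, map_smul]
    rw [hcomm, hcomm, hz, hz]
    simp
  refine key _ fun o => ?_
  rw [split_lengthProj, map_sum]
  refine Finset.sum_eq_zero fun p hp => ?_
  rw [Finset.HasAntidiagonal.mem_antidiagonal] at hp
  rw [← LinearMap.comp_apply, ← TensorProduct.map_comp]
  have h0 : ∀ j, j ≠ 1 → toLeaf ∘ₗ lengthProj (k := k) (V := V) j = 0 := fun j hj =>
    LinearMap.ext fun x => by
      rw [LinearMap.comp_apply, toLeaf_lengthProj, if_neg (Ne.symm hj)]; rfl
  by_cases h : p.1 = 1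
  · rw [h0 p.2 (by omega), TensorProduct.map_zero_right]; rfl
  · rw [h0 p.1 h, TensorProduct.map_zero_left]; rfl

/-- Projection by `p` leaves only the `j = 2` term of the obstruction, which is the composite of the
projected binary operations treated by `quad_coder`. Membership in the cofree Gerstenhaber coalgebra
is essential here. -/
theorem p_obstruction [CharZero k] {l : ℕ} (hl : 3 ≤ l) {x : TreeSpace k V} (hx : x ∈ gerCofree g) :
    H.p (H.obstruction l (lengthProj l x)) = 0 := by
  rw [obstruction, map_neg, map_sum, Finset.sum_eq_single 2]
  · rw [p_total, toLeaf_lengthProj, if_neg (by decide), map_zero, map_zero, zero_add,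
      core_lengthProj, if_pos rfl, core_coder_eq _ _ hl,
      show H.core (coder g H.core _) = 0 from H.quad_coder _ (lengthProj_mem_gerCofree hx l),
      neg_zero]
  · intro j hj hj2
    rw [Finset.mem_Ico] at hj
    rw [p_total, toLeaf_lengthProj, if_neg (by omega), map_zero, map_zero, zero_add,
      core_lengthProj, if_neg (Ne.symm hj2)]
  · intro h
    exact absurd (Finset.mem_Ico.2 ⟨le_rfl, hl⟩) h

theorem D_leafMap (v : V) : H.D (leafMap v) = leafMap (H.q v) := by
  rw [coder_leafMap, total_leafMap]

/-- The square of `D` is an even coderivation, so its root cuts involve `D^2` of shorter pieces and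
vanish by induction. An element without root cuts is a leaf. -/
theorem D_D_eq_leafMap [CharZero k] {l : ℕ}
    (ih : ∀ j < l, ∀ x ∈ gerCofree g, H.D (H.D (lengthProj j x)) = 0)
    {x : TreeSpace k V} (hx : x ∈ gerCofree g) :
    H.D (H.D (lengthProj l x)) = leafMap (H.total (H.D (lengthProj l x))) := by
  refine ext_toLeaf_split (by rw [toLeaf_coder, toLeaf_leafMap]) fun o => ?_
  rw [split_leafMap, split_coder_coder H.total_sign, split_lengthProj, map_sum, map_sum,
    ← Finset.sum_add_distrib]
  refine Finset.sum_eq_zero fun p hp => ?_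
  rw [Finset.HasAntidiagonal.mem_antidiagonal] at hp
  obtain ⟨w, hw⟩ := split_mem_gerCofree g o hx
  rw [← hw]
  clear hw
  -- Either the other factor has length zero and vanishes, or this factor is strictly shorter than
  -- `l`.
  have hz : ∀ j i, j + i = l → ∀ x ∈ gerCofree g, ∀ y : TreeSpace k V,
      H.D (H.D (lengthProj j x)) ⊗ₜ[k] lengthProj i y = 0 ∧
      lengthProj i y ⊗ₜ[k] H.D (H.D (lengthProj j x)) = 0 := by
    intro j i hji x hx y
    rcases Nat.eq_zero_or_pos i with h | h
    · subst h; simp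
    · rw [ih j (by omega) x hx]; simp
  induction w using TensorProduct.induction_on with
  | zero => simp
  | tmul a c =>
    simp only [TensorProduct.mapIncl, TensorProduct.map_tmul, LinearMap.comp_apply,
      LinearMap.id_apply, Submodule.subtype_apply]
    rw [(hz p.1 p.2 hp a a.2 c).1, (hz p.2 p.1 (by omega) c c.2 a).2, add_zero]
  | add a c ha hc =>
    simp only [map_add] at ha hc ⊢
    rw [add_add_add_comm, ha, hc, add_zero]

/-- The recursion produces a differential. -/
theorem D_D_lengthProj [CharZero k] (l : ℕ) : ∀ x ∈ gerCofree g,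
    H.D (H.D (lengthProj l x)) = 0 := by
  induction l using Nat.strong_induction_on with
  | _ l ih =>
  intro x hx
  rcases Nat.lt_or_ge l 3 with hl | hl
  · rw [H.D_D_eq_leafMap ih hx]
    interval_cases l
    · simp
    · rw [lengthProj_one, D_leafMap, total_leafMap, H.q_q, map_zero]
    -- Length two expresses that `q` is a derivation of both operations, which holds on all trees.
    · suffices ∀ x, H.total (H.D (lengthProj 2 x)) = 0 by rw [this, map_zero]
      intro x
      have : H.total ∘ₗ H.D ∘ₗ lengthProj 2 = 0 := by
        refine hom_ext (fun v => ?_) fun o x y _ _ => ?_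
        · simp [lengthProj_leafMap]
        · have e : lengthProj 2 (join o (x ⊗ₜ y)) =
              join (k := k) o (leafMap (toLeaf x) ⊗ₜ leafMap (toLeaf y)) := by
            rw [lengthProj_join]
            simp [Finset.Nat.antidiagonal_succ, lengthProj_one]
          simp only [LinearMap.comp_apply, LinearMap.zero_apply]
          rw [e, coder_join, oddExt_tmul, D_leafMap, D_leafMap, sign_leafMap, total_join_leafMap]
          simp only [map_add, map_smul, total_leafMap, total_join_leafMap]
          exact H.q_b o _ _
      exact LinearMap.congr_fun this x
  · -- `y` has length `l`, and `y'` is the top component of `D y`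
    set y := lengthProj l x with hy
    have hyS : y ∈ gerCofree g := lengthProj_mem_gerCofree hx l
    have hyl : lengthProj l y = y := by rw [hy, lengthProj_lengthProj, if_pos rfl]
    have hDyS : H.D y ∈ gerCofree g := H.D_mem hyS
    set y' := lengthProj l (H.D y) with hy'
    have hyS' : y' ∈ gerCofree g := lengthProj_mem_gerCofree hDyS l
    have hsum : ∀ z ∈ gerCofree g, H.D (lengthProj l z) = leafMap (H.total (lengthProj l z)) +
        (∑ j ∈ Finset.Ico 2 l, lengthProj j (H.D (lengthProj l z))) +
        lengthProj l (H.D (lengthProj l z)) := by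
      intro z _
      have := coder_lengthProj_eq_sum (g := g) (m := H.total) l z
      rw [Finset.sum_range_succ, Finset.range_eq_Ico, Finset.sum_eq_sum_Ico_succ_bot (by omega),
        Finset.sum_eq_sum_Ico_succ_bot (by omega), lengthProj_zero, LinearMap.zero_apply,
        zero_add, lengthProj_one, toLeaf_coder] at this
      exact this
    -- Decomposing by length: the leaf contributes `q m_l = q h Γ`, the intermediate lengths
    -- contribute `- Γ`, and the top component is kept.
    have he : ∀ z ∈ gerCofree g, H.total (H.D (lengthProj l z)) =
        H.q (H.h (H.obstruction l (lengthProj l z))) - H.obstruction l (lengthProj l z) +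
          H.total (lengthProj l (H.D (lengthProj l z))) := by
      intro z hz
      conv_lhs => rw [hsum z hz]
      rw [map_add, map_add, total_leafMap, map_sum, H.total_eq_h_obstruction hl z, obstruction]
      abel
    have hE := H.D_D_eq_leafMap ih hx
    rw [← hy] at hE
    -- the top component of `D` squares to zero
    have htop : lengthProj l (H.D y') = 0 := by
      have h1 : lengthProj l (H.D (H.D y)) = 0 := by
        rw [hE, lengthProj_leafMap, if_neg (by omega)]
      have h2 := hsum x hx
      rw [← hy, ← hy'] at h2
      rw [h2, map_add, map_add, map_add, map_add, D_leafMap, lengthProj_leafMap,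
        if_neg (by omega), map_sum, map_sum, Finset.sum_eq_zero, zero_add, zero_add] at h1
      · exact h1
      · intro j hj
        exact lengthProj_coder_lengthProj (Finset.mem_Ico.1 hj).2 _
    have he1 := he x hx
    rw [← hy, ← hy'] at he1
    have he2 := he (H.D y) hDyS
    rw [← hy', htop, map_zero, add_zero] at he2
    have h3 : H.total y' = H.h (H.obstruction l y') := H.total_eq_h_obstruction hl _
    rw [h3] at he1
    -- `D` commutes with its square
    have hcomm : H.q (H.total (H.D y)) = H.total (H.D y') := by
      have h1 : H.D (H.D (H.D y)) = H.D (H.D y') := by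
        have h2 := hsum x hx
        rw [← hy, ← hy'] at h2
        conv_lhs => rw [h2]
        rw [map_add, map_add, map_add, map_add, D_leafMap, D_leafMap, H.q_q, map_zero, map_sum,
          map_sum, Finset.sum_eq_zero, zero_add, zero_add]
        exact fun j hj => ih j (Finset.mem_Ico.1 hj).2 _ hDyS
      have h2 := congrArg toLeaf h1
      rwa [hE, D_leafMap, toLeaf_leafMap, toLeaf_coder] at h2
    -- In `hcomm` the terms `q h Γ y'` on the two sides cancel, leaving the compatibility of the
    -- obstruction with the differentials.
    have hclosed : H.q (H.obstruction l y) = H.obstruction l y' := by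
      rw [he1, he2, map_add, map_sub, H.q_q] at hcomm
      rw [zero_sub, neg_add_eq_sub] at hcomm
      exact sub_right_injective hcomm
    rw [hE, he1, ← hclosed]
    -- Now `D^2 y` is decorated by `q h Γ y - Γ y + h q Γ y = - p Γ y`, which is zero.
    have h4 := H.q_h (H.obstruction l y)
    rw [H.p_obstruction hl hx, sub_zero] at h4
    rw [sub_add_eq_add_sub, h4, sub_self, map_zero]

theorem D_D [CharZero k] {x : TreeSpace k V} (hx : x ∈ gerCofree g) : H.D (H.D x) = 0 := by
  obtain ⟨n, hn⟩ := exists_sum_lengthProj x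
  rw [← hn n le_rfl, map_sum, map_sum]
  exact Finset.sum_eq_zero fun j _ => H.D_D_lengthProj j x hx

variable {F : ℤ → Submodule k V} {e c r : ℤ}

/-- Here `r` is the degree of `q`, and `h` has the opposite degree. The case `r = 1` is used for the
fermionic degree and `r = 0` for the conformal weight. -/
theorem partialMap_mem (hs : ∀ a, ∀ v ∈ F a, g.sign v ∈ F a)
    (hq : ∀ a, ∀ v ∈ F a, H.q v ∈ F (a + r)) (hh : ∀ a, ∀ v ∈ F a, H.h v ∈ F (a - r))
    (hb : ∀ o a a', ∀ v ∈ F a, ∀ w ∈ F a', H.b o v w ∈ F (a + a' + e + c * o.count + r)) (n : ℕ) :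
    ∀ j, ∀ x ∈ gradedPart F e c j, H.partialMap n x ∈ F (j + r - e) := by
  induction n with
  | zero => exact fun j x hx => quad_mem hq hb hx
  | succ n ih =>
    intro j x hx
    refine sub_mem (ih j x hx) ?_
    change H.h (H.partialMap n (coder g (H.partialMap n) (lengthProj (n + 3) x))) ∈ _
    convert hh _ _ (ih _ _ (coder_mem_gradedPart hs ih (lengthProj_mem_gradedPart (n + 3) hx)))
      using 2
    ring

theorem total_mem (hs : ∀ a, ∀ v ∈ F a, g.sign v ∈ F a)
    (hq : ∀ a, ∀ v ∈ F a, H.q v ∈ F (a + r)) (hh : ∀ a, ∀ v ∈ F a, H.h v ∈ F (a - r))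
    (hb : ∀ o a a', ∀ v ∈ F a, ∀ w ∈ F a', H.b o v w ∈ F (a + a' + e + c * o.count + r))
    (j : ℤ) : ∀ x ∈ gradedPart F e c j, H.total x ∈ F (j + r - e) := by
  suffices gradedPart F e c j ≤ (F (j + r - e)).comap H.total from this
  refine Submodule.span_le.2 ?_
  rintro _ ⟨t, v, d, h, hn, rfl⟩
  change H.total (tree t _) ∈ F _
  rw [total, treeLift_tree]
  exact H.partialMap_mem hs hq hh hb _ _ _ (Submodule.subset_span ⟨t, v, d, h, hn, rfl⟩)

theorem D_mem_gradedPart (hs : ∀ a, ∀ v ∈ F a, g.sign v ∈ F a)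
    (hq : ∀ a, ∀ v ∈ F a, H.q v ∈ F (a + r)) (hh : ∀ a, ∀ v ∈ F a, H.h v ∈ F (a - r))
    (hb : ∀ o a a', ∀ v ∈ F a, ∀ w ∈ F a', H.b o v w ∈ F (a + a' + e + c * o.count + r))
    {j : ℤ} {x : TreeSpace k V} (hx : x ∈ gradedPart F e c j) :
    H.D x ∈ gradedPart F e c (j + r) :=
  coder_mem_gradedPart hs (H.total_mem hs hq hh hb) hx

end HomotopyGerstenhaber
end

/-! ### The Gerstenhaber identities evaluated on the cofree coalgebra. -/

noncomputable section

open TreeSpace Cooperation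

/-- The sign `(-1) ^ n` as a scalar. -/
def ksign (k : Type u) [Field k] (n : ℤ) : k := ((n.negOnePow : ℤ) : k)

section ksign

variable {k : Type u} [Field k]

theorem ksign_add (a b : ℤ) : ksign k (a + b) = ksign k a * ksign k b := by
  simp [ksign, Int.negOnePow_add]

theorem ksign_even {a : ℤ} (h : Even a) : ksign k a = 1 := by
  simp [ksign, Int.negOnePow_even a h]

theorem ksign_odd {a : ℤ} (h : Odd a) : ksign k a = -1 := by
  simp [ksign, Int.negOnePow_odd a h]

theorem ksign_one : ksign k 1 = -1 := ksign_odd odd_one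

theorem ksign_zero : ksign k 0 = 1 := ksign_even Even.zero

theorem ksign_mul_self (a : ℤ) : ksign k a * ksign k a = 1 := by
  rw [← ksign_add, ksign_even ⟨a, rfl⟩]

theorem ksign_smul {M : Type*} [AddCommGroup M] [Module k M] (a : ℤ) (x : M) :
    ksign k a • x = a.negOnePow • x := by
  rw [ksign, Units.smul_def, Int.cast_smul_eq_zsmul]

end ksign

namespace ZGrading

variable {k : Type u} {V : Type v} [Field k] [AddCommGroup V] [Module k V] (g : ZGrading k V)

/-- The vector `x` has the parity of `a`. -/
def HasParity (a : ℤ) (x : V) : Prop := g.sign x = ksign k a • x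

variable {g}

theorem hasParity_of_mem {a : ℤ} {x : V} (hx : x ∈ g.deg a) : g.HasParity a x := g.sign_apply hx

theorem koszulFlip_tmul [CharZero k] {a b : ℤ} {x y : V} (hx : g.HasParity a x)
    (hy : g.HasParity b y) : koszulFlip g.sign (x ⊗ₜ y) = ksign k (a * b) • (y ⊗ₜ[k] x) :=
  _root_.koszulFlip_tmul g.sign hx hy

theorem koszulFlip₁₂_tmul [CharZero k] {a b : ℤ} {x y : V} (hx : g.HasParity a x)
    (hy : g.HasParity b y) (z : V) :
    koszulFlip₁₂ g.sign (x ⊗ₜ (y ⊗ₜ z)) = ksign k (a * b) • (y ⊗ₜ[k] (x ⊗ₜ[k] z)) := by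
  simp [koszulFlip₁₂, koszulFlip_tmul hx hy, ← TensorProduct.smul_tmul']

theorem koszulCycle_tmul [CharZero k] {a b c : ℤ} {x y z : V} (hx : g.HasParity a x)
    (hy : g.HasParity b y) (hz : g.HasParity c z) :
    koszulCycle g.sign (x ⊗ₜ (y ⊗ₜ z)) = ksign k ((a + b) * c) • (z ⊗ₜ[k] (x ⊗ₜ[k] y)) := by
  rw [koszulCycle, LinearMap.comp_apply, TensorProduct.map_tmul, koszulFlip_tmul hy hz,
    TensorProduct.tmul_smul, map_smul, LinearMap.id_apply, koszulFlip₁₂_tmul hx hz, smul_smul,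
    ← ksign_add]
  congr 2
  ring

theorem hom_ext {N : Type*} [AddCommGroup N] [Module k N] {f f' : V →ₗ[k] N}
    (h : ∀ a x, g.HasParity a x → f x = f' x) : f = f' := by
  refine LinearMap.ext fun x => ?_
  have hx : x ∈ ⨆ n, g.deg n := by rw [iSup_deg]; trivial
  refine (iSup_le fun n => ?_ : ⨆ n, g.deg n ≤ LinearMap.eqLocus f f') hx
  exact fun x hx => h n x (hasParity_of_mem hx)

theorem ext_threefold {N : Type*} [AddCommGroup N] [Module k N] {f f' : V ⊗[k] (V ⊗[k] V) →ₗ[k] N}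
    (h : ∀ a b c x y z, g.HasParity a x → g.HasParity b y → g.HasParity c z →
      f (x ⊗ₜ (y ⊗ₜ z)) = f' (x ⊗ₜ (y ⊗ₜ z))) : f = f' := by
  refine TensorProduct.ext (hom_ext (g := g) fun a x hx => ?_)
  refine TensorProduct.ext (hom_ext (g := g) fun b y hy => ?_)
  exact hom_ext (g := g) fun c z hz => h a b c x y z hx hy hz

end ZGrading

namespace TreeSpace

variable {k : Type u} {V : Type v} [Field k] [AddCommGroup V] [Module k V] {g : ZGrading k V}

/-- Moving the last factor in front of the cut pair is the same as flipping first and cutting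
afterwards. On flip-invariant tensors right cuts thus become cycled left cuts. -/
theorem koszulCycle_map_coproduct [CharZero k] (w : TreeSpace k V ⊗[k] TreeSpace k V) :
    koszulCycle (sign g) (TensorProduct.assoc k _ _ _
        (TensorProduct.map (split .coproduct) LinearMap.id w)) =
      TensorProduct.map LinearMap.id (split .coproduct) (koszulFlip (sign g) w) := by
  have hs : ∀ x, split .coproduct (sign g x) =
      TensorProduct.map (sign g) (sign g) (split .coproduct x) :=
    fun x => by simpa [sgn] using LinearMap.congr_fun (split_comp_sign g .coproduct) x
  induction w using TensorProduct.induction_on with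
  | zero => simp
  | tmul x y =>
    rw [TensorProduct.map_tmul, koszulCycle_assoc (sign_comp_sign g), koszulFlip_apply_tmul]
    simp only [map_smul, map_add, map_sub, TensorProduct.map_tmul, LinearMap.id_apply, hs]
  | add a b ha hb => simp only [map_add, ha, hb]

theorem koszulCycle_map_cobracket [CharZero k] (w : TreeSpace k V ⊗[k] TreeSpace k V) :
    koszulCycle (sign g) (TensorProduct.assoc k _ _ _
        (TensorProduct.map (split .cobracket) LinearMap.id w)) =
      TensorProduct.map (sign g) (split .cobracket) (koszulFlip (sign g) w) := by
  have hs : ∀ x, split .cobracket (sign g x) =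
      -TensorProduct.map (sign g) (sign g) (split .cobracket x) :=
    fun x => by simpa [sgn] using LinearMap.congr_fun (split_comp_sign g .cobracket) x
  induction w using TensorProduct.induction_on with
  | zero => simp
  | tmul x y =>
    rw [TensorProduct.map_tmul, koszulCycle_assoc (sign_comp_sign g), koszulFlip_apply_tmul]
    simp only [map_smul, map_add, map_sub, TensorProduct.map_tmul, LinearMap.id_apply, hs,
      sign_sign, TensorProduct.tmul_neg]
    module
  | add a b ha hb => simp only [map_add, ha, hb]

/-- Evaluation of `n (n' (x, y), z)`. -/
def evalLeft (n n' : V →ₗ[k] V →ₗ[k] V) : V ⊗[k] (V ⊗[k] V) →ₗ[k] V :=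
  TensorProduct.lift n ∘ₗ TensorProduct.map (TensorProduct.lift n') LinearMap.id ∘ₗ
    (TensorProduct.assoc k V V V).symm.toLinearMap

/-- Evaluation of `n (x, n' (y, z))`. -/
def evalRight (n n' : V →ₗ[k] V →ₗ[k] V) : V ⊗[k] (V ⊗[k] V) →ₗ[k] V :=
  TensorProduct.lift n ∘ₗ TensorProduct.map LinearMap.id (TensorProduct.lift n')

theorem evalLeft_tmul (n n' : V →ₗ[k] V →ₗ[k] V) (x y z : V) :
    evalLeft n n' (x ⊗ₜ (y ⊗ₜ z)) = n (n' x y) z := by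
  simp [evalLeft]

theorem evalRight_tmul (n n' : V →ₗ[k] V →ₗ[k] V) (x y z : V) :
    evalRight n n' (x ⊗ₜ (y ⊗ₜ z)) = n x (n' y z) := by
  simp [evalRight]

/-- The decorations of the trees with three leaves. -/
def leaves₃ : TreeSpace k V ⊗[k] (TreeSpace k V ⊗[k] TreeSpace k V) →ₗ[k] V ⊗[k] (V ⊗[k] V) :=
  TensorProduct.map toLeaf (TensorProduct.map toLeaf toLeaf)

/-- The decorations after cutting a tree at its root and then its left part. -/
def cutLeft (o o' : Cooperation) : TreeSpace k V →ₗ[k] V ⊗[k] (V ⊗[k] V) :=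
  leaves₃ ∘ₗ (TensorProduct.assoc k _ _ _).toLinearMap ∘ₗ
    TensorProduct.map (split o') LinearMap.id ∘ₗ split o

/-- The decorations after cutting a tree at its root and then its right part. -/
def cutRight (o o' : Cooperation) : TreeSpace k V →ₗ[k] V ⊗[k] (V ⊗[k] V) :=
  leaves₃ ∘ₗ TensorProduct.map LinearMap.id (split o') ∘ₗ split o

theorem quad_zero_apply (n : Cooperation → V →ₗ[k] V →ₗ[k] V) (x : TreeSpace k V) :
    quad 0 n x = TensorProduct.lift (n .coproduct)
        (TensorProduct.map toLeaf toLeaf (split .coproduct x)) +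
      TensorProduct.lift (n .cobracket)
        (TensorProduct.map toLeaf toLeaf (split .cobracket x)) := by
  simp [quad]

/-- The four terms record which factor the coderivation contracts and along which of the two cuts;
composing binary operations becomes evaluation on double cuts. -/
theorem lift_oddExt_quad (n : V →ₗ[k] V →ₗ[k] V) (n' : Cooperation → V →ₗ[k] V →ₗ[k] V)
    (w : TreeSpace k V ⊗[k] TreeSpace k V) :
    TensorProduct.lift n (TensorProduct.map toLeaf toLeaf
        (oddExt (sign g) (coder g (quad 0 n')) w)) =
      evalLeft n (n' .coproduct) (leaves₃ (TensorProduct.assoc k _ _ _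
        (TensorProduct.map (split .coproduct) LinearMap.id w))) +
      evalLeft n (n' .cobracket) (leaves₃ (TensorProduct.assoc k _ _ _
        (TensorProduct.map (split .cobracket) LinearMap.id w))) +
      evalRight n (n' .coproduct) (TensorProduct.map g.sign LinearMap.id
        (leaves₃ (TensorProduct.map LinearMap.id (split .coproduct) w))) +
      evalRight n (n' .cobracket) (TensorProduct.map g.sign LinearMap.id
        (leaves₃ (TensorProduct.map LinearMap.id (split .cobracket) w))) := by
  have h1 : ∀ (n' : V →ₗ[k] V →ₗ[k] V) (u : TreeSpace k V ⊗[k] TreeSpace k V) (y : TreeSpace k V),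
      evalLeft n n' (leaves₃ (TensorProduct.assoc k _ _ _ (u ⊗ₜ y))) =
      n (TensorProduct.lift n' (TensorProduct.map toLeaf toLeaf u)) (toLeaf y) := by
    intro n' u y
    induction u using TensorProduct.induction_on with
    | zero => simp
    | tmul a b => simp [leaves₃, evalLeft_tmul]
    | add a b ha hb => simp only [map_add, TensorProduct.add_tmul, ha, hb, LinearMap.add_apply]
  have h2 : ∀ (n' : V →ₗ[k] V →ₗ[k] V) (u : TreeSpace k V ⊗[k] TreeSpace k V) (y : TreeSpace k V),
      evalRight n n' (TensorProduct.map g.sign LinearMap.id (leaves₃ (y ⊗ₜ u))) =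
      n (g.sign (toLeaf y)) (TensorProduct.lift n' (TensorProduct.map toLeaf toLeaf u)) := by
    intro n' u y
    induction u using TensorProduct.induction_on with
    | zero => simp
    | tmul a b => simp [leaves₃, evalRight_tmul]
    | add a b ha hb => simp only [map_add, TensorProduct.tmul_add, ha, hb]
  induction w using TensorProduct.induction_on with
  | zero => simp
  | tmul a b =>
    simp only [oddExt_tmul, map_add, TensorProduct.map_tmul, toLeaf_coder, LinearMap.id_apply,
      h1, h2, TensorProduct.lift.tmul, quad_zero_apply, toLeaf_sign, LinearMap.add_apply]
    abel
  | add a b ha hb =>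
    simp only [map_add, ha, hb]
    abel

theorem toLeaf_comp_sign (g : ZGrading k V) : toLeaf ∘ₗ sign g = g.sign ∘ₗ toLeaf :=
  LinearMap.ext (toLeaf_sign g)

theorem leaves₃_cycle (w : TreeSpace k V ⊗[k] (TreeSpace k V ⊗[k] TreeSpace k V)) :
    leaves₃ (koszulCycle (sign g) w) = koszulCycle g.sign (leaves₃ w) :=
  (LinearMap.congr_fun (koszulCycle_map (toLeaf_comp_sign g)) w).symm

theorem leaves₃_flip (w : TreeSpace k V ⊗[k] (TreeSpace k V ⊗[k] TreeSpace k V)) :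
    leaves₃ (koszulFlip₁₂ (sign g) w) = koszulFlip₁₂ g.sign (leaves₃ w) :=
  (LinearMap.congr_fun (koszulFlip₁₂_map (toLeaf_comp_sign g)) w).symm

theorem split_flip {x : TreeSpace k V} (hx : x ∈ gerCofree g) (o : Cooperation) :
    koszulFlip (sign g) (split o x) = split o x := by
  cases o
  · exact (gerCofree_isGerstenhaberSubcoalgebra g).cocommutative x hx
  · exact (gerCofree_isGerstenhaberSubcoalgebra g).cosymmetric x hx

section relations

variable {x : TreeSpace k V}

/-- Graded symmetry of the root cut reduces right double cuts to left ones. -/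
theorem cutRight_coproduct [CharZero k] (hx : x ∈ gerCofree g) (o : Cooperation) :
    cutRight o .coproduct x = koszulCycle g.sign (cutLeft o .coproduct x) := by
  simp only [cutLeft, cutRight, LinearMap.comp_apply, LinearEquiv.coe_coe]
  rw [← leaves₃_cycle, koszulCycle_map_coproduct, split_flip hx]

theorem map_sign_leaves₃ (w : TreeSpace k V ⊗[k] (TreeSpace k V ⊗[k] TreeSpace k V)) :
    leaves₃ (TensorProduct.map (sign g) LinearMap.id w) =
      TensorProduct.map g.sign LinearMap.id (leaves₃ w) := by
  simp only [leaves₃, ← LinearMap.comp_apply, ← TensorProduct.map_comp, toLeaf_comp_sign,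
    LinearMap.comp_id, LinearMap.id_comp]

theorem map_sign_cutRight (o o' : Cooperation) (x : TreeSpace k V) :
    TensorProduct.map g.sign LinearMap.id (cutRight o o' x) =
      leaves₃ (TensorProduct.map (sign g) (split o') (split o x)) := by
  simp only [cutRight, LinearMap.comp_apply]
  rw [← map_sign_leaves₃]
  have : TensorProduct.map (sign g) (LinearMap.id (M := TreeSpace k V ⊗[k] TreeSpace k V)) ∘ₗ
      TensorProduct.map LinearMap.id (split o') =
      TensorProduct.map (sign g) (split o') := by
    rw [← TensorProduct.map_comp, LinearMap.comp_id, LinearMap.id_comp]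
  exact congrArg leaves₃ (LinearMap.congr_fun this (split o x))

theorem map_sign_cutRight_cobracket [CharZero k] (hx : x ∈ gerCofree g) (o : Cooperation) :
    TensorProduct.map g.sign LinearMap.id (cutRight o .cobracket x) =
      koszulCycle g.sign (cutLeft o .cobracket x) := by
  rw [map_sign_cutRight]
  simp only [cutLeft, LinearMap.comp_apply, LinearEquiv.coe_coe]
  rw [← leaves₃_cycle, koszulCycle_map_cobracket, split_flip hx]

/-- The factors of a root cut lie again in the cofree Gerstenhaber coalgebra, so the second cut is
symmetric as well. -/
theorem cutLeft_flip (hx : x ∈ gerCofree g) (o o' : Cooperation) :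
    koszulFlip₁₂ g.sign (cutLeft o o' x) = cutLeft o o' x := by
  simp only [cutLeft, LinearMap.comp_apply, LinearEquiv.coe_coe]
  rw [← leaves₃_flip]
  congr 1
  obtain ⟨w, hw⟩ := split_mem_gerCofree g o hx
  rw [← hw]
  clear hw
  induction w using TensorProduct.induction_on with
  | zero => simp
  | tmul a b =>
    simp [koszulFlip₁₂, TensorProduct.mapIncl, split_flip a.2]
  | add a b ha hb => simp only [map_add, ha, hb]

end relations

/-- Two binary operations, a graded commutative and associative product and an odd bracket, both
graded symmetric, which satisfy the Gerstenhaber identities in symmetric form. -/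
structure IsSymmetricGerstenhaber (g : ZGrading k V) (n : Cooperation → V →ₗ[k] V →ₗ[k] V) :
    Prop where
  parity_coproduct : ∀ a b x y, g.HasParity a x → g.HasParity b y →
    g.HasParity (a + b + 1) (n .coproduct x y)
  parity_cobracket : ∀ a b x y, g.HasParity a x → g.HasParity b y →
    g.HasParity (a + b) (n .cobracket x y)
  symm : ∀ o a b x y, g.HasParity a x → g.HasParity b y →
    n o x y = ksign k (a * b) • n o y x
  assoc : ∀ x y z, n .cobracket (n .cobracket x y) z = n .cobracket x (n .cobracket y z)
  jacobi : ∀ a b c x y z, g.HasParity a x → g.HasParity b y → g.HasParity c z →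
    n .coproduct (n .coproduct x y) z
      + ksign k ((a + b) * c) • n .coproduct (n .coproduct z x) y
      + ksign k (a * (b + c)) • n .coproduct (n .coproduct y z) x = 0
  leibniz : ∀ a b c x y z, g.HasParity a x → g.HasParity b y → g.HasParity c z →
    n .coproduct (n .cobracket x y) z =
      ksign k a • n .cobracket x (n .coproduct y z)
        + ksign k (a * b + b) • n .cobracket y (n .coproduct x z)

namespace IsSymmetricGerstenhaber

variable {n : Cooperation → V →ₗ[k] V →ₗ[k] V} [CharZero k]

theorem evalRight_cycle_cobracket (h : IsSymmetricGerstenhaber g n) (o : Cooperation) :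
    evalRight (n o) (n .cobracket) ∘ₗ koszulCycle g.sign = evalLeft (n o) (n .cobracket) := by
  refine ZGrading.ext_threefold (g := g) fun a b c x y z hx hy hz => ?_
  rw [LinearMap.comp_apply, ZGrading.koszulCycle_tmul hx hy hz, map_smul, evalRight_tmul,
    evalLeft_tmul, h.symm o _ _ _ _ (h.parity_cobracket _ _ _ _ hx hy) hz]

theorem evalRight_cycle_coproduct (h : IsSymmetricGerstenhaber g n) (o : Cooperation) :
    evalRight (n o) (n .coproduct) ∘ₗ TensorProduct.map g.sign LinearMap.id ∘ₗ
      koszulCycle g.sign = evalLeft (n o) (n .coproduct) := by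
  refine ZGrading.ext_threefold (g := g) fun a b c x y z hx hy hz => ?_
  rw [LinearMap.comp_apply, LinearMap.comp_apply, ZGrading.koszulCycle_tmul hx hy hz, map_smul,
    map_smul, TensorProduct.map_tmul, LinearMap.id_apply, evalRight_tmul, hz, map_smul,
    LinearMap.smul_apply, smul_smul, ← ksign_add,
    evalLeft_tmul, h.symm o _ _ _ _ (h.parity_coproduct _ _ _ _ hx hy) hz]
  congr 2
  ring

/-- Associativity passes from left to right nesting, and graded symmetry of the outer product passes
back at the cost of a cyclic permutation. -/
theorem evalLeft_cobracket_cycle (h : IsSymmetricGerstenhaber g n) :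
    evalLeft (n .cobracket) (n .cobracket) ∘ₗ koszulCycle g.sign =
      evalLeft (n .cobracket) (n .cobracket) := by
  have e : evalLeft (n .cobracket) (n .cobracket) = evalRight (n .cobracket) (n .cobracket) :=
    ZGrading.ext_threefold (g := g) fun a b c x y z _ _ _ => by
      rw [evalLeft_tmul, evalRight_tmul, h.assoc]
  conv_lhs => rw [e]
  exact h.evalRight_cycle_cobracket _

theorem evalLeft_coproduct_cycle (h : IsSymmetricGerstenhaber g n)
    (w : V ⊗[k] (V ⊗[k] V)) :
    evalLeft (n .coproduct) (n .coproduct) w +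
      evalLeft (n .coproduct) (n .coproduct) (koszulCycle g.sign w) +
      evalLeft (n .coproduct) (n .coproduct) (koszulCycle g.sign (koszulCycle g.sign w)) = 0 := by
  suffices evalLeft (n .coproduct) (n .coproduct) +
      evalLeft (n .coproduct) (n .coproduct) ∘ₗ koszulCycle g.sign +
      evalLeft (n .coproduct) (n .coproduct) ∘ₗ koszulCycle g.sign ∘ₗ koszulCycle g.sign = 0 from
    LinearMap.congr_fun this w
  refine ZGrading.ext_threefold (g := g) fun a b c x y z hx hy hz => ?_
  simp only [LinearMap.add_apply, LinearMap.comp_apply, ZGrading.koszulCycle_tmul hx hy hz,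
    map_smul, ZGrading.koszulCycle_tmul hz hx hy, evalLeft_tmul, smul_smul, ← ksign_add,
    LinearMap.zero_apply]
  rw [← h.jacobi a b c x y z hx hy hz]
  congr 2
  rw [show (a + b) * c + (c + a) * b = a * (b + c) + (b * c + b * c) by ring, ksign_add,
    ksign_even ⟨_, rfl⟩, mul_one]

/-- The Leibniz rule has two terms, and graded symmetry of the inner bracket lets each be written
twice, which explains the factor two and the four permutations. This shape matches the dual
co-Leibniz rule. -/
theorem evalLeft_leibniz (h : IsSymmetricGerstenhaber g n)
    (w : V ⊗[k] (V ⊗[k] V)) :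
    (2 : k) • evalLeft (n .coproduct) (n .cobracket) w =
      evalRight (n .cobracket) (n .coproduct) (TensorProduct.map g.sign LinearMap.id (
        w + koszulFlip₁₂ g.sign (koszulCycle g.sign w) + koszulFlip₁₂ g.sign w +
          koszulFlip₁₂ g.sign (koszulCycle g.sign (koszulFlip₁₂ g.sign w)))) := by
  suffices (2 : k) • evalLeft (n .coproduct) (n .cobracket) =
      evalRight (n .cobracket) (n .coproduct) ∘ₗ TensorProduct.map g.sign LinearMap.id ∘ₗ (
        LinearMap.id + koszulFlip₁₂ g.sign ∘ₗ koszulCycle g.sign + koszulFlip₁₂ g.sign +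
          koszulFlip₁₂ g.sign ∘ₗ koszulCycle g.sign ∘ₗ koszulFlip₁₂ g.sign) from
    LinearMap.congr_fun this w
  refine ZGrading.ext_threefold (g := g) fun a b c x y z hx hy hz => ?_
  simp only [LinearMap.add_apply, LinearMap.comp_apply, LinearMap.smul_apply, LinearMap.id_apply,
    ZGrading.koszulCycle_tmul hx hy hz, ZGrading.koszulFlip₁₂_tmul hx hy,
    ZGrading.koszulFlip₁₂_tmul hz hx, ZGrading.koszulFlip₁₂_tmul hz hy,
    ZGrading.koszulCycle_tmul hy hx hz, map_smul, map_add, evalLeft_tmul, evalRight_tmul,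
    TensorProduct.map_tmul]
  rw [hx, hy]
  simp only [map_smul, LinearMap.smul_apply]
  rw [h.symm .coproduct _ _ z y hz hy, h.symm .coproduct _ _ z x hz hx,
    h.leibniz a b c x y z hx hy hz]
  simp only [map_smul, smul_smul, ← ksign_add, smul_add]
  have e1 : ksign k ((a + b) * c + (c * a + (a + c * b))) = ksign k a := by
    rw [show (a + b) * c + (c * a + (a + c * b)) = a + ((a + b) * c + (a + b) * c) by ring, ksign_add,
      ksign_even ⟨_, rfl⟩, mul_one]
  have e2 : ksign k (a * b + ((b + a) * c + (c * b + (b + c * a)))) = ksign k (a * b + b) := by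
    rw [show a * b + ((b + a) * c + (c * b + (b + c * a))) =
      (a * b + b) + ((a + b) * c + (a + b) * c) by ring, ksign_add,
      ksign_even ⟨_, rfl⟩, mul_one]
  rw [e1, e2]
  module

/-- The Gerstenhaber identities, evaluated on the cofree Gerstenhaber coalgebra. -/
theorem quad_coder (h : IsSymmetricGerstenhaber g n) {x : TreeSpace k V} (hx : x ∈ gerCofree g) :
    quad 0 n (coder g (quad 0 n) x) = 0 := by
  have hS := gerCofree_isGerstenhaberSubcoalgebra g
  have hcop : ∀ o, evalRight (n o) (n .coproduct) (TensorProduct.map g.sign LinearMap.id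
      (cutRight o .coproduct x)) = evalLeft (n o) (n .coproduct) (cutLeft o .coproduct x) := by
    intro o
    rw [cutRight_coproduct hx, ← h.evalRight_cycle_coproduct o]
    rfl
  have hcob : ∀ o, evalRight (n o) (n .cobracket) (TensorProduct.map g.sign LinearMap.id
      (cutRight o .cobracket x)) = evalLeft (n o) (n .cobracket) (cutLeft o .cobracket x) := by
    intro o
    rw [map_sign_cutRight_cobracket hx, ← h.evalRight_cycle_cobracket o]
    rfl
  -- By symmetry, contracting the right factor contributes the same as contracting the left one.
  have hexp : ∀ o, TensorProduct.lift (n o) (TensorProduct.map toLeaf toLeaf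
        (oddExt (sign g) (coder g (quad 0 n)) (split o x))) =
      (2 : k) • (evalLeft (n o) (n .coproduct) (cutLeft o .coproduct x) +
        evalLeft (n o) (n .cobracket) (cutLeft o .cobracket x)) := by
    intro o
    rw [lift_oddExt_quad]
    have e1 := hcop o
    have e2 := hcob o
    simp only [cutLeft, cutRight, LinearMap.comp_apply, LinearEquiv.coe_coe] at e1 e2 ⊢
    rw [e1, e2]
    module
  have h3 : (3 : k) ≠ 0 := by norm_num
  -- the associativity terms
  have hB : evalLeft (n .cobracket) (n .cobracket) (cutLeft .cobracket .cobracket x) = 0 := by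
    have h1 := congrArg (evalLeft (n .cobracket) (n .cobracket) ∘ₗ leaves₃)
      (hS.coJacobi x hx _ rfl)
    simp only [LinearMap.comp_apply, map_add, map_zero, leaves₃_cycle] at h1
    have h2 := LinearMap.congr_fun h.evalLeft_cobracket_cycle
    simp only [LinearMap.comp_apply] at h2
    rw [h2, h2, h2] at h1
    -- Cyclic invariance makes the three terms of co-Jacobi evaluate equally, so their common value
    -- is killed by `3`.
    refine (smul_eq_zero_iff_right h3).1 (Eq.trans ?_ h1)
    simp only [cutLeft, LinearMap.comp_apply, LinearEquiv.coe_coe]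
    module
  -- the Jacobi terms
  have hA : evalLeft (n .coproduct) (n .coproduct) (cutLeft .coproduct .coproduct x) = 0 := by
    -- Coassociativity with cocommutativity makes this double cut cyclically invariant; the Jacobi
    -- sum then consists of three equal terms.
    have h1 : koszulCycle g.sign (cutLeft .coproduct .coproduct x) =
        cutLeft .coproduct .coproduct x := by
      rw [← cutRight_coproduct hx]
      simp only [cutLeft, cutRight, LinearMap.comp_apply, LinearEquiv.coe_coe]
      rw [hS.coassociative x hx]
    have h2 := h.evalLeft_coproduct_cycle (cutLeft .coproduct .coproduct x)
    rw [h1, h1] at h2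
    refine (smul_eq_zero_iff_right h3).1 (Eq.trans ?_ h2)
    module
  -- the Leibniz terms
  have hC : evalLeft (n .coproduct) (n .cobracket) (cutLeft .coproduct .cobracket x) =
      evalLeft (n .cobracket) (n .coproduct) (cutLeft .cobracket .coproduct x) := by
    -- As the double cut is flip-invariant, the four permutations in `evalLeft_leibniz` pair up to
    -- twice the right-hand side of co-Leibniz.
    have h1 := congrArg leaves₃ (hS.coLeibniz x hx)
    rw [map_add, leaves₃_flip, ← map_sign_cutRight, map_sign_cutRight_cobracket hx] at h1
    change cutRight .cobracket .coproduct x = cutLeft .coproduct .cobracket x + _ at h1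
    have h2 := h.evalLeft_leibniz (cutLeft .coproduct .cobracket x)
    rw [cutLeft_flip hx, add_assoc, ← h1, ← two_smul k, map_smul, map_smul, hcop] at h2
    exact smul_right_injective _ two_ne_zero h2
  -- The two mixed terms agree by `hC` and carry opposite values of `sgn`, so they cancel.
  rw [quad_zero_apply, split_coder, split_coder, map_smul, map_smul, map_smul, map_smul, hexp,
    hexp, hA, hB, hC]
  simp [sgn]

end IsSymmetricGerstenhaber

end TreeSpace
end

/-! ### Consequences of the Borcherds identity. -/

noncomputable section

open TreeSpace Cooperation

section scale

variable {k : Type u} {V : Type v} [Field k] [AddCommGroup V] [Module k V]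
variable {ι : Type*} [DecidableEq ι] {F : ι → Submodule k V}

/-- The operator acting on the `i`-th summand of a decomposition by the scalar `f i`. -/
def DirectSum.IsInternal.scale (hF : DirectSum.IsInternal F) (f : ι → k) : V →ₗ[k] V :=
  (DirectSum.toModule k ι V fun i => f i • (F i).subtype) ∘ₗ
    (LinearEquiv.ofBijective (DirectSum.coeLinearMap F) hF).symm.toLinearMap

theorem DirectSum.IsInternal.scale_apply (hF : DirectSum.IsInternal F) (f : ι → k) {i : ι} {x : V}
    (hx : x ∈ F i) : hF.scale f x = f i • x := by
  have h : (LinearEquiv.ofBijective (DirectSum.coeLinearMap F) hF).symm x =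
      DirectSum.lof k ι (fun i => F i) i ⟨x, hx⟩ :=
    (LinearEquiv.symm_apply_eq _).2 (DirectSum.coeLinearMap_lof (A := F) i ⟨x, hx⟩).symm
  simp only [scale, LinearMap.comp_apply, LinearEquiv.coe_coe]
  rw [h, DirectSum.toModule_lof]
  simp

theorem DirectSum.IsInternal.hom_ext {N : Type*} [AddCommGroup N] [Module k N]
    (hF : DirectSum.IsInternal F) {f f' : V →ₗ[k] N}
    (h : ∀ i, ∀ x ∈ F i, f x = f' x) : f = f' := by
  refine LinearMap.ext fun x => ?_
  have hx : x ∈ ⨆ i, F i := by rw [hF.submodule_iSup_eq_top]; trivial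
  exact (iSup_le h : ⨆ i, F i ≤ LinearMap.eqLocus f f') hx

end scale

theorem neg_one_pow_val_mul_val (a b : ℤ) :
    (-1 : ℤ) ^ ((a : ZMod 2).val * (b : ZMod 2).val) = ((a * b).negOnePow : ℤ) := by
  have he : ∀ {n : ℤ}, Even n → (n : ZMod 2) = 0 := fun h =>
    (ZMod.intCast_zmod_eq_zero_iff_dvd _ 2).2 h.two_dvd
  have ho : ∀ {n : ℤ}, Odd n → (n : ZMod 2) = 1 := by
    rintro _ ⟨m, rfl⟩
    push_cast
    rw [show (2 : ZMod 2) = 0 from rfl, zero_mul, zero_add]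
  rcases Int.even_or_odd a with ha | ha
  · rw [he ha, Int.negOnePow_even _ (ha.mul_right b)]
    simp
  · rcases Int.even_or_odd b with hb | hb
    · rw [he hb, Int.negOnePow_even _ (hb.mul_left a)]
      simp
    · rw [ho ha, ho hb, Int.negOnePow_odd _ (ha.mul hb), ZMod.val_one]
      simp

theorem exists_intCast_zmod_two (p : ZMod 2) : ∃ a : ℤ, (a : ZMod 2) = p :=
  ⟨p.val, by simp⟩

namespace VertexSuperalgebra

variable {k : Type u} {V : Type v} [Field k] [AddCommGroup V] [Module k V]
variable (A : VertexSuperalgebra k V)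

/-- The Borcherds commutator formula. -/
theorem commutator (m l : ℤ) {i j a b : ℤ} {x y : V} (hx : x ∈ A.comp (i, a))
    (hy : y ∈ A.comp (j, b)) (z : V) :
    ∑ᶠ r : ℕ, Ring.choose m r • A.op (m + l - r) (A.op r x y) z =
      A.op m x (A.op l y z) - ksign k (a * b) • A.op l y (A.op m x z) := by
  have h := A.borcherds m 0 l i j a b x hx y hy z
  simp only [zero_add] at h
  -- For `n = 0` the binomial coefficients leave only the term `r = 0` on the right.
  rw [h, finsum_eq_single _ 0]
  · rw [neg_one_pow_val_mul_val, ksign, Int.cast_smul_eq_zsmul]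
    simp
  · intro r hr
    rw [Ring.choose_zero_pos ℤ (Nat.pos_of_ne_zero hr)]
    simp

/-- The case `m = 0` of the commutator formula has a single term: zero modes are derivations of all
products. -/
theorem op_zero_op {i j a b : ℤ} {x y : V} (hx : x ∈ A.comp (i, a))
    (hy : y ∈ A.comp (j, b)) (l : ℤ) (z : V) :
    A.op 0 x (A.op l y z) = ksign k (a * b) • A.op l y (A.op 0 x z) + A.op l (A.op 0 x y) z := by
  have h := A.commutator 0 l hx hy z
  rw [finsum_eq_single _ 0] at h
  · simp only [Ring.choose_zero_right, one_smul, Nat.cast_zero, sub_zero, zero_add] at h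
    rw [h]
    abel
  · intro r hr
    rw [Ring.choose_zero_pos ℤ (Nat.pos_of_ne_zero hr), zero_smul]

/-- The case `m = 1` has two terms. The extra one, `(x_(0) y)_(0) z`, measures how far a first mode
is from being a derivation of the product; for `x = G` it is the bracket. -/
theorem op_one_op {i j a b : ℤ} {x y : V} (hx : x ∈ A.comp (i, a))
    (hy : y ∈ A.comp (j, b)) (z : V) :
    A.op 1 x (A.op (-1) y z) = ksign k (a * b) • A.op (-1) y (A.op 1 x z) +
      A.op 0 (A.op 0 x y) z + A.op (-1) (A.op 1 x y) z := by
  have h := A.commutator 1 (-1) hx hy z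
  have hc : ∀ r, Ring.choose (1 : ℤ) r = (Nat.choose 1 r : ℤ) := fun r => by
    rw [← Ring.choose_natCast, Nat.cast_one]
  rw [finsum_eq_sum_of_support_subset _ (s := Finset.range 2)] at h
  · simp only [Finset.sum_range_succ, Finset.range_zero, Finset.sum_empty, hc] at h
    simp at h
    rw [add_assoc, h]
    abel
  · intro r hr
    rw [Finset.coe_range, Set.mem_Iio]
    by_contra hn
    refine hr ?_
    simp only
    rw [hc, Nat.choose_eq_zero_of_lt (by omega)]
    simp

/-- The result would have weight `- r - 1 < 0`. -/
theorem op_nonneg_eq_zero {a b : ℤ} {x y : V} (hx : x ∈ A.comp (0, a))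
    (hy : y ∈ A.comp (0, b)) (r : ℕ) : A.op r x y = 0 := by
  have h := A.op_mem r 0 0 a b x hx y hy
  rw [A.nonneg _ _ (by omega)] at h
  exact (Submodule.mem_bot k).1 h

theorem op_neg_one_left_comm {a b : ℤ} {x y : V} (hx : x ∈ A.comp (0, a))
    (hy : y ∈ A.comp (0, b)) (z : V) :
    A.op (-1) x (A.op (-1) y z) = ksign k (a * b) • A.op (-1) y (A.op (-1) x z) := by
  have h := A.commutator (-1) (-1) hx hy z
  rw [finsum_eq_zero_of_forall_eq_zero] at h
  · exact sub_eq_zero.1 h.symm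
  · intro r
    rw [A.op_nonneg_eq_zero hx hy, map_zero, LinearMap.zero_apply, smul_zero]

/-- Apply the commuting left multiplications to the vacuum, a right unit. -/
theorem op_neg_one_comm {a b : ℤ} {x y : V} (hx : x ∈ A.comp (0, a))
    (hy : y ∈ A.comp (0, b)) :
    A.op (-1) x y = ksign k (a * b) • A.op (-1) y x := by
  have h := A.op_neg_one_left_comm hx hy A.vac
  rwa [A.op_vac, A.op_vac] at h

theorem op_neg_one_mem {a b : ℤ} {x y : V} (hx : x ∈ A.comp (0, a))
    (hy : y ∈ A.comp (0, b)) : A.op (-1) x y ∈ A.comp (0, ((a + b : ℤ) : ZMod 2)) := by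
  have h := A.op_mem (-1) 0 0 a b x hx y hy
  rwa [← Int.cast_add] at h

/-- Commutativity reduces this to commuting left multiplications: bring `z` to the front, past `x`,
and back inside. -/
theorem op_neg_one_assoc {a b c : ℤ} {x y z : V} (hx : x ∈ A.comp (0, a))
    (hy : y ∈ A.comp (0, b)) (hz : z ∈ A.comp (0, c)) :
    A.op (-1) (A.op (-1) x y) z = A.op (-1) x (A.op (-1) y z) := by
  rw [A.op_neg_one_comm (A.op_neg_one_mem hx hy) hz, A.op_neg_one_left_comm hz hx,
    A.op_neg_one_comm hz hy, map_smul, smul_smul, smul_smul, ← ksign_add, ← ksign_add,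
    ksign_even, one_smul]
  exact ⟨(a + b) * c, by ring⟩

theorem hom_ext {N : Type*} [AddCommGroup N] [Module k N] {f f' : V →ₗ[k] N}
    (h : ∀ i a : ℤ, ∀ x ∈ A.comp (i, (a : ZMod 2)), f x = f' x) : f = f' := by
  refine A.internal.hom_ext fun ip x hx => ?_
  obtain ⟨i, p⟩ := ip
  obtain ⟨a, rfl⟩ := exists_intCast_zmod_two p
  exact h i a x hx

end VertexSuperalgebra

namespace TopologicalVertexAlgebra

variable {k : Type u} {V : Type v} [Field k] [AddCommGroup V] [Module k V]
variable (A : TopologicalVertexAlgebra k V)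

theorem Q_mem_comp : A.Q ∈ A.comp (1, ((1 : ℤ) : ZMod 2)) := by
  rw [Int.cast_one]; exact A.Q_mem

theorem G_mem_comp : A.G ∈ A.comp (2, ((1 : ℤ) : ZMod 2)) := by
  rw [Int.cast_one]; exact A.G_mem

theorem L_mem_comp : A.L ∈ A.comp (2, ((0 : ℤ) : ZMod 2)) := by
  rw [Int.cast_zero]; exact A.L_mem

/-- The bilinear map `(x, y) ↦ (G_(0) x)_(0) y`. -/
def preBracket : V →ₗ[k] V →ₗ[k] V := A.op 0 ∘ₗ A.op 0 A.G

theorem preBracket_apply (x y : V) : A.preBracket x y = A.op 0 (A.op 0 A.G x) y := rfl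

variable {A}

theorem op_mem_comp {n i j a b : ℤ} {x y : V} (hx : x ∈ A.comp (i, (a : ZMod 2)))
    (hy : y ∈ A.comp (j, (b : ZMod 2))) :
    A.op n x y ∈ A.comp (i + j - n - 1, ((a + b : ℤ) : ZMod 2)) := by
  rw [Int.cast_add]
  exact A.op_mem n i j a b x hx y hy

theorem G_zero_mem {i a : ℤ} {x : V} (hx : x ∈ A.comp (i, (a : ZMod 2))) :
    A.op 0 A.G x ∈ A.comp (i + 1, ((a + 1 : ℤ) : ZMod 2)) := by
  have := op_mem_comp (n := 0) A.G_mem_comp hx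
  rwa [show 2 + i - 0 - 1 = i + 1 by ring, add_comm 1 a] at this

theorem homotopy_mem {i a : ℤ} {x : V} (hx : x ∈ A.comp (i, (a : ZMod 2))) :
    A.homotopy x ∈ A.comp (i, ((a + 1 : ℤ) : ZMod 2)) := by
  have := op_mem_comp (n := 1) A.G_mem_comp hx
  rwa [show 2 + i - 1 - 1 = i by ring, add_comm 1 a] at this

theorem differential_mem {i a : ℤ} {x : V} (hx : x ∈ A.comp (i, (a : ZMod 2))) :
    A.differential x ∈ A.comp (i, ((a + 1 : ℤ) : ZMod 2)) := by
  have := op_mem_comp (n := 0) A.Q_mem_comp hx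
  rwa [show 1 + i - 0 - 1 = i by ring, add_comm 1 a] at this

theorem preBracket_mem {i j a b : ℤ} {x y : V} (hx : x ∈ A.comp (i, (a : ZMod 2)))
    (hy : y ∈ A.comp (j, (b : ZMod 2))) :
    A.preBracket x y ∈ A.comp (i + j, ((a + b + 1 : ℤ) : ZMod 2)) := by
  have := op_mem_comp (n := 0) (G_zero_mem hx) hy
  rwa [show i + 1 + j - 0 - 1 = i + j by ring, show a + 1 + b = a + b + 1 by ring] at this

theorem mul_mem {i j a b : ℤ} {x y : V} (hx : x ∈ A.comp (i, (a : ZMod 2)))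
    (hy : y ∈ A.comp (j, (b : ZMod 2))) :
    A.op (-1) x y ∈ A.comp (i + j, ((a + b : ℤ) : ZMod 2)) := by
  have := op_mem_comp (n := -1) hx hy
  rwa [show i + j - -1 - 1 = i + j by ring] at this

variable (A)

/-- The differential is a derivation of every product. -/
theorem differential_op {i a : ℤ} {x : V} (hx : x ∈ A.comp (i, (a : ZMod 2))) (n : ℤ) (y : V) :
    A.differential (A.op n x y) =
      A.op n (A.differential x) y + ksign k a • A.op n x (A.differential y) := by
  have := A.op_zero_op A.Q_mem_comp hx n y
  rw [one_mul] at this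
  rw [differential, this, add_comm]

/-- `L_(1)` counts the conformal weight, which is additive for the product, so the defect term in
`op_one_op` for `L` must vanish. In the usual language, `L_(0)` is translation and zero modes of
total derivatives are zero. -/
theorem op_zero_L_zero {x : V} : A.op 0 (A.op 0 A.L x) = 0 := by
  suffices A.op 0 ∘ₗ A.op 0 A.L = 0 from LinearMap.congr_fun this x
  refine A.hom_ext fun i a x hx => A.hom_ext fun j b y hy => ?_
  have h := A.op_one_op A.L_mem_comp hx y
  rw [A.L_eigen _ _ _ hx, A.L_eigen _ _ _ hy, A.L_eigen _ _ _ (mul_mem hx hy), zero_mul,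
    ksign_zero, one_smul, map_smul, map_smul, LinearMap.smul_apply] at h
  push_cast at h
  rw [LinearMap.comp_apply, LinearMap.zero_apply, LinearMap.zero_apply]
  have h2 : A.op 0 (A.op 0 A.L x) y = ((i : k) + (j : k)) • A.op (-1) x y -
      ((j : k) • A.op (-1) x y + (i : k) • A.op (-1) x y) := by
    rw [h]
    abel
  rw [h2]
  module

/-- `[Q_(0), G_(0)] = L_(0)`, and the resulting contribution vanishes by `op_zero_L_zero`. -/
theorem differential_preBracket {i a : ℤ} {x : V} (hx : x ∈ A.comp (i, (a : ZMod 2))) (y : V) :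
    A.differential (A.preBracket x y) =
      -A.preBracket (A.differential x) y - ksign k a • A.preBracket x (A.differential y) := by
  rw [preBracket_apply, A.differential_op (G_zero_mem hx), ksign_add, ksign_one,
    preBracket_apply, preBracket_apply]
  have h : A.differential (A.op 0 A.G x) = A.op 0 A.L x - A.op 0 A.G (A.differential x) :=
    eq_sub_of_add_eq (A.Q_G 0 x)
  rw [h, map_sub, LinearMap.sub_apply, op_zero_L_zero, LinearMap.zero_apply]
  module

/-- The bracket measures the failure of the homotopy to be a derivation of the product. -/
theorem preBracket_eq {i a : ℤ} {x : V} (hx : x ∈ A.comp (i, (a : ZMod 2))) (y : V) :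
    A.preBracket x y = A.homotopy (A.op (-1) x y) - ksign k a • A.op (-1) x (A.homotopy y)
      - A.op (-1) (A.homotopy x) y := by
  have h := A.op_one_op A.G_mem_comp hx y
  rw [one_mul] at h
  rw [homotopy, h, preBracket_apply]
  abel

/-- Bracketing with `x` is the zero mode of `G_(0) x`, hence a derivation of the product. -/
theorem preBracket_mul {i j a b : ℤ} {x y : V} (hx : x ∈ A.comp (i, (a : ZMod 2)))
    (hy : y ∈ A.comp (j, (b : ZMod 2))) (z : V) :
    A.preBracket x (A.op (-1) y z) = A.op (-1) (A.preBracket x y) z +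
      ksign k ((a + 1) * b) • A.op (-1) y (A.preBracket x z) := by
  have h := A.op_zero_op (G_zero_mem hx) hy (-1) z
  rw [preBracket_apply, h, preBracket_apply, preBracket_apply, add_comm]

theorem homotopy_homotopy (x : V) : A.homotopy (A.homotopy x) = 0 := A.G_sq x

/-- Expanding all brackets as defects of `G_(1)`, the relation `G_(1)^2 = 0` makes `G_(1)` a
derivation of the bracket, up to sign. -/
theorem preBracket_homotopy {i a : ℤ} {x : V} (hx : x ∈ A.comp (i, (a : ZMod 2))) (y : V) :
    A.preBracket x (A.homotopy y) = -(ksign k a • A.homotopy (A.preBracket x y))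
      - ksign k a • A.preBracket (A.homotopy x) y := by
  rw [A.preBracket_eq hx, A.preBracket_eq hx, A.preBracket_eq (homotopy_mem hx)]
  simp only [map_sub, map_smul, homotopy_homotopy, smul_zero, map_zero, LinearMap.zero_apply,
    sub_zero, zero_sub, smul_sub, smul_neg, smul_smul, ksign_add, ksign_one, ksign_mul_self,
    one_smul, mul_neg, mul_one, neg_smul]
  abel

/-- The Jacobi identity in derivation form. Write the inner bracket as the defect of `G_(1)`, apply
the derivation rules for the product and for `G_(1)`, and recollect. No symmetry of the bracket is
needed, so it holds in every weight. -/
theorem preBracket_preBracket {i j a b : ℤ} {x y : V} (hx : x ∈ A.comp (i, (a : ZMod 2)))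
    (hy : y ∈ A.comp (j, (b : ZMod 2))) (z : V) :
    A.preBracket x (A.preBracket y z) = -(ksign k a • A.preBracket (A.preBracket x y) z)
      - ksign k (a + (a + 1) * b) • A.preBracket y (A.preBracket x z) := by
  have sa := ksign_mul_self (k := k) a
  have sb := ksign_mul_self (k := k) b
  have sab := ksign_mul_self (k := k) (a * b)
  conv_lhs => rw [A.preBracket_eq hy, map_sub, map_sub, map_smul, A.preBracket_homotopy hx,
    A.preBracket_mul hx hy, A.preBracket_mul hx hy, A.preBracket_mul (homotopy_mem hx) hy,
    A.preBracket_mul hx (homotopy_mem hy), A.preBracket_homotopy hx, A.preBracket_homotopy hx]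
  rw [A.preBracket_eq (preBracket_mem hx hy), A.preBracket_eq hy]
  simp only [map_sub, map_add, map_neg, map_smul, LinearMap.sub_apply, LinearMap.neg_apply,
    LinearMap.smul_apply, smul_sub, smul_add, smul_neg, smul_smul, ksign_add, ksign_one, add_mul,
    mul_add, one_mul, mul_one]
  -- Only the squares of the signs matter from here on; comparing coefficients is then polynomial
  -- algebra.
  generalize ksign k a = ε at *
  generalize ksign k b = η at *
  generalize ksign k (a * b) = θ at *
  match_scalars <;> grind

end TopologicalVertexAlgebra
end

/-! ### Parity, conformal weight and the contracting homotopy. -/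

noncomputable section

open TreeSpace Cooperation

theorem ksign_intCast_val (k : Type u) [Field k] (a : ℤ) :
    ksign k ((a : ZMod 2).val : ℤ) = ksign k a := by
  rcases Int.even_or_odd a with ha | ha
  · rw [(ZMod.intCast_zmod_eq_zero_iff_dvd _ 2).2 ha.two_dvd, ksign_even ha]
    exact ksign_zero
  · obtain ⟨m, rfl⟩ := ha
    have : ((2 * m + 1 : ℤ) : ZMod 2) = 1 := by
      push_cast
      rw [show (2 : ZMod 2) = 0 from rfl, zero_mul, zero_add]
    rw [this, ksign_odd ⟨m, rfl⟩, ZMod.val_one]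
    exact ksign_one

namespace TopologicalVertexAlgebra

variable {k : Type u} {V : Type v} [Field k] [CharZero k] [AddCommGroup V] [Module k V]
variable (A : TopologicalVertexAlgebra k V)

section parity

/-- By `J_parity` the fermionic degree modulo two is the superspace parity, so signs can be computed
on the components of the vertex superalgebra. -/
theorem sign_eq_scale :
    A.fermionic.sign = A.internal.scale fun ip => ksign k (ip.2.val : ℤ) := by
  refine A.fermionic.internal.hom_ext fun n x hx => ?_
  rw [A.fermionic.sign_apply hx]
  have hle : ⨆ s : ℤ, A.comp (s, (n : ZMod 2)) ≤
      LinearMap.eqLocus (A.internal.scale fun ip => ksign k (ip.2.val : ℤ))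
        (ksign k n • LinearMap.id) := by
    refine iSup_le fun s x hx => ?_
    rw [LinearMap.mem_eqLocus, A.internal.scale_apply _ hx, ksign_intCast_val]
    rfl
  exact (hle (A.J_parity n hx)).symm

variable {A}

theorem hasParity_of_mem_comp {i a : ℤ} {x : V} (hx : x ∈ A.comp (i, (a : ZMod 2))) :
    A.fermionic.HasParity a x := by
  rw [ZGrading.HasParity, sign_eq_scale, A.internal.scale_apply _ hx, ksign_intCast_val]

theorem sign_mem_comp {ip : ℤ × ZMod 2} {x : V} (hx : x ∈ A.comp ip) :
    A.fermionic.sign x ∈ A.comp ip := by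
  rw [sign_eq_scale, A.internal.scale_apply _ hx]
  exact Submodule.smul_mem _ _ hx

/-- A vector of a given parity is a sum of vectors of that parity which are homogeneous for the
conformal weight. -/
theorem mem_iSup_comp_of_hasParity {a : ℤ} {x : V} (hx : A.fermionic.HasParity a x) :
    x ∈ ⨆ i : ℤ, A.comp (i, (a : ZMod 2)) := by
  -- This operator is the projection to the parity of `a`, and it fixes vectors of that parity.
  have h : ∀ x, (2 : k)⁻¹ • (x + ksign k a • A.fermionic.sign x) ∈
      ⨆ i : ℤ, A.comp (i, (a : ZMod 2)) := by
    intro x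
    have hmem : x ∈ ⨆ ip, A.comp ip := by
      rw [A.internal.submodule_iSup_eq_top]; trivial
    have hle : ⨆ ip, A.comp ip ≤ (⨆ i : ℤ, A.comp (i, (a : ZMod 2))).comap
        ((2 : k)⁻¹ • (LinearMap.id + ksign k a • A.fermionic.sign)) := by
      refine iSup_le fun ip x hx => ?_
      obtain ⟨i, p⟩ := ip
      change (2 : k)⁻¹ • (x + ksign k a • A.fermionic.sign x) ∈ ⨆ i : ℤ, A.comp (i, (a : ZMod 2))
      by_cases hp : p = (a : ZMod 2)
      · subst hp
        refine Submodule.mem_iSup_of_mem i (Submodule.smul_mem _ _ (add_mem hx ?_))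
        exact Submodule.smul_mem _ _ (sign_mem_comp hx)
      · obtain ⟨b, rfl⟩ := exists_intCast_zmod_two p
        have hodd : Odd (a + b) := by
          rw [← Int.not_even_iff_odd]
          rintro h
          apply hp
          have := (ZMod.intCast_zmod_eq_zero_iff_dvd _ 2).2 h.two_dvd
          push_cast at this
          rw [← sub_eq_zero, ← this, sub_eq_add_neg, add_comm (a : ZMod 2)]
          congr 1
          exact ZMod.neg_eq_self_mod_two _
        rw [hasParity_of_mem_comp hx, smul_smul, ← ksign_add, ksign_odd hodd, neg_one_smul,
          add_neg_cancel, smul_zero]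
        exact zero_mem _
    exact hle hmem
  have h2 := h x
  rwa [hx, smul_smul, ksign_mul_self, one_smul, ← two_smul k x, smul_smul,
    inv_mul_cancel₀ two_ne_zero, one_smul] at h2

theorem sign_comp_eq_neg {f : V →ₗ[k] V}
    (h : ∀ i a x, x ∈ A.comp (i, ((a : ℤ) : ZMod 2)) → ∃ j, f x ∈ A.comp (j, ((a + 1 : ℤ) : ZMod 2)))
    (v : V) : f (A.fermionic.sign v) = -A.fermionic.sign (f v) := by
  suffices f ∘ₗ A.fermionic.sign = -(A.fermionic.sign ∘ₗ f) from LinearMap.congr_fun this v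
  refine A.hom_ext fun i a x hx => ?_
  obtain ⟨j, hj⟩ := h i a x hx
  rw [LinearMap.comp_apply, LinearMap.neg_apply, LinearMap.comp_apply, hasParity_of_mem_comp hx,
    hasParity_of_mem_comp hj, map_smul, ksign_add, ksign_one]
  module

end parity

section weight

/-- The projection to conformal weight zero. -/
def weightZero : V →ₗ[k] V := A.internal.scale fun ip => if ip.1 = 0 then 1 else 0

/-- The inverse of the conformal weight, extended by zero. -/
def weightInv : V →ₗ[k] V := A.internal.scale fun ip => (ip.1 : k)⁻¹

/-- The contracting homotopy onto the part of conformal weight zero. -/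
def contraction : V →ₗ[k] V := A.homotopy ∘ₗ A.weightInv

variable {A}

theorem weightZero_apply {ip : ℤ × ZMod 2} {x : V} (hx : x ∈ A.comp ip) :
    A.weightZero x = if ip.1 = 0 then x else 0 := by
  rw [weightZero, A.internal.scale_apply _ hx]
  split_ifs <;> simp

theorem weightInv_apply {ip : ℤ × ZMod 2} {x : V} (hx : x ∈ A.comp ip) :
    A.weightInv x = (ip.1 : k)⁻¹ • x := A.internal.scale_apply _ hx

theorem contraction_apply {ip : ℤ × ZMod 2} {x : V} (hx : x ∈ A.comp ip) :
    A.contraction x = (ip.1 : k)⁻¹ • A.homotopy x := by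
  rw [contraction, LinearMap.comp_apply, weightInv_apply hx, map_smul]

theorem contraction_mem {i a : ℤ} {x : V} (hx : x ∈ A.comp (i, (a : ZMod 2))) :
    A.contraction x ∈ A.comp (i, ((a + 1 : ℤ) : ZMod 2)) := by
  rw [contraction_apply hx]
  exact Submodule.smul_mem _ _ (homotopy_mem hx)

theorem weightZero_mem {a : ℤ} {x : V} (hx : A.fermionic.HasParity a x) :
    A.weightZero x ∈ A.comp (0, (a : ZMod 2)) := by
  have hle : ⨆ i : ℤ, A.comp (i, (a : ZMod 2)) ≤ (A.comp (0, (a : ZMod 2))).comap A.weightZero := by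
    refine iSup_le fun i x hx => ?_
    rw [Submodule.mem_comap, weightZero_apply hx]
    split_ifs with h
    · obtain rfl : i = 0 := h
      exact hx
    · exact zero_mem _
  exact hle (mem_iSup_comp_of_hasParity hx)

theorem weightZero_weightZero (x : V) : A.weightZero (A.weightZero x) = A.weightZero x := by
  suffices A.weightZero ∘ₗ A.weightZero = A.weightZero from LinearMap.congr_fun this x
  refine A.hom_ext fun i a x hx => ?_
  rw [LinearMap.comp_apply, weightZero_apply hx]
  split_ifs with h
  · rw [weightZero_apply hx, if_pos h]
  · rw [map_zero]

theorem weightZero_contraction (x : V) : A.weightZero (A.contraction x) = 0 := by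
  suffices A.weightZero ∘ₗ A.contraction = 0 from LinearMap.congr_fun this x
  refine A.hom_ext fun i a x hx => ?_
  rw [LinearMap.comp_apply, weightZero_apply (contraction_mem hx), contraction_apply hx]
  split_ifs with h
  -- The convention `0⁻¹ = 0` makes the contraction vanish in weight zero.
  · obtain rfl : i = 0 := h
    simp
  · rfl

/-- `[Q_(0), G_(1)] = L_(1)` acts by the weight, which can be divided out when nonzero; in weight
zero both sides vanish. -/
theorem differential_contraction (x : V) :
    A.differential (A.contraction x) + A.contraction (A.differential x) = x - A.weightZero x := by
  suffices A.differential ∘ₗ A.contraction + A.contraction ∘ₗ A.differential =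
    LinearMap.id - A.weightZero from LinearMap.congr_fun this x
  refine A.hom_ext fun i a x hx => ?_
  have h : A.differential (A.homotopy x) + A.homotopy (A.differential x) = (i : k) • x :=
    (A.Q_G 1 x).trans (A.L_eigen _ _ _ hx)
  simp only [LinearMap.add_apply, LinearMap.comp_apply, LinearMap.sub_apply, LinearMap.id_apply]
  rw [contraction_apply hx, contraction_apply (differential_mem hx), map_smul, ← smul_add, h,
    smul_smul, weightZero_apply hx]
  by_cases hi : i = 0
  · subst hi; simp
  · rw [inv_mul_cancel₀ (Int.cast_ne_zero.2 hi), if_neg hi, one_smul, sub_zero]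

/-- Weights are non-negative and add, so the total weight is zero only if both weights are. -/
theorem weightZero_bilin {b : V →ₗ[k] V →ₗ[k] V}
    (hb : ∀ i j a a' : ℤ, ∀ x ∈ A.comp (i, (a : ZMod 2)), ∀ y ∈ A.comp (j, (a' : ZMod 2)),
      ∃ p, b x y ∈ A.comp (i + j, p)) (x y : V) :
    A.weightZero (b x y) = b (A.weightZero x) (A.weightZero y) := by
  suffices b.compr₂ A.weightZero = b.compl₁₂ A.weightZero A.weightZero from
    LinearMap.congr_fun₂ this x y
  refine A.hom_ext fun i a x hx => A.hom_ext fun j a' y hy => ?_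
  rw [LinearMap.compr₂_apply, LinearMap.compl₁₂_apply]
  rcases lt_or_ge i 0 with hi | hi
  · rw [A.nonneg _ _ hi, Submodule.mem_bot] at hx
    simp [hx]
  rcases lt_or_ge j 0 with hj | hj
  · rw [A.nonneg _ _ hj, Submodule.mem_bot] at hy
    simp [hy]
  obtain ⟨p, hp⟩ := hb i j a a' x hx y hy
  rw [weightZero_apply hp, weightZero_apply hx, weightZero_apply hy]
  by_cases h : i = 0
  · by_cases h' : j = 0
    · simp [h, h']
    · rw [if_neg (by simpa [h] using h'), if_neg (show ¬ j = 0 from h'), map_zero]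
  · rw [if_neg (by dsimp only; omega), if_neg (show ¬ i = 0 from h), map_zero,
      LinearMap.zero_apply]

end weight

/-! ### The Gerstenhaber identities in weight zero. -/

section operations

/-- The binary operations of the vertex algebra. -/
def ops : Cooperation → V →ₗ[k] V →ₗ[k] V
  | coproduct => A.preBracket
  | cobracket => A.op (-1)

/-- The binary operations on the part of conformal weight zero. -/
def zeroOps (o : Cooperation) : V →ₗ[k] V →ₗ[k] V :=
  (A.ops o).compl₁₂ A.weightZero A.weightZero

variable {A}

theorem weightZero_ops (o : Cooperation) (x y : V) :
    A.weightZero (A.ops o x y) = A.ops o (A.weightZero x) (A.weightZero y) := by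
  cases o
  · exact weightZero_bilin (fun i j a a' x hx y hy => ⟨_, preBracket_mem hx hy⟩) x y
  · exact weightZero_bilin (fun i j a a' x hx y hy => ⟨_, mul_mem hx hy⟩) x y

theorem zeroOps_apply (o : Cooperation) (x y : V) :
    A.zeroOps o x y = A.ops o (A.weightZero x) (A.weightZero y) := rfl

theorem zeroOps_zeroOps_left (o o' : Cooperation) (x y z : V) :
    A.zeroOps o (A.zeroOps o' x y) z =
      A.ops o (A.ops o' (A.weightZero x) (A.weightZero y)) (A.weightZero z) := by
  rw [zeroOps_apply, zeroOps_apply, weightZero_ops, weightZero_weightZero, weightZero_weightZero]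

theorem zeroOps_zeroOps_right (o o' : Cooperation) (x y z : V) :
    A.zeroOps o x (A.zeroOps o' y z) =
      A.ops o (A.weightZero x) (A.ops o' (A.weightZero y) (A.weightZero z)) := by
  rw [zeroOps_apply, zeroOps_apply, weightZero_ops, weightZero_weightZero, weightZero_weightZero]

/-- In weight zero the product is graded commutative, and the expression of the bracket as the
defect of `G_(1)` inherits the symmetry. -/
theorem preBracket_symm {a b : ℤ} {x y : V} (hx : x ∈ A.comp (0, (a : ZMod 2)))
    (hy : y ∈ A.comp (0, (b : ZMod 2))) :
    A.preBracket x y = ksign k (a * b) • A.preBracket y x := by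
  rw [A.preBracket_eq hx, A.preBracket_eq hy, A.op_neg_one_comm hx hy,
    A.op_neg_one_comm hx (homotopy_mem hy), A.op_neg_one_comm (homotopy_mem hx) hy]
  simp only [map_smul, smul_sub, smul_smul, mul_add, add_mul, ksign_add, mul_one, one_mul]
  have sa := ksign_mul_self (k := k) a
  have sb := ksign_mul_self (k := k) b
  generalize ksign k a = ε at *
  generalize ksign k b = η at *
  generalize ksign k (a * b) = θ at *
  match_scalars <;> grind

variable (A)

/-- Multiplicativity of the projection lets nested operations be computed on weight-zero inputs,
where symmetry is available. Jacobi and Leibniz then come from `preBracket_preBracket` and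
`preBracket_mul` by rearranging arguments. -/
theorem zeroOps_isSymmetricGerstenhaber : IsSymmetricGerstenhaber A.fermionic A.zeroOps := by
  refine ⟨fun a b x y hx hy => ?_, fun a b x y hx hy => ?_, fun o a b x y hx hy => ?_,
    fun x y z => ?_, fun a b c x y z hx hy hz => ?_, fun a b c x y z hx hy hz => ?_⟩
  · exact hasParity_of_mem_comp (preBracket_mem (weightZero_mem hx) (weightZero_mem hy))
  · exact hasParity_of_mem_comp (mul_mem (weightZero_mem hx) (weightZero_mem hy))
  · cases o
    · exact preBracket_symm (weightZero_mem hx) (weightZero_mem hy)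
    · exact A.op_neg_one_comm (weightZero_mem hx) (weightZero_mem hy)
  · have : evalLeft (A.zeroOps .cobracket) (A.zeroOps .cobracket) =
        evalRight (A.zeroOps .cobracket) (A.zeroOps .cobracket) :=
      ZGrading.ext_threefold (g := A.fermionic) fun a b c x y z hx hy hz => by
        rw [evalLeft_tmul, evalRight_tmul, zeroOps_zeroOps_left, zeroOps_zeroOps_right]
        exact A.op_neg_one_assoc (weightZero_mem hx) (weightZero_mem hy) (weightZero_mem hz)
    have h := LinearMap.congr_fun this (x ⊗ₜ (y ⊗ₜ z))
    rwa [evalLeft_tmul, evalRight_tmul] at h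
  · rw [zeroOps_zeroOps_left, zeroOps_zeroOps_left, zeroOps_zeroOps_left]
    replace hx := weightZero_mem hx
    replace hy := weightZero_mem hy
    replace hz := weightZero_mem hz
    generalize A.weightZero x = x at *
    generalize A.weightZero y = y at *
    generalize A.weightZero z = z at *
    change A.preBracket (A.preBracket x y) z + _ • A.preBracket (A.preBracket z x) y
      + _ • A.preBracket (A.preBracket y z) x = 0
    -- Symmetry brings the last two terms into right-nested form, to which the derivation form of
    -- Jacobi applies.
    rw [preBracket_symm (x := A.preBracket y z) (preBracket_mem hy hz) hx,
      preBracket_symm hz hx, map_smul, LinearMap.smul_apply,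
      preBracket_symm (x := A.preBracket x z) (preBracket_mem hx hz) hy,
      A.preBracket_preBracket hx hy]
    simp only [smul_sub, smul_neg, smul_smul, mul_add, add_mul, ksign_add, one_mul,
      mul_comm b a, mul_comm c a, mul_comm c b]
    have sa := ksign_mul_self (k := k) a
    have sb := ksign_mul_self (k := k) (b * c)
    have sc := ksign_mul_self (k := k) (a * c)
    have sd := ksign_mul_self (k := k) (a * b)
    generalize ksign k a = ε at *
    generalize ksign k b = η at *
    generalize ksign k (a * b) = θ₁ at *
    generalize ksign k (a * c) = θ₂ at *
    generalize ksign k (b * c) = θ₃ at *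
    match_scalars <;> grind
  · rw [zeroOps_zeroOps_left, zeroOps_zeroOps_right, zeroOps_zeroOps_right]
    replace hx := weightZero_mem hx
    replace hy := weightZero_mem hy
    replace hz := weightZero_mem hz
    generalize A.weightZero x = x at *
    generalize A.weightZero y = y at *
    generalize A.weightZero z = z at *
    change A.preBracket (A.op (-1) x y) z = _ • A.op (-1) x (A.preBracket y z) +
      _ • A.op (-1) y (A.preBracket x z)
    rw [preBracket_symm (x := A.op (-1) x y) (mul_mem hx hy) hz, A.preBracket_mul hz hx,
      preBracket_symm hz hx, preBracket_symm hz hy, map_smul, map_smul, LinearMap.smul_apply,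
      A.op_neg_one_comm (x := A.preBracket x z) (preBracket_mem hx hz) hy]
    simp only [smul_add, smul_smul, add_mul, ksign_add, one_mul, mul_comm c a, mul_comm c b]
    have sb := ksign_mul_self (k := k) (b * c)
    have sc := ksign_mul_self (k := k) (a * c)
    generalize ksign k a = ε at *
    generalize ksign k b = η at *
    generalize ksign k (a * b) = θ₁ at *
    generalize ksign k (a * c) = θ₂ at *
    generalize ksign k (b * c) = θ₃ at *
    match_scalars <;> grind

variable {A}

/-- Each identity is homogeneous in the operations, linear or quadratic, so a common rescaling is
harmless. -/
theorem _root_.TreeSpace.IsSymmetricGerstenhaber.smul {g : ZGrading k V}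
    {n : Cooperation → V →ₗ[k] V →ₗ[k] V} (h : IsSymmetricGerstenhaber g n) (r : k) :
    IsSymmetricGerstenhaber g fun o => r • n o := by
  have hp : ∀ a x, g.HasParity a x → g.HasParity a (r • x) := fun a x hx => by
    rw [ZGrading.HasParity, map_smul, hx, smul_comm]
  refine ⟨fun a b x y hx hy => hp _ _ (h.parity_coproduct a b x y hx hy),
    fun a b x y hx hy => hp _ _ (h.parity_cobracket a b x y hx hy), fun o a b x y hx hy => ?_,
    fun x y z => ?_, fun a b c x y z hx hy hz => ?_, fun a b c x y z hx hy hz => ?_⟩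
  · rw [LinearMap.smul_apply, LinearMap.smul_apply, LinearMap.smul_apply, LinearMap.smul_apply,
      h.symm o a b x y hx hy, smul_comm]
  · simp only [LinearMap.smul_apply, map_smul, h.assoc]
  · have := congrArg (fun z => r • r • z) (h.jacobi a b c x y z hx hy hz)
    simp only [LinearMap.smul_apply, map_smul]
    rw [← smul_zero r, ← smul_zero r, ← this]
    module
  · simp only [LinearMap.smul_apply, map_smul, h.leibniz a b c x y z hx hy hz]
    module

theorem ops_q (o : Cooperation) (x y : V) :
    A.differential (A.ops o x y) + sgn k o • (A.ops o (A.differential x) y +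
      A.ops o (A.fermionic.sign x) (A.differential y)) = 0 := by
  suffices (A.ops o).compr₂ A.differential + sgn k o • (A.ops o ∘ₗ A.differential +
      (A.ops o).compl₁₂ A.fermionic.sign A.differential) = 0 from LinearMap.congr_fun₂ this x y
  refine A.hom_ext fun i a x hx => LinearMap.ext fun y => ?_
  simp only [LinearMap.add_apply, LinearMap.compr₂_apply, LinearMap.smul_apply,
    LinearMap.comp_apply, LinearMap.compl₁₂_apply, LinearMap.zero_apply]
  rw [hasParity_of_mem_comp hx, map_smul, LinearMap.smul_apply]
  cases o
  · simp only [ops, sgn]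
    rw [A.differential_preBracket hx]
    module
  · simp only [ops, sgn]
    rw [A.differential_op hx]
    module

theorem ops_sign (o : Cooperation) (x y : V) :
    A.fermionic.sign (A.ops o x y) =
      -(sgn k o • A.ops o (A.fermionic.sign x) (A.fermionic.sign y)) := by
  suffices (A.ops o).compr₂ A.fermionic.sign =
      -(sgn k o • (A.ops o).compl₁₂ A.fermionic.sign A.fermionic.sign) from
    LinearMap.congr_fun₂ this x y
  refine A.hom_ext fun i a x hx => A.hom_ext fun j b y hy => ?_
  simp only [LinearMap.compr₂_apply, LinearMap.smul_apply, LinearMap.neg_apply,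
    LinearMap.compl₁₂_apply]
  rw [hasParity_of_mem_comp hx, hasParity_of_mem_comp hy]
  cases o
  · simp only [ops, sgn]
    rw [hasParity_of_mem_comp (preBracket_mem hx hy), ksign_add, ksign_add, ksign_one]
    simp only [map_smul, LinearMap.smul_apply]
    module
  · simp only [ops, sgn]
    rw [hasParity_of_mem_comp (mul_mem hx hy), ksign_add]
    simp only [map_smul, LinearMap.smul_apply]
    module

variable (A)

/-- The contraction of the vertex algebra onto its part of conformal weight zero. -/
def homotopyGerstenhaber : HomotopyGerstenhaber A.fermionic where
  q := A.differential
  h := A.contraction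
  p := A.weightZero
  -- The length-two elements of the coalgebra are symmetric sums of two trees, so one half makes the
  -- structure map return the symmetrization.
  b o := (2 : k)⁻¹ • A.ops o
  q_sign := sign_comp_eq_neg fun _ _ _ hx => ⟨_, differential_mem hx⟩
  h_sign := sign_comp_eq_neg fun _ _ _ hx => ⟨_, contraction_mem hx⟩
  b_sign o v w := by
    simp only [LinearMap.smul_apply, map_smul, ops_sign]
    module
  q_q := A.Q_sq
  q_b o v w := by
    simp only [LinearMap.smul_apply, map_smul]
    rw [← smul_add, smul_comm, ← smul_add, ops_q, smul_zero]
  q_h := differential_contraction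
  p_p := weightZero_weightZero
  p_h := weightZero_contraction
  p_b o v w := by simp only [LinearMap.smul_apply, map_smul, weightZero_ops]
  quad_coder _ hx := (A.zeroOps_isSymmetricGerstenhaber.smul (2 : k)⁻¹).quad_coder hx

end operations

end TopologicalVertexAlgebra
end

/-! ### Gerstenhaber algebras from symmetric operations, and their subquotients. -/

noncomputable section

open TreeSpace Cooperation

theorem ksign_sub {k : Type u} [Field k] (a b : ℤ) : ksign k (a - b) = ksign k a * ksign k b := by
  simp [ksign, Int.negOnePow_sub]

namespace TreeSpace.IsSymmetricGerstenhaber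

variable {k : Type u} {V : Type v} [Field k] [CharZero k] [AddCommGroup V] [Module k V]
variable {g : ZGrading k V} {n : Cooperation → V →ₗ[k] V →ₗ[k] V}

/-- Graded symmetric operations with the dual Gerstenhaber identities are a Gerstenhaber algebra
after the shift of the bracket by the parity operator. -/
theorem isGerstenhaberAlgebra (h : IsSymmetricGerstenhaber g n)
    (hmul : ∀ a b, ∀ x ∈ g.deg a, ∀ y ∈ g.deg b, n .cobracket x y ∈ g.deg (a + b))
    (hbrac : ∀ a b, ∀ x ∈ g.deg a, ∀ y ∈ g.deg b, n .coproduct x y ∈ g.deg (a + b - 1)) :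
    IsGerstenhaberAlgebra g.deg (n .cobracket) (n .coproduct ∘ₗ g.sign) := by
  have hs : ∀ {a x}, x ∈ g.deg a → ∀ y, (n .coproduct ∘ₗ g.sign) x y =
      ksign k a • n .coproduct x y := fun hx y => by
    rw [LinearMap.comp_apply, ZGrading.hasParity_of_mem hx, map_smul, LinearMap.smul_apply]
  have sgns := ksign_mul_self (k := k)
  refine ⟨g.internal, hmul, fun a b x hx y hy => ?_, h.assoc, fun a b x hx y hy => ?_,
    fun a b x hx y hy => ?_, fun a b c x hx y hy z hz => ?_, fun a b c x hx y hy z hz => ?_⟩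
  · rw [← ksign_smul (k := k)]
    exact h.symm _ _ _ _ _ (ZGrading.hasParity_of_mem hx) (ZGrading.hasParity_of_mem hy)
  · rw [hs hx]
    exact Submodule.smul_mem _ _ (hbrac a b x hx y hy)
  · rw [← ksign_smul (k := k), hs hx, hs hy,
      h.symm .coproduct _ _ _ _ (ZGrading.hasParity_of_mem hx) (ZGrading.hasParity_of_mem hy)]
    simp only [mul_sub, sub_mul, ksign_sub, mul_one, one_mul, ksign_one]
    have sa := sgns a
    have sb := sgns b
    generalize ksign k a = ε at *
    generalize ksign k b = η at *
    generalize ksign k (a * b) = θ at *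
    match_scalars
    grind
  · simp only [← ksign_smul (k := k)]
    rw [hs hx, hs hy, hs hz, map_smul, map_smul, map_smul, LinearMap.smul_apply,
      LinearMap.smul_apply, LinearMap.smul_apply, hs (hbrac a b x hx y hy),
      hs (hbrac b c y hy z hz), hs (hbrac c a z hz x hx)]
    have e := h.jacobi a b c x y z (ZGrading.hasParity_of_mem hx) (ZGrading.hasParity_of_mem hy) (ZGrading.hasParity_of_mem hz)
    rw [add_assoc, add_eq_zero_iff_eq_neg] at e
    rw [e]
    simp only [mul_sub, sub_mul, mul_add, add_mul, ksign_add, ksign_sub, mul_one, one_mul,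
      ksign_one]
    have sa := sgns a
    have sb := sgns b
    have sc := sgns c
    have sab := sgns (a * b)
    have sac := sgns (a * c)
    have sbc := sgns (b * c)
    generalize ksign k a = ε at *
    generalize ksign k b = η at *
    generalize ksign k c = ζ at *
    generalize ksign k (a * b) = θ₁ at *
    generalize ksign k (a * c) = θ₂ at *
    generalize ksign k (b * c) = θ₃ at *
    match_scalars <;> grind
  · have px := ZGrading.hasParity_of_mem hx
    have py := ZGrading.hasParity_of_mem hy
    have pz := ZGrading.hasParity_of_mem hz
    -- The symmetric Leibniz rule has the product in the first slot of the bracket; graded symmetry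
    -- moves it to the second.
    rw [← ksign_smul (k := k), hs hx, hs hx, hs hx,
      h.symm .coproduct _ _ _ _ px (h.parity_cobracket _ _ _ _ py pz),
      h.leibniz b c a y z x py pz px, h.symm .coproduct _ _ _ _ pz px,
      h.symm .cobracket _ _ _ _ pz (h.parity_coproduct _ _ _ _ py px),
      h.symm .coproduct _ _ _ _ py px]
    simp only [map_smul, LinearMap.smul_apply, sub_mul, mul_add, ksign_add, ksign_sub, mul_one,
      one_mul, mul_comm c a, mul_comm b a, mul_comm c b]
    have sa := sgns a
    have sb := sgns b
    have sc := sgns c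
    have sab := sgns (a * b)
    have sac := sgns (a * c)
    have sbc := sgns (b * c)
    generalize ksign k a = ε at *
    generalize ksign k b = η at *
    generalize ksign k c = ζ at *
    generalize ksign k (a * b) = θ₁ at *
    generalize ksign k (a * c) = θ₂ at *
    generalize ksign k (b * c) = θ₃ at *
    match_scalars <;> grind

end TreeSpace.IsSymmetricGerstenhaber

section subquotient

variable {k : Type u} {V : Type v} [Field k] [AddCommGroup V] [Module k V]
variable {W : Type*} [AddCommGroup W] [Module k W] {E : Submodule k V}

/-- A Gerstenhaber structure passes to a subquotient. -/
theorem IsGerstenhaberAlgebra.of_surjective {deg : ℤ → Submodule k V} {mul brac : V →ₗ[k] V →ₗ[k] V}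
    (h : IsGerstenhaberAlgebra deg mul brac) {φ : E →ₗ[k] W} (hφ : Function.Surjective φ)
    {mulW bracW : W →ₗ[k] W →ₗ[k] W}
    (internal : DirectSum.IsInternal fun n => ((deg n).submoduleOf E).map φ)
    (hmul : ∀ x y : E, ∃ h : mul x y ∈ E, mulW (φ x) (φ y) = φ ⟨mul x y, h⟩)
    (hbrac : ∀ x y : E, ∃ h : brac x y ∈ E, bracW (φ x) (φ y) = φ ⟨brac x y, h⟩) :
    IsGerstenhaberAlgebra (fun n => ((deg n).submoduleOf E).map φ) mulW bracW := by
  choose m hm using hmul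
  choose b hb using hbrac
  have hu : ∀ (u : ℤˣ) (x : E), u • φ x = φ (u • x) := fun u x => by
    rw [Units.smul_def, Units.smul_def, map_zsmul]
  refine ⟨internal, ?_, ?_, fun x y z => ?_, ?_, ?_, ?_, ?_⟩
  · rintro i j _ ⟨x, hx, rfl⟩ _ ⟨y, hy, rfl⟩
    exact ⟨_, h.mul_mem i j x hx y hy, (hm x y).symm⟩
  · rintro i j _ ⟨x, hx, rfl⟩ _ ⟨y, hy, rfl⟩
    rw [hm, hm, hu]
    exact congrArg φ (Subtype.ext (h.mul_comm i j x hx y hy))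
  · obtain ⟨x, rfl⟩ := hφ x
    obtain ⟨y, rfl⟩ := hφ y
    obtain ⟨z, rfl⟩ := hφ z
    rw [hm, hm, hm, hm]
    exact congrArg φ (Subtype.ext (h.mul_assoc x y z))
  · rintro i j _ ⟨x, hx, rfl⟩ _ ⟨y, hy, rfl⟩
    exact ⟨_, h.brac_mem i j x hx y hy, (hb x y).symm⟩
  · rintro i j _ ⟨x, hx, rfl⟩ _ ⟨y, hy, rfl⟩
    rw [hb, hb, hu, ← map_add, ← map_zero φ]
    exact congrArg φ (Subtype.ext (h.brac_skew i j x hx y hy))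
  · rintro i j l _ ⟨x, hx, rfl⟩ _ ⟨y, hy, rfl⟩ _ ⟨z, hz, rfl⟩
    simp only [hb]
    rw [hu, hu, ← map_add, ← map_add, ← map_zero φ]
    exact congrArg φ (Subtype.ext (h.jacobi i j l x hx y hy z hz))
  · rintro i j l _ ⟨x, hx, rfl⟩ _ ⟨y, hy, rfl⟩ _ ⟨z, hz, rfl⟩
    simp only [hb, hm]
    rw [hu, ← map_add]
    exact congrArg φ (Subtype.ext (h.leibniz i j l x hx y hy z hz))

/-- The projection to the part of degree `n`. -/
def ZGrading.proj (g : ZGrading k V) (n : ℤ) : V →ₗ[k] V :=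
  g.internal.scale fun m => if m = n then 1 else 0

theorem ZGrading.proj_apply (g : ZGrading k V) {m : ℤ} {x : V} (hx : x ∈ g.deg m) (n : ℤ) :
    g.proj n x = if m = n then x else 0 := by
  rw [proj, g.internal.scale_apply _ hx]
  split_ifs <;> simp

/-- A grading passes to a subquotient to which its projections pass. -/
theorem ZGrading.internal_of_surjective (g : ZGrading k V) {φ : E →ₗ[k] W}
    (hφ : Function.Surjective φ) (P : ℤ → W →ₗ[k] W)
    (hP : ∀ (n : ℤ) (x : E), ∃ h : g.proj n x ∈ E, P n (φ x) = φ ⟨g.proj n x, h⟩) :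
    DirectSum.IsInternal fun n => ((g.deg n).submoduleOf E).map φ := by
  rw [DirectSum.isInternal_submodule_iff_iSupIndep_and_iSup_eq_top]
  have hPW : ∀ m n, ∀ w ∈ ((g.deg m).submoduleOf E).map φ, P n w = if m = n then w else 0 := by
    rintro m n _ ⟨x, hx, rfl⟩
    obtain ⟨h, e⟩ := hP n x
    rw [e]
    have e' := g.proj_apply hx n
    split_ifs at e' ⊢
    · exact congrArg φ (Subtype.ext e')
    · rw [← map_zero φ]
      exact congrArg φ (Subtype.ext e')
  refine ⟨fun n => ?_, ?_⟩
  · rw [Submodule.disjoint_def]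
    intro w hw hw'
    -- The induced projection fixes `w`, as it has degree `n`, and kills it, as it lies in the sum
    -- of the other degrees.
    rw [← if_pos (rfl : n = n) (α := W) (t := w) (e := 0), ← hPW n n w hw]
    refine (iSup₂_le fun m hm w hw => ?_ :
      ⨆ m, ⨆ (_ : m ≠ n), ((g.deg m).submoduleOf E).map φ ≤ LinearMap.ker (P n)) hw'
    rw [LinearMap.mem_ker, hPW m n w hw, if_neg hm]
  · rw [eq_top_iff]
    rintro w -
    obtain ⟨⟨x, hx⟩, rfl⟩ := hφ w
    have hx' : x ∈ ⨆ n, g.deg n := by rw [g.iSup_deg]; trivial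
    obtain ⟨f, hf, hfx⟩ := (Submodule.mem_iSup_iff_exists_finsupp _ _).1 hx'
    have hproj : ∀ n, g.proj n x = f n := by
      intro n
      rw [← hfx, Finsupp.sum, map_sum, Finset.sum_eq_single n]
      · rw [g.proj_apply (hf n), if_pos rfl]
      · intro m _ hm
        rw [g.proj_apply (hf m), if_neg hm]
      · intro hn
        rw [Finsupp.notMem_support_iff.1 hn, map_zero]
    -- Homogeneous components are values of the projections, which preserve `E`.
    have hE : ∀ n, f n ∈ E := fun n => hproj n ▸ (hP n ⟨x, hx⟩).1
    have hsum : (⟨x, hx⟩ : E) = ∑ n ∈ f.support, ⟨f n, hE n⟩ := by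
      apply Subtype.ext
      rw [AddSubmonoidClass.coe_finsetSum]
      exact hfx.symm
    rw [hsum, map_sum]
    exact Submodule.sum_mem _ fun n _ => Submodule.mem_iSup_of_mem n ⟨_, hf n, rfl⟩

end subquotient
end

/-! ### Fermionic degree and conformal weight of the operations. -/

noncomputable section

open TreeSpace Cooperation

theorem DirectSum.IsInternal.apply_scale {k : Type u} {V : Type v} [Field k] [AddCommGroup V]
    [Module k V] {ι : Type*} [DecidableEq ι] {F : ι → Submodule k V} (hF : DirectSum.IsInternal F)
    {T : V →ₗ[k] V} (hT : ∀ i, ∀ x ∈ F i, T x ∈ F i) (f : ι → k) (x : V) :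
    T (hF.scale f x) = hF.scale f (T x) := by
  suffices T ∘ₗ hF.scale f = hF.scale f ∘ₗ T from LinearMap.congr_fun this x
  refine hF.hom_ext fun i x hx => ?_
  rw [LinearMap.comp_apply, LinearMap.comp_apply, hF.scale_apply _ hx, hF.scale_apply _ (hT i x hx),
    map_smul]

namespace TopologicalVertexAlgebra

variable {k : Type u} {V : Type v} [Field k] [CharZero k] [AddCommGroup V] [Module k V]
variable {A : TopologicalVertexAlgebra k V}

section fermionic

theorem J_mem_comp : A.J ∈ A.comp (1, ((0 : ℤ) : ZMod 2)) := by
  rw [Int.cast_zero]; exact A.J_mem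

theorem mem_deg {n : ℤ} {x : V} : x ∈ A.fermionic.deg n ↔ A.op 0 A.J x = (n : k) • x :=
  Module.End.mem_eigenspace_iff

/-- The fermionic degree operator is a derivation of every product. -/
theorem J_op (n : ℤ) (x y : V) :
    A.op 0 A.J (A.op n x y) = A.op n (A.op 0 A.J x) y + A.op n x (A.op 0 A.J y) := by
  suffices (A.op n).compr₂ (A.op 0 A.J) = A.op n ∘ₗ A.op 0 A.J +
      (A.op n).compl₁₂ LinearMap.id (A.op 0 A.J) from LinearMap.congr_fun₂ this x y
  refine A.hom_ext fun i a x hx => LinearMap.ext fun y => ?_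
  have := A.op_zero_op J_mem_comp hx n y
  rw [zero_mul, ksign_zero, one_smul, add_comm] at this
  exact this

theorem op_mem_deg (n : ℤ) {a b : ℤ} {x y : V} (hx : x ∈ A.fermionic.deg a)
    (hy : y ∈ A.fermionic.deg b) : A.op n x y ∈ A.fermionic.deg (a + b) := by
  rw [mem_deg] at *
  rw [J_op, hx, hy, map_smul, map_smul, LinearMap.smul_apply, ← add_smul, Int.cast_add]

theorem differential_mem_deg {a : ℤ} {x : V} (hx : x ∈ A.fermionic.deg a) :
    A.differential x ∈ A.fermionic.deg (a + 1) := by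
  rw [add_comm]
  exact op_mem_deg 0 (mem_deg.2 (by rw [A.J_Q, Int.cast_one, one_smul])) hx

theorem G_op_mem_deg (n : ℤ) {a : ℤ} {x : V} (hx : x ∈ A.fermionic.deg a) :
    A.op n A.G x ∈ A.fermionic.deg (a - 1) := by
  rw [sub_eq_neg_add]
  exact op_mem_deg n (mem_deg.2 (by rw [A.J_G, Int.cast_neg, Int.cast_one, neg_one_smul])) hx

theorem J_mem_of_mem_comp (ip : ℤ × ZMod 2) (x : V) (hx : x ∈ A.comp ip) :
    A.op 0 A.J x ∈ A.comp ip := by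
  obtain ⟨i, p⟩ := ip
  have := A.op_mem 0 1 i 0 p _ A.J_mem x hx
  rwa [zero_add, show 1 + i - 0 - 1 = i by ring] at this

/-- `J_(0)` preserves every component, hence commutes with rescalings of them; in particular the
weight projection and the inverse weight preserve the fermionic degree. -/
theorem scale_mem_deg (f : ℤ × ZMod 2 → k) {a : ℤ} {x : V} (hx : x ∈ A.fermionic.deg a) :
    A.internal.scale f x ∈ A.fermionic.deg a := by
  rw [mem_deg] at *
  rw [A.internal.apply_scale J_mem_of_mem_comp, hx, map_smul]

theorem contraction_mem_deg {a : ℤ} {x : V} (hx : x ∈ A.fermionic.deg a) :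
    A.contraction x ∈ A.fermionic.deg (a - 1) :=
  G_op_mem_deg 1 (scale_mem_deg _ hx)

theorem ops_mem_deg (o : Cooperation) {a b : ℤ} {x y : V} (hx : x ∈ A.fermionic.deg a)
    (hy : y ∈ A.fermionic.deg b) : A.ops o x y ∈ A.fermionic.deg (a + b - 1 + o.count) := by
  cases o
  · have := op_mem_deg 0 (G_op_mem_deg 0 hx) hy
    rwa [show a - 1 + b = a + b - 1 + 0 by ring] at this
  · have := op_mem_deg (-1) hx hy
    rwa [← sub_add_cancel (a + b) 1] at this

theorem zeroOps_mem_deg (o : Cooperation) {a b : ℤ} {x y : V} (hx : x ∈ A.fermionic.deg a)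
    (hy : y ∈ A.fermionic.deg b) : A.zeroOps o x y ∈ A.fermionic.deg (a + b - 1 + o.count) :=
  ops_mem_deg o (scale_mem_deg _ hx) (scale_mem_deg _ hy)

/-- The operations on the part of weight zero form a Gerstenhaber algebra. -/
theorem zeroOps_isGerstenhaberAlgebra : IsGerstenhaberAlgebra A.fermionic.deg
    (A.zeroOps .cobracket) (A.zeroOps .coproduct ∘ₗ A.fermionic.sign) :=
  A.zeroOps_isSymmetricGerstenhaber.isGerstenhaberAlgebra
    (fun a b x hx y hy => by
      simpa only [count, sub_add_cancel] using zeroOps_mem_deg .cobracket hx hy)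
    (fun a b x hx y hy => by
      simpa only [count, add_zero] using zeroOps_mem_deg .coproduct hx hy)

end fermionic

section conformal

theorem conformal_le {s : ℤ} {S : Submodule k V}
    (h : ∀ a : ℤ, ∀ x ∈ A.comp (s, (a : ZMod 2)), x ∈ S) : A.conformal s ≤ S :=
  iSup_le fun p x hx => by
    obtain ⟨a, rfl⟩ := exists_intCast_zmod_two p
    exact h a x hx

theorem mem_conformal {s : ℤ} {p : ZMod 2} {x : V} (hx : x ∈ A.comp (s, p)) : x ∈ A.conformal s :=
  Submodule.mem_iSup_of_mem p hx

theorem map_mem_conformal {f : V →ₗ[k] V} {s t : ℤ}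
    (h : ∀ a : ℤ, ∀ x ∈ A.comp (s, (a : ZMod 2)), ∃ p, f x ∈ A.comp (t, p)) {x : V}
    (hx : x ∈ A.conformal s) : f x ∈ A.conformal t :=
  conformal_le (S := (A.conformal t).comap f)
    (fun a x hx => (h a x hx).elim fun _ hp => mem_conformal hp) hx

theorem sign_mem_conformal (s : ℤ) (x : V) (hx : x ∈ A.conformal s) :
    A.fermionic.sign x ∈ A.conformal s :=
  map_mem_conformal (fun _ _ hx => ⟨_, sign_mem_comp hx⟩) hx

theorem differential_mem_conformal {s : ℤ} {x : V} (hx : x ∈ A.conformal s) :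
    A.differential x ∈ A.conformal s :=
  map_mem_conformal (fun _ _ hx => ⟨_, differential_mem hx⟩) hx

theorem contraction_mem_conformal {s : ℤ} {x : V} (hx : x ∈ A.conformal s) :
    A.contraction x ∈ A.conformal s :=
  map_mem_conformal (fun _ _ hx => ⟨_, contraction_mem hx⟩) hx

theorem ops_mem_conformal (o : Cooperation) {s t : ℤ} {x y : V} (hx : x ∈ A.conformal s)
    (hy : y ∈ A.conformal t) : A.ops o x y ∈ A.conformal (s + t) := by
  refine conformal_le (S := (A.conformal (s + t)).comap ((A.ops o).flip y)) (fun a x hx => ?_) hx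
  refine map_mem_conformal (f := A.ops o x) (fun b y hy => ?_) hy
  cases o
  · exact ⟨_, preBracket_mem hx hy⟩
  · exact ⟨_, mul_mem hx hy⟩

theorem contraction_eq_of_mem_conformal {s : ℤ} {x : V} (hx : x ∈ A.conformal s) :
    A.contraction x = (s : k)⁻¹ • A.homotopy x :=
  conformal_le (S := LinearMap.eqLocus A.contraction ((s : k)⁻¹ • A.homotopy))
    (fun _ _ hx => contraction_apply hx) hx

theorem weightZero_mem_conformal (x : V) : A.weightZero x ∈ A.conformal 0 := by
  suffices (⊤ : Submodule k V) ≤ (A.conformal 0).comap A.weightZero from this trivial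
  rw [← A.internal.submodule_iSup_eq_top]
  refine iSup_le fun ip x hx => ?_
  rw [Submodule.mem_comap, weightZero_apply hx]
  split_ifs with h
  · obtain ⟨i, p⟩ := ip
    obtain rfl : i = 0 := h
    exact mem_conformal hx
  · exact zero_mem _

theorem weightZero_eq_self {x : V} (hx : x ∈ A.conformal 0) : A.weightZero x = x :=
  conformal_le (S := LinearMap.eqLocus A.weightZero LinearMap.id)
    (fun _ _ hx => (weightZero_apply hx).trans (if_pos rfl)) hx

theorem zeroOps_eq_ops (o : Cooperation) {x y : V} (hx : x ∈ A.conformal 0)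
    (hy : y ∈ A.conformal 0) : A.zeroOps o x y = A.ops o x y := by
  rw [zeroOps_apply, weightZero_eq_self hx, weightZero_eq_self hy]

theorem proj_weightZero (n : ℤ) (x : V) :
    A.fermionic.proj n (A.weightZero x) = A.weightZero (A.fermionic.proj n x) :=
  (A.fermionic.internal.apply_scale (fun _ _ hx => scale_mem_deg _ hx) _ x).symm

theorem proj_mem_conformal (n : ℤ) {x : V} (hx : x ∈ A.conformal 0) :
    A.fermionic.proj n x ∈ A.conformal 0 := by
  rw [← weightZero_eq_self hx, proj_weightZero]
  exact weightZero_mem_conformal _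

theorem proj_differential (n : ℤ) (x : V) :
    A.fermionic.proj (n + 1) (A.differential x) = A.differential (A.fermionic.proj n x) := by
  suffices A.fermionic.proj (n + 1) ∘ₗ A.differential = A.differential ∘ₗ A.fermionic.proj n from
    LinearMap.congr_fun this x
  refine A.fermionic.internal.hom_ext fun m x hx => ?_
  rw [LinearMap.comp_apply, LinearMap.comp_apply, A.fermionic.proj_apply hx,
    A.fermionic.proj_apply (differential_mem_deg hx)]
  simp only [add_left_inj]
  split_ifs
  · rfl
  · rw [map_zero]

end conformal

section symmetrize

/-- A form without homogeneity assumptions, so that arbitrary vectors of weight zero and arbitrary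
cocycles can be inserted. -/
theorem symmetrize_eq (B : V →ₗ[k] V →ₗ[k] V) (x y : V) :
    A.symmetrize B x y = (2 : k)⁻¹ • (B x y + (2 : k)⁻¹ • (B y x + B y (A.fermionic.sign x)
      + B (A.fermionic.sign y) x - B (A.fermionic.sign y) (A.fermionic.sign x))) := by
  simp [symmetrize, koszulFlip_apply_tmul]

theorem symmetrize_zeroOps (o : Cooperation) : A.symmetrize (A.zeroOps o) = A.zeroOps o := by
  refine A.fermionic.internal.hom_ext fun a x hx => A.fermionic.internal.hom_ext fun b y hy => ?_
  rw [A.symmetrize_apply _ hx hy]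
  have h := A.zeroOps_isSymmetricGerstenhaber.symm o _ _ _ _ (ZGrading.hasParity_of_mem hx)
    (ZGrading.hasParity_of_mem hy)
  rw [ksign] at h
  rw [← h, ← two_smul k, smul_smul, inv_mul_cancel₀ two_ne_zero, one_smul]

theorem symmetrize_ops_eq_zeroOps (o : Cooperation) {x y : V} (hx : x ∈ A.conformal 0)
    (hy : y ∈ A.conformal 0) : A.symmetrize (A.ops o) x y = A.zeroOps o x y := by
  have hx' := sign_mem_conformal _ _ hx
  have hy' := sign_mem_conformal _ _ hy
  rw [← symmetrize_zeroOps, symmetrize_eq, symmetrize_eq, zeroOps_eq_ops o hx hy,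
    zeroOps_eq_ops o hy hx, zeroOps_eq_ops o hy hx', zeroOps_eq_ops o hy' hx,
    zeroOps_eq_ops o hy' hx']

/-- The product and the bracket make the part of weight zero a Gerstenhaber algebra. -/
theorem exists_isGerstenhaberAlgebra_conformal_zero :
    ∃ mul brac : A.conformal 0 →ₗ[k] A.conformal 0 →ₗ[k] A.conformal 0,
      (∀ x y, (mul x y : V) = A.product x y) ∧ (∀ x y, (brac x y : V) = A.bracket x y) ∧
      IsGerstenhaberAlgebra (fun n => (A.fermionic.deg n).submoduleOf (A.conformal 0)) mul brac := by
  have hmem : ∀ o x y, A.zeroOps o x y ∈ A.conformal 0 := fun o x y =>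
    ops_mem_conformal (s := 0) (t := 0) o (weightZero_mem_conformal x) (weightZero_mem_conformal y)
  -- Composing with the projection supplies the codomain; it changes nothing, as the values already
  -- have weight zero.
  let op₀ : (V →ₗ[k] V →ₗ[k] V) → A.conformal 0 →ₗ[k] A.conformal 0 →ₗ[k] A.conformal 0 :=
    fun B => (B.compl₁₂ (A.conformal 0).subtype (A.conformal 0).subtype).compr₂
      (A.weightZero.codRestrict (A.conformal 0) weightZero_mem_conformal)
  have hop : ∀ (o : Cooperation) (f : V →ₗ[k] V) (x y : A.conformal 0),
      (op₀ (A.zeroOps o ∘ₗ f) x y : V) = A.zeroOps o (f x) y := fun o f x y =>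
    weightZero_eq_self (hmem o (f x) y)
  have hint := A.fermionic.internal_of_surjective (φ := LinearMap.id (M := A.conformal 0))
    Function.surjective_id (fun n => (A.fermionic.proj n).restrict fun _ => proj_mem_conformal n)
    (fun n x => ⟨proj_mem_conformal n x.2, rfl⟩)
  refine ⟨op₀ (A.zeroOps .cobracket ∘ₗ LinearMap.id), op₀ (A.zeroOps .coproduct ∘ₗ A.fermionic.sign),
    fun x y => ?_, fun x y => ?_, ?_⟩
  · rw [hop]
    exact (symmetrize_ops_eq_zeroOps .cobracket x.2 y.2).symm
  · rw [hop]
    exact (symmetrize_ops_eq_zeroOps .coproduct (sign_mem_conformal _ _ x.2) y.2).symm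
  · have := zeroOps_isGerstenhaberAlgebra.of_surjective (φ := LinearMap.id (M := A.conformal 0))
      Function.surjective_id hint
      (fun x y => ⟨hmem _ x y, Subtype.ext (hop .cobracket LinearMap.id x y)⟩)
      (fun x y => ⟨hmem _ _ y, Subtype.ext (hop .coproduct A.fermionic.sign x y)⟩)
    simpa only [Submodule.map_id] using this

end symmetrize

end TopologicalVertexAlgebra
end

/-! ### Elements of length one and two, and the transferred structure. -/

noncomputable section

open TreeSpace Cooperation

namespace TreeSpace

variable {k : Type u} {V : Type v} [Field k] [AddCommGroup V] [Module k V] {g : ZGrading k V}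

theorem isGerstenhaberSubcoalgebra_range_leafMap :
    IsGerstenhaberSubcoalgebra g (LinearMap.range (leafMap (k := k) (V := V))) := by
  have h : ∀ o, ∀ x ∈ LinearMap.range (leafMap (k := k) (V := V)), split o x = 0 := by
    rintro o _ ⟨v, rfl⟩
    exact split_leafMap o v
  refine ⟨fun o x hx => ?_, fun x hx => ?_, fun x hx => ?_, fun x hx => ?_, fun x hx y hy => ?_,
    fun x hx => ?_⟩
  · rw [h o x hx]; exact zero_mem _
  all_goals simp [h _ x hx, *]

theorem single_mem_gerCofree (v : V) : single v ∈ gerCofree g :=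
  le_sSup (α := Submodule k (TreeSpace k V)) isGerstenhaberSubcoalgebra_range_leafMap
    ⟨v, leafMap_apply v⟩

theorem pair_eq_join (o : Cooperation) (v w : V) :
    pair (k := k) o v w = join o (leafMap v ⊗ₜ leafMap w) := by
  have h := pureTree_node (k := k) o .leaf .leaf (fun _ => v) (fun _ => w)
  rw [pureTree_leaf, pureTree_leaf] at h
  rw [← h, pair]
  congr 1
  funext i
  change Fin 2 at i
  fin_cases i <;> rfl

/-- The graded symmetric corolla with leaves `v` and `w`. -/
theorem pair_add_pair_mem_gerCofree [CharZero k] (o : Cooperation) {a b : ℤ} {v w : V}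
    (hv : v ∈ g.deg a) (hw : w ∈ g.deg b) :
    pair (k := k) o v w + (a * b).negOnePow • pair o w v ∈ gerCofree g := by
  set x := pair (k := k) o v w + (a * b).negOnePow • pair o w v with hx
  have hxj : x = join o (leafMap v ⊗ₜ leafMap w + ksign k (a * b) • leafMap w ⊗ₜ leafMap v) := by
    rw [hx, pair_eq_join, pair_eq_join, ← ksign_smul (k := k), map_add, map_smul]
  have hsplit : ∀ o', split o' x = if o = o' then
      leafMap v ⊗ₜ leafMap w + ksign k (a * b) • leafMap w ⊗ₜ leafMap v else 0 := fun o' => by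
    rw [hxj, split_join]
  set R := LinearMap.range (leafMap (k := k) (V := V)) with hR
  have hl : ∀ v : V, leafMap (k := k) v ∈ R ⊔ Submodule.span k {x} := fun v =>
    Submodule.mem_sup_left ⟨v, rfl⟩
  have hsign : ∀ {c : ℤ} {u : V}, u ∈ g.deg c →
      sign g (leafMap u) = ((c.negOnePow : ℤ) : k) • leafMap u := fun hu => by
    rw [sign_leafMap, g.sign_apply hu, map_smul]
  have hflip : ∀ o', koszulFlip (sign g) (split o' x) = split o' x := by
    intro o'
    rw [hsplit]
    split_ifs
    · rw [map_add, map_smul, koszulFlip_tmul _ (hsign hv) (hsign hw),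
        koszulFlip_tmul _ (hsign hw) (hsign hv), mul_comm b a]
      change ksign k (a * b) • _ + ksign k (a * b) • ksign k (a * b) • _ = _
      rw [smul_smul, ksign_mul_self, one_smul, add_comm]
    · rw [map_zero]
  -- The pieces of `x` are leaves, so every double cut vanishes and all ternary identities become
  -- trivial.
  have h3 : ∀ (f : TreeSpace k V →ₗ[k] TreeSpace k V) o' o'',
      TensorProduct.map (split o') f (split o'' x) = 0 ∧
      TensorProduct.map f (split o') (split o'' x) = 0 := by
    intro f o' o''
    rw [hsplit]
    split_ifs <;> simp
  -- The leaves are adjoined because the cuts of `x` must stay in the subspace.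
  have hS : IsGerstenhaberSubcoalgebra g (R ⊔ Submodule.span k {x}) := by
    have hR' := isGerstenhaberSubcoalgebra_range_leafMap (g := g)
    have key : ∀ {N : Type (max u v)} [AddCommGroup N] [Module k N] (f f' : TreeSpace k V →ₗ[k] N),
        (∀ y ∈ R, f y = f' y) → f x = f' x → ∀ y ∈ R ⊔ Submodule.span k {x}, f y = f' y := by
      intro N _ _ f f' h h' y hy
      refine (sup_le h ?_ : R ⊔ Submodule.span k {x} ≤ LinearMap.eqLocus f f') hy
      exact (Submodule.span_singleton_le_iff_mem _ _).2 h'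
    have h0 : ∀ o, ∀ y ∈ R, split o y = 0 := by
      rintro o _ ⟨v, rfl⟩
      exact split_leafMap o v
    refine ⟨fun o' y hy => ?_,
      key (koszulFlip (sign g) ∘ₗ split .coproduct) (split .coproduct) hR'.cocommutative
        (hflip .coproduct),
      key ((TensorProduct.assoc k _ _ _).toLinearMap ∘ₗ
          TensorProduct.map (split .coproduct) LinearMap.id ∘ₗ split .coproduct)
        (TensorProduct.map LinearMap.id (split .coproduct) ∘ₗ split .coproduct)
        hR'.coassociative ?_,
      key (koszulFlip (sign g) ∘ₗ split .cobracket) (split .cobracket) hR'.cosymmetric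
        (hflip .cobracket), ?_,
      key (TensorProduct.map LinearMap.id (split .coproduct) ∘ₗ split .cobracket)
        ((TensorProduct.assoc k (TreeSpace k V) (TreeSpace k V) (TreeSpace k V)).toLinearMap ∘ₗ
          TensorProduct.map (split .cobracket) LinearMap.id ∘ₗ split .coproduct
          + koszulFlip₁₂ (sign g) ∘ₗ
            TensorProduct.map (sign g) (split .cobracket) ∘ₗ split .coproduct)
        hR'.coLeibniz ?_⟩
    · refine (sup_le ?_ ?_ : R ⊔ Submodule.span k {x} ≤ (LinearMap.range (TensorProduct.mapIncl
        (R ⊔ Submodule.span k {x}) (R ⊔ Submodule.span k {x}))).comap (split o')) hy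
      · intro y hy
        rw [Submodule.mem_comap, h0 o' y hy]
        exact zero_mem _
      · rw [Submodule.span_singleton_le_iff_mem, Submodule.mem_comap, hsplit]
        split_ifs
        · exact add_mem ⟨⟨_, hl v⟩ ⊗ₜ ⟨_, hl w⟩, rfl⟩
            (Submodule.smul_mem _ _ ⟨⟨_, hl w⟩ ⊗ₜ ⟨_, hl v⟩, rfl⟩)
        · exact zero_mem _
    · simp only [LinearMap.comp_apply, (h3 _ _ _).1, (h3 _ _ _).2, map_zero]
    · rintro y hy _ rfl
      have : TensorProduct.map (split .cobracket) LinearMap.id (split .cobracket y) = 0 :=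
        key (TensorProduct.map (split .cobracket) LinearMap.id ∘ₗ split .cobracket) 0
          (fun y hy => by
            rw [LinearMap.comp_apply, h0 _ y hy, map_zero]; rfl) (h3 _ _ _).1 y hy
      rw [this]
      simp only [map_zero, add_zero]
    · simp only [LinearMap.comp_apply, LinearMap.add_apply, (h3 _ _ _).1, (h3 _ _ _).2, map_zero,
        add_zero]
  exact le_sSup (α := Submodule k (TreeSpace k V)) hS
    (Submodule.mem_sup_right (Submodule.mem_span_singleton_self x))

end TreeSpace

namespace HomotopyGerstenhaber

variable {k : Type u} {V : Type v} [Field k] [CharZero k] [AddCommGroup V] [Module k V]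
variable {g : ZGrading k V} (H : HomotopyGerstenhaber g)

theorem oddLeibniz_restrict (o : Cooperation) (x : gerCofree g) :
    oddLeibniz g (H.D.restrict fun _ => H.D_mem) (cooperation g o x) =
      oddExt (TreeSpace.sign g) H.D (split o (x : TreeSpace k V)) := by
  have : oddLeibniz g (H.D.restrict fun _ => H.D_mem) =
      oddExt (TreeSpace.sign g) H.D ∘ₗ TensorProduct.mapIncl (gerCofree g) (gerCofree g) :=
    TensorProduct.ext' fun x y => by simp [oddLeibniz, oddExt]
  rw [this, LinearMap.comp_apply, mapIncl_cooperation]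

/-- The homotopy Gerstenhaber structure obtained by transfer. -/
def gInfinityStructure (hq : ∀ a, ∀ v ∈ g.deg a, H.q v ∈ g.deg (a + 1))
    (hh : ∀ a, ∀ v ∈ g.deg a, H.h v ∈ g.deg (a - 1))
    (hb : ∀ o a b, ∀ v ∈ g.deg a, ∀ w ∈ g.deg b, H.b o v w ∈ g.deg (a + b - 1 + o.count)) :
    GInfinityStructure g where
  D := H.D.restrict fun _ => H.D_mem
  degree_one n x hx := by
    rw [degree_eq] at hx ⊢
    refine H.D_mem_gradedPart (fun a v hv => ?_) hq hh (fun o a b v hv w hw => ?_) hx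
    · rw [g.sign_apply hv]
      exact Submodule.smul_mem _ _ hv
    · convert hb o a b v hv w hw using 2
      ring
  square_zero x := Subtype.ext (H.D_D x.2)
  coderivation_coproduct x := by
    rw [oddLeibniz_restrict]
    exact (split_coder _ _ _ _).trans (one_smul _ _)
  coderivation_cobracket x := by
    rw [oddLeibniz_restrict]
    exact (split_coder _ _ _ _).trans (neg_one_smul _ _)

variable {hq : ∀ a, ∀ v ∈ g.deg a, H.q v ∈ g.deg (a + 1)}
  {hh : ∀ a, ∀ v ∈ g.deg a, H.h v ∈ g.deg (a - 1)}
  {hb : ∀ o a b, ∀ v ∈ g.deg a, ∀ w ∈ g.deg b, H.b o v w ∈ g.deg (a + b - 1 + o.count)}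

theorem operation_eq (x : gerCofree g) :
    (H.gInfinityStructure hq hh hb).operation x = H.total x :=
  toLeaf_coder _ _ _

theorem total_pair_add_pair (o : Cooperation) (a : ℤ) (v w : V) :
    H.total (pair o v w + a.negOnePow • pair o w v) = H.b o v w + ksign k a • H.b o w v := by
  rw [← ksign_smul (k := k), map_add, map_smul, pair_eq_join, pair_eq_join, total_join_leafMap,
    total_join_leafMap]

theorem hasDifferential : (H.gInfinityStructure hq hh hb).HasDifferential H.q := fun v =>
  ⟨single_mem_gerCofree v, (operation_eq H _).trans <|
    (congrArg H.total (leafMap_apply v).symm).trans (H.total_leafMap v)⟩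

theorem isObstruction (l : ℕ) (x : gerCofree g) :
    (H.gInfinityStructure hq hh hb).IsObstruction l x (H.obstruction l x) :=
  ⟨fun j => ⟨lengthProj j (H.D x), lengthProj_mem_gerCofree (H.D_mem x.2) j⟩, fun _ => rfl, by
    simp only [operation_eq, obstruction]⟩

end HomotopyGerstenhaber
end

/-! ### The operations on BRST cohomology. -/

noncomputable section

open TreeSpace Cooperation

namespace TopologicalVertexAlgebra

variable {k : Type u} {V : Type v} [Field k] [CharZero k] [AddCommGroup V] [Module k V]
variable {A : TopologicalVertexAlgebra k V}

section cohomology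

theorem differential_sign {x : V} (hx : x ∈ LinearMap.ker A.differential) :
    A.fermionic.sign x ∈ LinearMap.ker A.differential := by
  rw [LinearMap.mem_ker] at *
  have h := A.homotopyGerstenhaber.q_sign x
  change A.differential _ = -A.fermionic.sign (A.differential x) at h
  rw [h, hx, map_zero, neg_zero]

theorem range_le_ker : LinearMap.range A.differential ≤ LinearMap.ker A.differential := by
  rintro _ ⟨x, rfl⟩
  exact A.Q_sq x

theorem ops_mem_ker (o : Cooperation) {x y : V} (hx : x ∈ LinearMap.ker A.differential)
    (hy : y ∈ LinearMap.ker A.differential) : A.ops o x y ∈ LinearMap.ker A.differential := by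
  have h := ops_q (A := A) o x y
  rwa [LinearMap.mem_ker.1 hx, LinearMap.mem_ker.1 hy, map_zero, map_zero, LinearMap.zero_apply,
    add_zero, smul_zero, add_zero] at h

theorem ops_differential_left (o : Cooperation) (x : V) {y : V}
    (hy : y ∈ LinearMap.ker A.differential) :
    A.ops o (A.differential x) y ∈ LinearMap.range A.differential := by
  have h := ops_q (A := A) o x y
  rw [LinearMap.mem_ker.1 hy, map_zero, add_zero, add_eq_zero_iff_eq_neg] at h
  refine ⟨-(sgn k o • A.ops o x y), ?_⟩
  rw [map_neg, map_smul, h, smul_neg, neg_neg, smul_smul, sgn_mul_self, one_smul]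

theorem ops_differential_right (o : Cooperation) {x : V} (hx : x ∈ LinearMap.ker A.differential)
    (y : V) : A.ops o x (A.differential y) ∈ LinearMap.range A.differential := by
  -- Starting from `sign x`, the parity operator in the derivation rule is undone.
  have h := ops_q (A := A) o (A.fermionic.sign x) y
  rw [LinearMap.mem_ker.1 (differential_sign hx), map_zero, LinearMap.zero_apply, zero_add,
    A.fermionic.sign_sign, add_eq_zero_iff_eq_neg] at h
  refine ⟨-(sgn k o • A.ops o (A.fermionic.sign x) y), ?_⟩
  rw [map_neg, map_smul, h, smul_neg, neg_neg, smul_smul, sgn_mul_self, one_smul]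

/-- The contraction of a cocycle is a primitive of its positive-weight part, so all cohomology is
represented in weight zero. -/
theorem sub_weightZero_mem_range {x : V} (hx : x ∈ LinearMap.ker A.differential) :
    x - A.weightZero x ∈ LinearMap.range A.differential := by
  refine ⟨A.contraction x, ?_⟩
  rw [← differential_contraction, LinearMap.mem_ker.1 hx, map_zero, add_zero]

theorem weightZero_mem_ker {x : V} (hx : x ∈ LinearMap.ker A.differential) :
    A.weightZero x ∈ LinearMap.ker A.differential := by
  rw [← sub_sub_cancel x (A.weightZero x)]
  exact sub_mem hx (range_le_ker (sub_weightZero_mem_range hx))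

/-- Replace one argument at a time by its weight-zero part; each replacement changes the result by
an exact term. -/
theorem ops_sub_zeroOps_mem_range (o : Cooperation) {x y : V}
    (hx : x ∈ LinearMap.ker A.differential) (hy : y ∈ LinearMap.ker A.differential) :
    A.zeroOps o x y - A.ops o x y ∈ LinearMap.range A.differential := by
  obtain ⟨x', hx'⟩ := sub_weightZero_mem_range hx
  obtain ⟨y', hy'⟩ := sub_weightZero_mem_range hy
  have : A.zeroOps o x y - A.ops o x y =
      -(A.ops o (A.differential x') y + A.ops o (A.weightZero x) (A.differential y')) := by
    rw [hx', hy', zeroOps_apply]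
    simp only [map_sub, LinearMap.sub_apply]
    abel
  rw [this]
  exact neg_mem (add_mem (ops_differential_left o x' hy)
    (ops_differential_right o (weightZero_mem_ker hx) y'))

/-- The weight-zero operations equal their own symmetrization, so the difference is a combination of
the exact differences from `ops_sub_zeroOps_mem_range`, evaluated on cocycles and their images under
the parity operator. -/
theorem zeroOps_sub_symmetrize_mem_range (o : Cooperation) {x y : V}
    (hx : x ∈ LinearMap.ker A.differential) (hy : y ∈ LinearMap.ker A.differential) :
    A.zeroOps o x y - A.symmetrize (A.ops o) x y ∈ LinearMap.range A.differential := by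
  have hx' := differential_sign hx
  have hy' := differential_sign hy
  have h := @ops_sub_zeroOps_mem_range k V _ _ _ _ A o
  rw [← symmetrize_zeroOps, symmetrize_eq, symmetrize_eq, ← smul_sub, add_sub_add_comm, ← smul_sub,
    sub_sub_sub_comm, add_sub_add_comm, add_sub_add_comm]
  exact Submodule.smul_mem _ _ (add_mem (h hx hy) (Submodule.smul_mem _ _
    (sub_mem (add_mem (add_mem (h hy hx) (h hy hx')) (h hy' hx)) (h hy' hx'))))

theorem exists_induces {B : V →ₗ[k] V →ₗ[k] V}
    (hker : ∀ x ∈ LinearMap.ker A.differential, ∀ y ∈ LinearMap.ker A.differential,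
      B x y ∈ LinearMap.ker A.differential)
    (hl : ∀ x, ∀ y ∈ LinearMap.ker A.differential,
      B (A.differential x) y ∈ LinearMap.range A.differential)
    (hr : ∀ x ∈ LinearMap.ker A.differential, ∀ y,
      B x (A.differential y) ∈ LinearMap.range A.differential) :
    ∃ mH, A.Induces B mH := by
  let f : LinearMap.ker A.differential →ₗ[k] LinearMap.ker A.differential →ₗ[k] A.Cohomology :=
    LinearMap.mk₂ k (fun x y => A.cls ⟨B x y, hker x x.2 y y.2⟩)
      (fun x x' y => by
        rw [← map_add]
        exact congrArg A.cls (Subtype.ext (LinearMap.map_add₂ B (x : V) x' y)))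
      (fun c x y => by
        rw [← map_smul]
        exact congrArg A.cls (Subtype.ext (LinearMap.map_smul₂ B c (x : V) y)))
      (fun x y y' => by
        rw [← map_add]
        exact congrArg A.cls (Subtype.ext (map_add (B x) (y : V) y')))
      (fun c x y => by
        rw [← map_smul]
        exact congrArg A.cls (Subtype.ext (map_smul (B x) c (y : V))))
  let f₁ : A.Cohomology →ₗ[k] LinearMap.ker A.differential →ₗ[k] A.Cohomology :=
    Submodule.liftQ _ f (by
      rintro ⟨_, hx⟩ ⟨x, rfl⟩
      exact LinearMap.ext fun y => (Submodule.Quotient.mk_eq_zero _).2 (hl x y y.2))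
  let f₂ : A.Cohomology →ₗ[k] A.Cohomology →ₗ[k] A.Cohomology :=
    Submodule.liftQ _ f₁.flip (by
      rintro ⟨_, hy⟩ ⟨y, rfl⟩
      refine LinearMap.ext fun x => ?_
      obtain ⟨x, rfl⟩ := Submodule.Quotient.mk_surjective _ x
      exact (Submodule.Quotient.mk_eq_zero _).2 (hr x x.2 y))
  exact ⟨f₂.flip, fun x y => ⟨hker x x.2 y y.2, rfl⟩⟩

theorem Induces.congr {B B' : V →ₗ[k] V →ₗ[k] V}
    {mH : A.Cohomology →ₗ[k] A.Cohomology →ₗ[k] A.Cohomology} (h : A.Induces B mH)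
    (hB : ∀ x ∈ LinearMap.ker A.differential, ∀ y ∈ LinearMap.ker A.differential,
      B x y - B' x y ∈ LinearMap.range A.differential) : A.Induces B' mH := by
  intro x y
  obtain ⟨hx, e⟩ := h x y
  have hd := hB x x.2 y y.2
  refine ⟨?_, e.trans ((Submodule.Quotient.eq _).2 hd)⟩
  rw [← sub_sub_cancel (B x y) (B' x y)]
  exact sub_mem hx (range_le_ker hd)

theorem isInternal_cohomologyDeg : DirectSum.IsInternal A.cohomologyDeg := by
  have hZ : ∀ n, ∀ x ∈ LinearMap.ker A.differential,
      A.fermionic.proj n x ∈ LinearMap.ker A.differential := fun n x hx => by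
    rw [LinearMap.mem_ker, ← proj_differential, LinearMap.mem_ker.1 hx, map_zero]
  refine A.fermionic.internal_of_surjective (φ := A.cls) (Submodule.mkQ_surjective _)
    (fun n => Submodule.mapQ _ _ ((A.fermionic.proj n).restrict (hZ n)) ?_)
    (fun n x => ⟨hZ n x x.2, rfl⟩)
  rintro ⟨_, hx⟩ ⟨x, rfl⟩
  -- The differential raises the degree by one, so a primitive of the degree `n` part is the part of
  -- degree `n - 1`.
  refine ⟨A.fermionic.proj (n - 1) x, ?_⟩
  rw [← proj_differential, sub_add_cancel]
  rfl

/-- The weight-zero operations satisfy the identities strictly on all of `V`, so these descend to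
cohomology without any further homotopies. -/
theorem isGerstenhaberAlgebra_of_induces
    {mulH bracH : A.Cohomology →ₗ[k] A.Cohomology →ₗ[k] A.Cohomology}
    (hmul : A.Induces (A.zeroOps .cobracket) mulH)
    (hbrac : A.Induces (A.zeroOps .coproduct ∘ₗ A.fermionic.sign) bracH) :
    IsGerstenhaberAlgebra A.cohomologyDeg mulH bracH :=
  zeroOps_isGerstenhaberAlgebra.of_surjective (φ := A.cls) (Submodule.mkQ_surjective _)
    isInternal_cohomologyDeg hmul hbrac

theorem exists_induces_ops (o : Cooperation) :
    ∃ mH, A.Induces (A.ops o) mH ∧ A.Induces (A.zeroOps o) mH ∧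
      A.Induces (A.symmetrize (A.ops o)) mH := by
  obtain ⟨mH, h⟩ := exists_induces (A := A) (B := A.ops o)
    (fun _ hx _ hy => ops_mem_ker _ hx hy) (fun x _ hy => ops_differential_left _ x hy)
    (fun _ hx y => ops_differential_right _ hx y)
  have h₀ : A.Induces (A.zeroOps o) mH := h.congr fun x hx y hy => by
    rw [← neg_sub]
    exact neg_mem (ops_sub_zeroOps_mem_range _ hx hy)
  exact ⟨mH, h, h₀, h₀.congr fun _ hx _ hy => zeroOps_sub_symmetrize_mem_range _ hx hy⟩

/-- The parity operator of the BRST cohomology. -/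
def cohomologySign (A : TopologicalVertexAlgebra k V) : A.Cohomology →ₗ[k] A.Cohomology :=
  Submodule.mapQ _ _ (A.fermionic.sign.restrict fun _ => differential_sign) (by
    rintro ⟨_, hx⟩ ⟨x, rfl⟩
    refine ⟨-A.fermionic.sign x, ?_⟩
    rw [map_neg]
    exact (neg_eq_iff_eq_neg).2 (A.homotopyGerstenhaber.q_sign x))

theorem Induces.comp_sign {B : V →ₗ[k] V →ₗ[k] V}
    {mH : A.Cohomology →ₗ[k] A.Cohomology →ₗ[k] A.Cohomology} (h : A.Induces B mH) :
    A.Induces (B ∘ₗ A.fermionic.sign) (mH ∘ₗ A.cohomologySign) := fun x y =>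
  h ⟨A.fermionic.sign x, differential_sign x.2⟩ y

/-- The Gerstenhaber algebra structure on the BRST cohomology. -/
theorem exists_isGerstenhaberAlgebra_cohomology :
    ∃ mulH bracH : A.Cohomology →ₗ[k] A.Cohomology →ₗ[k] A.Cohomology,
      IsGerstenhaberAlgebra A.cohomologyDeg mulH bracH ∧
      A.Induces A.lzProduct mulH ∧ A.Induces A.lzBracket bracH ∧
      A.Induces A.product mulH ∧ A.Induces A.bracket bracH := by
  obtain ⟨mulH, h, h₀, h₁⟩ := exists_induces_ops (A := A) .cobracket
  obtain ⟨bracH, h', h₀', h₁'⟩ := exists_induces_ops (A := A) .coproduct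
  exact ⟨mulH, bracH ∘ₗ A.cohomologySign, isGerstenhaberAlgebra_of_induces h₀ h₀'.comp_sign, h,
    h'.comp_sign, h₁, h₁'.comp_sign⟩

end cohomology

/-! ### The homotopy structure of a topological vertex algebra. -/

section gInfinity

variable (A)

/-- The homotopy Gerstenhaber structure of a topological vertex algebra. -/
def gInfinityStructure : GInfinityStructure A.fermionic :=
  A.homotopyGerstenhaber.gInfinityStructure (fun _ _ hx => differential_mem_deg hx)
    (fun _ _ hx => contraction_mem_deg hx)
    (fun o _ _ _ hx _ hy => Submodule.smul_mem _ _ (ops_mem_deg o hx hy))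

variable {A}

theorem operation_eq_total (x : gerCofree A.fermionic) :
    A.gInfinityStructure.operation x = A.homotopyGerstenhaber.total x :=
  HomotopyGerstenhaber.operation_eq _ x

theorem operation_pair_add_pair (o : Cooperation) {a b : ℤ} {v w : V}
    (hv : v ∈ A.fermionic.deg a) (hw : w ∈ A.fermionic.deg b) :
    ∃ h : pair o v w + (a * b).negOnePow • pair o w v ∈ gerCofree A.fermionic,
      A.gInfinityStructure.operation ⟨_, h⟩ = A.symmetrize (A.ops o) v w := by
  refine ⟨pair_add_pair_mem_gerCofree o hv hw, ?_⟩
  rw [operation_eq_total, HomotopyGerstenhaber.total_pair_add_pair, A.symmetrize_apply _ hv hw,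
    smul_add, smul_comm _ (((a * b).negOnePow : ℤ) : k)]
  rfl

theorem hasProduct : A.gInfinityStructure.HasProduct A.product :=
  fun _ _ _ hv _ hw => operation_pair_add_pair .cobracket hv hw

theorem hasBracket : A.gInfinityStructure.HasBracket A.bracket := by
  intro a b v hv w hw
  obtain ⟨h, e⟩ := operation_pair_add_pair .coproduct hv hw
  refine ⟨h, e.trans ?_⟩
  -- The sign built into the bracket cancels the one demanded by `HasBracket`.
  rw [bracket, LinearMap.comp_apply, ZGrading.hasParity_of_mem hv, map_smul, LinearMap.smul_apply,
    ← ksign_smul (k := k), smul_smul, ksign_mul_self, one_smul]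
  rfl

theorem homotopyGerstenhaber_b_mem_conformal (o : Cooperation) (s t : ℤ) (x : V)
    (hx : x ∈ A.conformal s) (y : V) (hy : y ∈ A.conformal t) :
    A.homotopyGerstenhaber.b o x y ∈ A.conformal (s + t + 0 + 0 * o.count + 0) := by
  simp only [zero_mul, add_zero]
  exact Submodule.smul_mem _ _ (ops_mem_conformal o hx hy)

theorem D_mem_weight (s : ℤ) {x : TreeSpace k V} (hx : x ∈ weight A.conformal s) :
    A.homotopyGerstenhaber.D x ∈ weight A.conformal s := by
  rw [weight_eq] at *
  rw [← add_zero s]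
  refine A.homotopyGerstenhaber.D_mem_gradedPart sign_mem_conformal (fun a v hv => ?_)
    (fun a v hv => ?_) homotopyGerstenhaber_b_mem_conformal hx
  · rw [add_zero]; exact differential_mem_conformal hv
  · rw [sub_zero]; exact contraction_mem_conformal hv

theorem total_mem_conformal (s : ℤ) {x : TreeSpace k V} (hx : x ∈ weight A.conformal s) :
    A.homotopyGerstenhaber.total x ∈ A.conformal s := by
  rw [weight_eq] at hx
  have := A.homotopyGerstenhaber.total_mem (r := 0) sign_mem_conformal
    (fun a v hv => by rw [add_zero]; exact differential_mem_conformal hv)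
    (fun a v hv => by rw [sub_zero]; exact contraction_mem_conformal hv)
    homotopyGerstenhaber_b_mem_conformal s x hx
  rwa [add_zero, sub_zero] at this

/-- The recursion for the higher operations. -/
theorem operation_eq_homotopy_obstruction {l : ℕ} (hl : 3 ≤ l) {s : ℤ} {x : gerCofree A.fermionic}
    (hx : (x : TreeSpace k V) ∈ length (k := k) (V := V) l)
    (hw : (x : TreeSpace k V) ∈ weight A.conformal s) :
    A.gInfinityStructure.operation x =
      (s : k)⁻¹ • A.homotopy (A.homotopyGerstenhaber.obstruction l x) := by
  rw [operation_eq_total]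
  have h := A.homotopyGerstenhaber.total_eq_h_obstruction hl (x : TreeSpace k V)
  rw [lengthProj_of_mem_length hx] at h
  rw [h]
  -- The contraction is `G_(1)` divided by `s` once the obstruction has weight `s`, which holds
  -- since `D` and the structure map preserve weight.
  refine contraction_eq_of_mem_conformal (neg_mem (Submodule.sum_mem _ fun j _ => ?_))
  refine total_mem_conformal s ?_
  have hD := D_mem_weight s hw
  rw [weight_eq] at hD ⊢
  exact lengthProj_mem_gradedPart j hD

end gInfinity

end TopologicalVertexAlgebra
end

theorem mainTheorem1 {k : Type*} {V : Type*} [Field k] [CharZero k] [AddCommGroup V] [Module k V]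
    (A : TopologicalVertexAlgebra k V)
    (hfin : ∀ s : ℤ, {n : ℤ | A.conformal s ⊓ A.fermionic.deg n ≠ ⊥}.Finite) :
    ∃ γ : GInfinityStructure A.fermionic,
      -- the structure extends the differential, the product and the bracket
      γ.HasDifferential A.differential ∧ γ.HasProduct A.product ∧ γ.HasBracket A.bracket ∧
      -- it preserves the conformal weight
      (∀ (s : ℤ) (x : gerCofree A.fermionic),
        (x : TreeSpace k V) ∈ TreeSpace.weight A.conformal s →
        (γ.D x : TreeSpace k V) ∈ TreeSpace.weight A.conformal s) ∧
      -- product and bracket make the part of weight zero a Gerstenhaber algebra,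
      -- and there the structure has no higher operations
      (∃ mul brac : A.conformal 0 →ₗ[k] A.conformal 0 →ₗ[k] A.conformal 0,
        (∀ x y, (mul x y : V) = A.product x y) ∧ (∀ x y, (brac x y : V) = A.bracket x y) ∧
        IsGerstenhaberAlgebra (fun n => (A.fermionic.deg n).submoduleOf (A.conformal 0)) mul brac) ∧
      (∀ (l : ℕ) (x : gerCofree A.fermionic), 3 ≤ l →
        (x : TreeSpace k V) ∈ TreeSpace.length (k := k) (V := V) l →
        (x : TreeSpace k V) ∈ TreeSpace.weight A.conformal 0 → γ.operation x = 0) ∧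
      -- the explicit recursive formula for the higher operations in positive weight
      (∀ (l : ℕ) (s : ℤ) (x : gerCofree A.fermionic), 3 ≤ l → 0 < s →
        (x : TreeSpace k V) ∈ TreeSpace.length (k := k) (V := V) l →
        (x : TreeSpace k V) ∈ TreeSpace.weight A.conformal s →
        ∃ c : V, γ.IsObstruction l x c ∧ γ.operation x = (s : k)⁻¹ • A.homotopy c) ∧
      -- on cohomology it induces the Lian-Zuckerman Gerstenhaber algebra structure
      (∃ mulH bracH : A.Cohomology →ₗ[k] A.Cohomology →ₗ[k] A.Cohomology,
        IsGerstenhaberAlgebra A.cohomologyDeg mulH bracH ∧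
        A.Induces A.lzProduct mulH ∧ A.Induces A.lzBracket bracH ∧
        A.Induces A.product mulH ∧ A.Induces A.bracket bracH) := by
  refine ⟨A.gInfinityStructure, HomotopyGerstenhaber.hasDifferential _,
    TopologicalVertexAlgebra.hasProduct, TopologicalVertexAlgebra.hasBracket,
    fun s _ hx => TopologicalVertexAlgebra.D_mem_weight s hx,
    TopologicalVertexAlgebra.exists_isGerstenhaberAlgebra_conformal_zero,
    fun l x hl hx hw => ?_, fun l s x hl _ hx hw => ⟨_, HomotopyGerstenhaber.isObstruction _ l x,
      TopologicalVertexAlgebra.operation_eq_homotopy_obstruction hl hx hw⟩,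
    TopologicalVertexAlgebra.exists_isGerstenhaberAlgebra_cohomology⟩
  -- The recursion also covers weight zero, where the factor `0⁻¹ = 0` kills all higher operations.
  rw [TopologicalVertexAlgebra.operation_eq_homotopy_obstruction hl hx hw, Int.cast_zero, inv_zero,
    zero_smul]
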